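/- Let $n\ge 1$, $1<p<\infty$, $0<\alpha<\frac np$, $\frac1q=\frac1p-\frac\alpha n$, $1<s\le\infty$ and $s'=\frac{s}{s-1}$ (with $s'=1$ if $s=\infty$). Let $\Omega$ be a function on $\mathbb R^n$ that is homogeneous of degree zero (that is, $\Omega(tx)=\Omega(x)$ for $t>0$) with $\Omega\in L_s(S^{n-1})$, and let $b\in BMO(\mathbb R^n)$, that is, $b\in L_1^{loc}(\mathbb R^n)$ and $\|b\|_*=\sup_B\frac1{|B|}\int_B|b-b_B|\,dx<\infty$, where $B$ runs over all balls and $b_B=\frac1{|B|}\int_B b$. Functions are real- or complex-valued. Define $$M_{\Omega,b,\alpha}f(x)=\sup_{t>0}|B(x,t)|^{-1+\frac\alpha n}\int_{B(x,t)}|b(x)-b(y)|\,|\Omega(x-y)|\,|f(y)|\,dy,$$ $$\overline T_{\Omega,\alpha}f(x)=\int_{\mathbb R^n}\frac{\Omega(x-y)}{|x-y|^{n-\alpha}}f(y)\,dy,\qquad [b,\overline T_{\Omega,\alpha}]f=b\,\overline T_{\Omega,\alpha}f-\overline T_{\Omega,\alpha}(bf).$$ For $1\le p<\infty$ and a positive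 measurable function $\varphi$ on $\mathbb R^n\times(0,\infty)$, let $M_{p,\varphi}$ be the space of all $f\in L_p^{loc}(\mathbb R^n)$ with $$\|f\|_{p,\varphi}=\sup_{x\in\mathbb R^n,\,r>0}\varphi(x,r)^{-1}\|f\|_{L_p(B(x,r))}<\infty,$$ and let $VM_{p,\varphi}$ be the subspace of all $f\in M_{p,\varphi}$ with $\lim_{r\to0}\sup_{x}\varphi(x,r)^{-1}\|f\|_{L_p(B(x,r))}=0$, with the same norm. Let $\varphi_1,\varphi_2$ be measurable functions on $\mathbb R^n\times(0,\infty)$ with $\inf_{x,\,r>0}\varphi_i(x,r)>0$ for $i=1,2$, and suppose that, for $(\varphi,u)=(\varphi_1,p)$ and for $(\varphi,u)=(\varphi_2,q)$, $$\lim_{t\to0}\sup_{x}\frac{t^{n/u}}{\varphi(x,t)}=0,\qquad \inf_{t>1}\sup_{x}\frac{t^{n/u}}{\varphi(x,t)}>0 .$$ For a real number $\kappa$ consider the conditions (a) $\displaystyle\int_\delta^\infty\Bigl(1+\ln\frac tr\Bigr)\sup_{x}\varphi_1(x,t)\,\frac{dt}{t^{\kappa+1}}<\infty$ for all $0<r\le\delta$;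 (b) there is a constant $C_0$, independent of $x\in\mathbb R^n$ and $r>0$, such that $\displaystyle\int_r^\infty\Bigl(1+\ln\frac tr\Bigr)\varphi_1(x,t)\,\frac{dt}{t^{\kappa+1}}\le C_0\,\frac{\varphi_2(x,r)}{r^{\kappa}}$ for all $x\in\mathbb R^n$, $r>0$. Suppose that either $s'\le p$ and (a), (b) hold with $\kappa=\frac nq$, or $q<s$ and (a), (b) hold with $\kappa=\frac nq-\frac ns$ (where $\frac ns=0$ if $s=\infty$). Then $M_{\Omega,b,\alpha}$ and $[b,\overline T_{\Omega,\alpha}]$ are bounded from $VM_{p,\varphi_1}$ to $VM_{q,\varphi_2}$: each of the two operators maps $VM_{p,\varphi_1}$ into $VM_{q,\varphi_2}$, and there is a constant $C$ such that $\|M_{\Omega,b,\alpha}f\|_{q,\varphi_2}\le C\|f\|_{p,\varphi_1}$ and $\|[b,\overline T_{\Omega,\alpha}]f\|_{q,\varphi_2}\le C\|f\|_{p,\varphi_1}$ for all $f\in VM_{p,\varphi_1}$. Here, for $f\in VM_{p,\varphi_1}$, the integrals defining $\overline T_{\Omega,\alpha}f(x)$ and $\overline T_{\Omega,\alpha}(bf)(x)$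 converge absolutely for almost every $x$, and for such $x$ $$[b,\overline T_{\Omega,\alpha}]f(x)=\int_{\mathbb R^n}[b(x)-b(y)]\frac{\Omega(x-y)}{|x-y|^{n-\alpha}}f(y)\,dy .$$ -/

import Mathlib

namespace VanishingMorrey

open MeasureTheory Filter Topology Set
open scoped ENNReal

noncomputable section

/-- The Euclidean space `ℝⁿ`. -/
abbrev Rn (n : ℕ) : Type := EuclideanSpace ℝ (Fin n)

/-- `Ω` is homogeneous of degree zero. -/
def IsHomogeneousZero {n : ℕ} {𝕜 : Type*} (Ω : Rn n → 𝕜) : Prop :=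
  ∀ t : ℝ, 0 < t → ∀ x : Rn n, Ω (t • x) = Ω x

/-- `Ω ∈ L_s(S^{n-1})`, with respect to the surface measure of the unit sphere. -/
def MemLpSphere {n : ℕ} {𝕜 : Type*} [RCLike 𝕜] (Ω : Rn n → 𝕜) (s : ℝ≥0∞) : Prop :=
  MemLp (fun u : Metric.sphere (0 : Rn n) 1 => Ω (u : Rn n)) s
    (volume : Measure (Rn n)).toSphere

/-- The `BMO` seminorm: the supremum over all balls of the mean oscillation. -/
def bmoSeminorm {n : ℕ} {𝕜 : Type*} [RCLike 𝕜] (b : Rn n → 𝕜) : ℝ≥0∞ :=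
  ⨆ (x : Rn n) (r : ℝ) (_ : 0 < r),
    (volume (Metric.ball x r))⁻¹ *
      ∫⁻ y in Metric.ball x r, ‖b y - (⨍ z in Metric.ball x r, b z)‖ₑ

/-- `b ∈ BMO(ℝⁿ)`. -/
def MemBMO {n : ℕ} {𝕜 : Type*} [RCLike 𝕜] (b : Rn n → 𝕜) : Prop :=
  LocallyIntegrable b volume ∧ bmoSeminorm b < ∞

/-- An admissible weight `φ(x,r)` on `ℝⁿ × (0,∞)`: measurable, with positive infimum
(in particular positive). Values at `r ≤ 0` are never used. -/
structure IsWeight {n : ℕ} (φ : Rn n → ℝ → ℝ) : Prop where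
  measurable : Measurable fun z : Rn n × Ioi (0 : ℝ) => φ z.1 (z.2 : ℝ)
  inf_pos : ∃ c : ℝ, 0 < c ∧ ∀ x : Rn n, ∀ r : ℝ, 0 < r → c ≤ φ x r

/-- `φ(x,r)⁻¹ ‖f‖_{L_p(B(x,r))}`. The target is general enough to cover both scalar functions
and functions with values in `[0,∞]`. -/
def localRatio {n : ℕ} {ε : Type*} [TopologicalSpace ε] [ContinuousENorm ε]
    (p : ℝ) (φ : Rn n → ℝ → ℝ) (f : Rn n → ε) (x : Rn n) (r : ℝ) : ℝ≥0∞ :=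
  (ENNReal.ofReal (φ x r))⁻¹ *
    eLpNorm f (ENNReal.ofReal p) (volume.restrict (Metric.ball x r))

/-- The norm of `M_{p,φ}` and of `VM_{p,φ}`: `sup_{x, r>0} φ(x,r)⁻¹ ‖f‖_{L_p(B(x,r))}`. -/
def morreyNorm {n : ℕ} {ε : Type*} [TopologicalSpace ε] [ContinuousENorm ε]
    (p : ℝ) (φ : Rn n → ℝ → ℝ) (f : Rn n → ε) : ℝ≥0∞ :=
  ⨆ (x : Rn n) (r : ℝ) (_ : 0 < r), localRatio p φ f x r

/-- `f ∈ M_{p,φ}(ℝⁿ)`: `f` is locally in `L_p` and has finite norm. -/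
def MemMorrey {n : ℕ} {ε : Type*} [TopologicalSpace ε] [ContinuousENorm ε]
    (p : ℝ) (φ : Rn n → ℝ → ℝ) (f : Rn n → ε) : Prop :=
  (∀ K : Set (Rn n), IsCompact K → MemLp f (ENNReal.ofReal p) (volume.restrict K)) ∧
    morreyNorm p φ f < ∞

/-- `f ∈ VM_{p,φ}(ℝⁿ)`: `f ∈ M_{p,φ}(ℝⁿ)` and
`lim_{r → 0} sup_x φ(x,r)⁻¹ ‖f‖_{L_p(B(x,r))} = 0`. -/
def MemVM {n : ℕ} {ε : Type*} [TopologicalSpace ε] [ContinuousENorm ε]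
    (p : ℝ) (φ : Rn n → ℝ → ℝ) (f : Rn n → ε) : Prop :=
  MemMorrey p φ f ∧ Tendsto (fun r : ℝ => ⨆ x : Rn n, localRatio p φ f x r) (𝓝[>] 0) (𝓝 0)

/-- `T` is bounded from `VM_{p,φ₁}` to `VM_{q,φ₂}`. -/
def IsBoundedVM {n : ℕ} {𝕜 : Type*} [RCLike 𝕜] {ε : Type*} [TopologicalSpace ε]
    [ContinuousENorm ε] (p : ℝ) (φ₁ : Rn n → ℝ → ℝ) (q : ℝ) (φ₂ : Rn n → ℝ → ℝ)
    (T : (Rn n → 𝕜) → Rn n → ε) : Prop :=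
  ∃ C : ℝ, 0 < C ∧ ∀ f : Rn n → 𝕜, MemVM p φ₁ f →
    MemVM q φ₂ (T f) ∧ morreyNorm q φ₂ (T f) ≤ ENNReal.ofReal C * morreyNorm p φ₁ f

/-- `lim_{t → 0} sup_x t^{n/p} / φ(x,t) = 0` and `inf_{t > 1} sup_x t^{n/p} / φ(x,t) > 0`. -/
def VMCondition {n : ℕ} (p : ℝ) (φ : Rn n → ℝ → ℝ) : Prop :=
  Tendsto (fun t : ℝ => ⨆ x : Rn n, ENNReal.ofReal (t ^ ((n : ℝ) / p) / φ x t)) (𝓝[>] 0) (𝓝 0) ∧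
    0 < ⨅ (t : ℝ) (_ : 1 < t), ⨆ x : Rn n, ENNReal.ofReal (t ^ ((n : ℝ) / p) / φ x t)

/-- `∫_δ^∞ (1 + ln (t/r)) sup_x φ₁(x,t) dt / t^{κ+1} < ∞` for every `δ > 0` and all `r ∈ (0,δ]`
(the range in which the logarithmic factor is positive on the whole domain of integration). -/
def TailCondition {n : ℕ} (κ : ℝ) (φ₁ : Rn n → ℝ → ℝ) : Prop :=
  ∀ δ r : ℝ, 0 < r → r ≤ δ →
    ∫⁻ t in Ioi δ, ENNReal.ofReal ((1 + Real.log (t / r)) / t ^ (κ + 1)) *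
      (⨆ x : Rn n, ENNReal.ofReal (φ₁ x t)) < ∞

/-- `∫_r^∞ (1 + ln (t/r)) φ₁(x,t) dt / t^{κ+1} ≤ C₀ φ₂(x,r) / r^κ`, with `C₀` independent of
`x` and `r > 0`. -/
def PairCondition {n : ℕ} (κ : ℝ) (φ₁ φ₂ : Rn n → ℝ → ℝ) : Prop :=
  ∃ C₀ : ℝ, 0 < C₀ ∧ ∀ x : Rn n, ∀ r : ℝ, 0 < r →
    ∫⁻ t in Ioi r, ENNReal.ofReal ((1 + Real.log (t / r)) * φ₁ x t / t ^ (κ + 1)) ≤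
      ENNReal.ofReal (C₀ * φ₂ x r / r ^ κ)

/-- The integrand `Ω(x-y) / |x-y|^{n-α} f(y)` of the rough fractional integral. -/
def fracIntegrand {n : ℕ} {𝕜 : Type*} [RCLike 𝕜] (Ω : Rn n → 𝕜) (α : ℝ) (f : Rn n → 𝕜)
    (x y : Rn n) : 𝕜 :=
  Ω (x - y) / ((‖x - y‖ ^ ((n : ℝ) - α) : ℝ) : 𝕜) * f y

/-- The rough fractional integral operator `T̄_{Ω,α}`. -/
def fracIntegral {n : ℕ} {𝕜 : Type*} [RCLike 𝕜] (Ω : Rn n → 𝕜) (α : ℝ) (f : Rn n → 𝕜)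
    (x : Rn n) : 𝕜 :=
  ∫ y, fracIntegrand Ω α f x y

/-- The commutator `[b, T̄_{Ω,α}] f = b T̄_{Ω,α} f - T̄_{Ω,α} (b f)`. -/
def fracCommutator {n : ℕ} {𝕜 : Type*} [RCLike 𝕜] (Ω b : Rn n → 𝕜) (α : ℝ) (f : Rn n → 𝕜)
    (x : Rn n) : 𝕜 :=
  b x * fracIntegral Ω α f x - fracIntegral Ω α (fun y => b y * f y) x

/-- The commutator `M_{Ω,b,α}` of the rough fractional maximal operator, with values in `[0,∞]`:
`sup_{t>0} |B(x,t)|^{-1+α/n} ∫_{B(x,t)} |b(x) - b(y)| |Ω(x-y)| |f(y)| dy`. -/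
def fracMaximalCommutator {n : ℕ} {𝕜 : Type*} [RCLike 𝕜] (Ω b : Rn n → 𝕜) (α : ℝ)
    (f : Rn n → 𝕜) (x : Rn n) : ℝ≥0∞ :=
  ⨆ (t : ℝ) (_ : 0 < t), volume (Metric.ball x t) ^ (-1 + α / (n : ℝ)) *
    ∫⁻ y in Metric.ball x t, ‖b x - b y‖ₑ * ‖Ω (x - y)‖ₑ * ‖f y‖ₑ

end

end VanishingMorrey

/-! ### Hölder and Young inequalities with room in the exponents -/

namespace VanishingMorrey

open MeasureTheory Filter Topology Set
open scoped ENNReal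

/-! Put γ = n - α. Both operators are dominated pointwise, up to constants, by one positive operator
`posOp`, with kernel |Ω(x-y)| (1 + |b(x) - b(y)|) |x-y|^{-γ}. The extra 1 makes the same operator
control the absolute convergence of the integrals of f and of bf. Everything then follows from the
local estimate `HasLocalBound`: the L_q norm of the operator on B(x₀,r) is at most C r^κ ∫_r^∞ (1 +
ln(t/r)) ‖f‖_{L_p(B(x₀,t))} dt/t^{κ+1}.

The oscillation of b is separated by Hölder's inequality. By the John–Nirenberg inequality all L^m
mean oscillations are bounded (`exists_lintegral_oscillation_rpow_le`). Hence b may be measured in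
L^m with m large, at the cost of raising f, g and Ω to a power l only slightly above 1; this is
harmless where the exponents in Young's inequality satisfy strict inequalities
(`exists_bilinear_bound`). Means over balls of radii ρ ≤ σ differ by O(1 + ln(σ/ρ)), which is the
source of the logarithm.

The kernel |z|^{-γ} is, up to a constant, the superposition ∫_{|z|}^∞ ρ^{-γ-1} dρ, so pairing
`posOp` with g gives ∫_0^∞ ρ^{-γ-1} `truncForm` dρ, where `truncForm` only sees |x-y| < ρ. At one
scale the form is bounded by C ρ^{n(2-u-v)} ‖f‖_{1/u} ‖g‖_{1/v}, for an open set of exponents (u,v)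
(`exists_lintegral_pairing_le`). Splitting f and g at heights depending on ρ, and using exponents on
either side of the critical ones, makes the integral over ρ converge: this is real interpolation
(`exists_lintegral_truncForm_le`), and it yields the global L_p to L_q bound.

For the local estimate f is split at B(x₀,2r). The near part uses the global bound. For the far part
|x-y| is comparable with |y-x₀|, and the superposition reduces matters to bilinear forms on B(x₀,r)
× B(x₀,t). These are estimated in two ways, `exists_ballForm_le_of_conj` when s' ≤ p and
`exists_ballForm_le_of_add_lt_one` when q < s, which accounts for the two values of κ. Duality
(`exists_local_bound`) concludes.

The Morrey bound is the local estimate combined with (b). For the vanishing property the integral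
over t is cut at a small δ: below δ the local norms of f are small and (b) applies; above δ
condition (a) leaves a factor r^κ (1 + ln(δ/r)), which tends to 0, while φ₂ is bounded below. -/

theorem lintegral_rpow_mul_rpow_le {X : Type*} [MeasurableSpace X] {μ : Measure X}
    {P Q : X → ℝ≥0∞} (hP : AEMeasurable P μ) (hQ : AEMeasurable Q μ) {u v : ℝ} {S : ℝ≥0∞}
    (hv0 : 0 ≤ v) (hv : v ≤ 1) (huv : 1 ≤ u + v) (hS : ∀ᵐ x ∂μ, P x ≤ S) :
    ∫⁻ x, P x ^ u * Q x ^ v ∂μ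
      ≤ S ^ (u + v - 1) * ((∫⁻ x, P x ∂μ) ^ (1 - v) * (∫⁻ x, Q x ∂μ) ^ v) := by
  calc ∫⁻ x, P x ^ u * Q x ^ v ∂μ
      ≤ ∫⁻ x, S ^ (u + v - 1) * (P x ^ (1 - v) * Q x ^ v) ∂μ := by
        refine lintegral_mono_ae ?_
        filter_upwards [hS] with x hx
        -- The surplus u + v - 1 over the Hölder exponents 1 - v and v is paid by the supremum of P.
        have : P x ^ u = P x ^ (u + v - 1) * P x ^ (1 - v) := by
          rw [← ENNReal.rpow_add_of_nonneg _ _ (by linarith) (by linarith)]; congr 1; ring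
        rw [this, mul_assoc]
        gcongr
    _ = S ^ (u + v - 1) * ∫⁻ x, P x ^ (1 - v) * Q x ^ v ∂μ :=
        lintegral_const_mul'' _ ((hP.pow_const _).mul (hQ.pow_const _))
    _ ≤ _ := by
        gcongr
        exact ENNReal.lintegral_mul_norm_pow_le hP hQ (by linarith) hv0 (by ring)

theorem lintegral_rpow_le_of_le_one {X : Type*} [MeasurableSpace X] {μ : Measure X}
    {F : X → ℝ≥0∞} (hF : AEMeasurable F μ) {t : ℝ} (ht0 : 0 ≤ t) (ht : t ≤ 1) {M : ℝ≥0∞}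
    (hM : μ univ ≤ M) :
    ∫⁻ x, F x ^ t ∂μ ≤ (∫⁻ x, F x ∂μ) ^ t * M ^ (1 - t) := by
  have := ENNReal.lintegral_mul_norm_pow_le (μ := μ) hF (aemeasurable_const (b := (1 : ℝ≥0∞)))
    ht0 (sub_nonneg.2 ht) (by ring)
  simp only [ENNReal.one_rpow, mul_one, lintegral_const, one_mul] at this
  refine this.trans ?_
  have h1 : 0 ≤ 1 - t := by linarith
  gcongr

section Young

variable {n : ℕ}

/-- Young's inequality in symmetric form: Hölder's inequality for the three products FG, FK, GK with
exponents 1 - w, 1 - v, 1 - u, which sum to 1. The double integral of each product factorises by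
translation invariance. -/
theorem lintegral_lintegral_rpow_le {F G K : Rn n → ℝ≥0∞} (hF : Measurable F) (hG : Measurable G)
    (hK : Measurable K) {u v w : ℝ} (hu : u ≤ 1) (hv : v ≤ 1) (hw : w ≤ 1) (h : u + v + w = 2) :
    ∫⁻ x, ∫⁻ y, F y ^ u * G x ^ v * K (x - y) ^ w
      ≤ (∫⁻ y, F y) ^ u * (∫⁻ y, G y) ^ v * (∫⁻ y, K y) ^ w := by
  have hF' : Measurable fun z : Rn n × Rn n => F z.2 := hF.comp measurable_snd
  have hG' : Measurable fun z : Rn n × Rn n => G z.1 := hG.comp measurable_fst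
  have hK' : Measurable fun z : Rn n × Rn n => K (z.1 - z.2) :=
    hK.comp (measurable_fst.sub measurable_snd)
  rw [← lintegral_prod (fun z : Rn n × Rn n => F z.2 ^ u * G z.1 ^ v * K (z.1 - z.2) ^ w)
    (((hF'.pow_const _).mul (hG'.pow_const _)).mul (hK'.pow_const _)).aemeasurable]
  let A : Fin 3 → Rn n × Rn n → ℝ≥0∞ := ![fun z => F z.2 * G z.1, fun z => F z.2 * K (z.1 - z.2),
    fun z => G z.1 * K (z.1 - z.2)]
  let e : Fin 3 → ℝ := ![1 - w, 1 - v, 1 - u]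
  have key := ENNReal.lintegral_prod_norm_pow_le (μ := (volume : Measure (Rn n)).prod volume)
    Finset.univ (f := A) (p := e)
    (by
      intro i _
      fin_cases i
      · exact (hF'.mul hG').aemeasurable
      · exact (hF'.mul hK').aemeasurable
      · exact (hG'.mul hK').aemeasurable)
    (by simp [Fin.sum_univ_three, e]; linarith)
    (by
      intro i _
      fin_cases i <;> simp [e] <;> assumption)
  simp only [Fin.prod_univ_three, A, e, Matrix.cons_val_zero, Matrix.cons_val_one,
    Matrix.cons_val] at key
  have e1 : ∫⁻ z : Rn n × Rn n, F z.2 * G z.1 ∂(volume.prod volume)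
      = (∫⁻ y, F y) * ∫⁻ y, G y := by
    rw [lintegral_prod (fun z : Rn n × Rn n => F z.2 * G z.1) (hF'.mul hG').aemeasurable]
    simp only
    simp_rw [lintegral_mul_const _ hF]
    rw [lintegral_const_mul _ hG]
  have e2 : ∫⁻ z : Rn n × Rn n, F z.2 * K (z.1 - z.2) ∂(volume.prod volume)
      = (∫⁻ y, F y) * ∫⁻ y, K y := by
    rw [lintegral_prod_symm (fun z : Rn n × Rn n => F z.2 * K (z.1 - z.2))
      (hF'.mul hK').aemeasurable]
    simp only
    have : ∀ y, ∫⁻ x, F y * K (x - y) = F y * ∫⁻ x, K x := by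
      intro y
      rw [lintegral_const_mul _ (show Measurable fun x => K (x - y) by fun_prop), lintegral_sub_right_eq_self]
    simp_rw [this]
    rw [lintegral_mul_const _ hF]
  have e3 : ∫⁻ z : Rn n × Rn n, G z.1 * K (z.1 - z.2) ∂(volume.prod volume)
      = (∫⁻ y, G y) * ∫⁻ y, K y := by
    rw [lintegral_prod (fun z : Rn n × Rn n => G z.1 * K (z.1 - z.2)) (hG'.mul hK').aemeasurable]
    simp only
    have : ∀ x, ∫⁻ y, G x * K (x - y) = G x * ∫⁻ x, K x := by
      intro x
      rw [lintegral_const_mul _ (show Measurable fun y => K (x - y) by fun_prop), lintegral_sub_left_eq_self]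
    simp_rw [this]
    rw [lintegral_mul_const _ hG]
  rw [e1, e2, e3] at key
  have alg : ∀ a b c : ℝ≥0∞, (a * b) ^ (1 - w) * (a * c) ^ (1 - v) * (b * c) ^ (1 - u)
      = a ^ u * b ^ v * c ^ w := by
    intro a b c
    have hu' : 0 ≤ 1 - u := by linarith
    have hv' : 0 ≤ 1 - v := by linarith
    have hw' : 0 ≤ 1 - w := by linarith
    rw [ENNReal.mul_rpow_of_nonneg _ _ hw', ENNReal.mul_rpow_of_nonneg _ _ hv',
      ENNReal.mul_rpow_of_nonneg _ _ hu']
    have ha : a ^ u = a ^ (1 - w) * a ^ (1 - v) := by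
      rw [← ENNReal.rpow_add_of_nonneg _ _ hw' hv']; congr 1; linarith
    have hb : b ^ v = b ^ (1 - w) * b ^ (1 - u) := by
      rw [← ENNReal.rpow_add_of_nonneg _ _ hw' hu']; congr 1; linarith
    have hc : c ^ w = c ^ (1 - v) * c ^ (1 - u) := by
      rw [← ENNReal.rpow_add_of_nonneg _ _ hv' hu']; congr 1; linarith
    rw [ha, hb, hc]; ring
  rw [alg] at key
  refine le_trans (le_of_eq ?_) key
  refine lintegral_congr fun z => (alg _ _ _).symm

/-- Move from (u,v,w) straight towards (1,1,1), whose sum is 3, and stop when the sum equals 2; τ is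
the fraction of the segment covered. -/
theorem exists_exponents {u v w : ℝ} (hu : u < 1) (hv : v < 1) (hw : w < 1) (h : u + v + w ≤ 2) :
    ∃ u' v' w' : ℝ, u ≤ u' ∧ u' ≤ 1 ∧ v ≤ v' ∧ v' ≤ 1 ∧ w ≤ w' ∧ w' ≤ 1 ∧ u' + v' + w' = 2 := by
  set S := u + v + w with hS
  have h3 : 0 < 3 - S := by linarith
  set τ := (2 - S) / (3 - S) with hτ
  have hτ0 : 0 ≤ τ := div_nonneg (by linarith) h3.le
  have hτ1 : τ ≤ 1 := by rw [hτ, div_le_one h3]; linarith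
  have hτe : τ * (3 - S) = 2 - S := by rw [hτ]; field_simp
  refine ⟨u + τ * (1 - u), v + τ * (1 - v), w + τ * (1 - w), ?_, ?_, ?_, ?_, ?_, ?_, ?_⟩
  · nlinarith
  · nlinarith
  · nlinarith
  · nlinarith
  · nlinarith
  · nlinarith
  · have : u + τ * (1 - u) + (v + τ * (1 - v)) + (w + τ * (1 - w)) = S + τ * (3 - S) := by
      rw [hS]; ring
    rw [this, hτe]; ring

/-- On sets of measure at most M the exponents in Young's inequality may sum to less than 2: raise
them until they sum to 2, then return by Hölder's inequality against the constant 1. The total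
deficit appears as the power of M. -/
theorem setLIntegral_setLIntegral_rpow_le {F G K : Rn n → ℝ≥0∞} (hF : Measurable F)
    (hG : Measurable G) (hK : Measurable K) {u v w : ℝ} (hu0 : 0 < u) (hv0 : 0 < v) (hw0 : 0 < w)
    (hu : u < 1) (hv : v < 1) (hw : w < 1) (h : u + v + w ≤ 2)
    {E₁ E₂ E₃ : Set (Rn n)} (h₁ : MeasurableSet E₁) (h₂ : MeasurableSet E₂) (h₃ : MeasurableSet E₃)
    (h₁₂ : ∀ x ∈ E₁, ∀ y ∈ E₂, x - y ∈ E₃) {M : ℝ≥0∞} (hM₁ : volume E₁ ≤ M) (hM₂ : volume E₂ ≤ M)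
    (hM₃ : volume E₃ ≤ M) :
    ∫⁻ x in E₁, ∫⁻ y in E₂, F y ^ u * G x ^ v * K (x - y) ^ w
      ≤ (∫⁻ y in E₂, F y) ^ u * (∫⁻ y in E₁, G y) ^ v * (∫⁻ y in E₃, K y) ^ w
        * M ^ (2 - (u + v + w)) := by
  obtain ⟨u', v', w', hu1, hu2, hv1, hv2, hw1, hw2, hsum⟩ := exists_exponents hu hv hw h
  have main : ∀ {A : Rn n → ℝ≥0∞} (_ : Measurable A) {E : Set (Rn n)} (_ : volume E ≤ M) {a a' : ℝ},
      0 < a → a ≤ a' →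
      (∫⁻ y in E, A y ^ (a / a')) ^ a' ≤ (∫⁻ y in E, A y) ^ a * M ^ (a' - a) := by
    intro A hA E hE a a' ha haa
    have ha' : 0 < a' := ha.trans_le haa
    have h1 := lintegral_rpow_le_of_le_one (μ := volume.restrict E) (t := a / a') hA.aemeasurable
      (by positivity) (by rw [div_le_one ha']; exact haa) (M := M) (by simpa using hE)
    calc _ ≤ ((∫⁻ y in E, A y) ^ (a / a') * M ^ (1 - a / a')) ^ a' := by gcongr
      _ = _ := by
        rw [ENNReal.mul_rpow_of_nonneg _ _ ha'.le, ← ENNReal.rpow_mul, ← ENNReal.rpow_mul]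
        congr 2 <;> field_simp
  set F₁ := E₂.indicator fun y => F y ^ (u / u') with hF₁
  set G₁ := E₁.indicator fun y => G y ^ (v / v') with hG₁
  set K₁ := E₃.indicator fun y => K y ^ (w / w') with hK₁
  have hu' : 0 < u' := hu0.trans_le hu1
  have hv' : 0 < v' := hv0.trans_le hv1
  have hw' : 0 < w' := hw0.trans_le hw1
  have Y := lintegral_lintegral_rpow_le (F := F₁) (G := G₁) (K := K₁)
    ((hF.pow_const _).indicator h₂) ((hG.pow_const _).indicator h₁)
    ((hK.pow_const _).indicator h₃) hu2 hv2 hw2 hsum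
  have hle : ∫⁻ x in E₁, ∫⁻ y in E₂, F y ^ u * G x ^ v * K (x - y) ^ w
      ≤ ∫⁻ x, ∫⁻ y, F₁ y ^ u' * G₁ x ^ v' * K₁ (x - y) ^ w' := by
    refine le_trans ?_ (setLIntegral_le_lintegral E₁ _)
    refine setLIntegral_mono' h₁ fun x hx => ?_
    refine le_trans ?_ (setLIntegral_le_lintegral E₂ _)
    refine setLIntegral_mono' h₂ fun y hy => ?_
    simp only [hF₁, hG₁, hK₁, indicator_of_mem hx, indicator_of_mem hy,
      indicator_of_mem (h₁₂ x hx y hy), ← ENNReal.rpow_mul]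
    rw [div_mul_cancel₀ _ hu'.ne', div_mul_cancel₀ _ hv'.ne', div_mul_cancel₀ _ hw'.ne']
  refine hle.trans (Y.trans ?_)
  rw [hF₁, hG₁, hK₁, lintegral_indicator h₂, lintegral_indicator h₁, lintegral_indicator h₃]
  calc _ ≤ ((∫⁻ y in E₂, F y) ^ u * M ^ (u' - u)) * ((∫⁻ y in E₁, G y) ^ v * M ^ (v' - v))
        * ((∫⁻ y in E₃, K y) ^ w * M ^ (w' - w)) := by
        gcongr
        · exact main hF hM₂ hu0 hu1
        · exact main hG hM₁ hv0 hv1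
        · exact main hK hM₃ hw0 hw1
    _ = (∫⁻ y in E₂, F y) ^ u * (∫⁻ y in E₁, G y) ^ v * (∫⁻ y in E₃, K y) ^ w
        * (M ^ (u' - u) * M ^ (v' - v) * M ^ (w' - w)) := by ring
    _ = _ := by
        rw [← ENNReal.rpow_add_of_nonneg _ _ (by linarith) (by linarith),
          ← ENNReal.rpow_add_of_nonneg _ _ (by linarith) (by linarith)]
        congr 2; linarith

/-- Hölder's inequality on `E₁ × E₂` for an iterated integral. -/
theorem setLIntegral_setLIntegral_mul_le {h β : Rn n → Rn n → ℝ≥0∞}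
    (hh : Measurable (Function.uncurry h)) (hβ : Measurable (Function.uncurry β))
    (E₁ E₂ : Set (Rn n)) {l m : ℝ} (hlm : l.HolderConjugate m) :
    ∫⁻ x in E₁, ∫⁻ y in E₂, h x y * β x y
      ≤ (∫⁻ x in E₁, ∫⁻ y in E₂, h x y ^ l) ^ (1 / l)
        * (∫⁻ x in E₁, ∫⁻ y in E₂, β x y ^ m) ^ (1 / m) := by
  have H := ENNReal.lintegral_mul_le_Lp_mul_Lq
    ((volume.restrict E₁).prod (volume.restrict E₂)) hlm hh.aemeasurable hβ.aemeasurable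
  rw [lintegral_prod _ (hh.mul hβ).aemeasurable,
    lintegral_prod _ (hh.pow_const l).aemeasurable,
    lintegral_prod _ (hβ.pow_const m).aemeasurable] at H
  exact H

/-- Strict inequalities leave room for some l > 1 for which lu, lv, lw are still admissible in
Young's inequality. Hölder's inequality with l and its conjugate m then separates β, of which only
an L^m average is needed. The factor M² normalises that average by the size of E₁ × E₂. -/
theorem exists_bilinear_bound {u v w : ℝ} (hu0 : 0 < u) (hv0 : 0 < v) (hw0 : 0 < w)
    (hu : u < 1) (hv : v < 1) (hw : w < 1) (h : u + v + w < 2) :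
    ∃ m : ℝ, 1 ≤ m ∧ ∀ {n : ℕ} {f g k : Rn n → ℝ≥0∞} {β : Rn n → Rn n → ℝ≥0∞},
      Measurable f → Measurable g → Measurable k → Measurable (Function.uncurry β) →
      ∀ {E₁ E₂ E₃ : Set (Rn n)}, MeasurableSet E₁ → MeasurableSet E₂ → MeasurableSet E₃ →
      (∀ x ∈ E₁, ∀ y ∈ E₂, x - y ∈ E₃) → ∀ {M D : ℝ≥0∞}, volume E₁ ≤ M → volume E₂ ≤ M →
      volume E₃ ≤ M → ∫⁻ x in E₁, ∫⁻ y in E₂, β x y ^ m ≤ D ^ m * M ^ (2 : ℝ) →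
      ∫⁻ x in E₁, ∫⁻ y in E₂, f y * g x * k (x - y) * β x y
        ≤ (∫⁻ y in E₂, f y ^ (1 / u)) ^ u * (∫⁻ x in E₁, g x ^ (1 / v)) ^ v
          * (∫⁻ z in E₃, k z ^ (1 / w)) ^ w * M ^ (2 - (u + v + w)) * D := by
  have hS : 0 < u + v + w := by linarith
  obtain ⟨l, hl1, hl⟩ : ∃ l : ℝ, 1 < l ∧ l < min (min (1 / u) (1 / v)) (min (1 / w) (2 / (u + v + w))) := by
    refine exists_between ?_
    simp only [lt_min_iff]
    refine ⟨⟨?_, ?_⟩, ?_, ?_⟩ <;> rw [lt_div_iff₀ (by assumption)] <;> linarith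
  simp only [lt_min_iff] at hl
  obtain ⟨⟨hlu, hlv⟩, hlw, hlS⟩ := hl
  rw [lt_div_iff₀ (by assumption)] at hlu hlv hlw hlS
  have hl0 : 0 < l := by linarith
  have hlm := Real.HolderConjugate.conjExponent hl1
  refine ⟨l.conjExponent, hlm.symm.lt.le, ?_⟩
  intro n f g k β hf hg hk hβ E₁ E₂ E₃ h₁ h₂ h₃ h₁₂ M D hM₁ hM₂ hM₃ hD
  set m := l.conjExponent
  have hm0 : 0 < m := hlm.symm.pos
  have hh : Measurable (Function.uncurry fun x y : Rn n => f y * g x * k (x - y)) :=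
    ((hf.comp measurable_snd).mul (hg.comp measurable_fst)).mul
      (hk.comp (measurable_fst.sub measurable_snd))
  refine (setLIntegral_setLIntegral_mul_le hh hβ E₁ E₂ hlm).trans ?_
  have A := setLIntegral_setLIntegral_rpow_le (hf.pow_const (1 / u)) (hg.pow_const (1 / v))
    (hk.pow_const (1 / w)) (mul_pos hl0 hu0) (mul_pos hl0 hv0) (mul_pos hl0 hw0) hlu hlv hlw
    (by linarith) h₁ h₂ h₃ h₁₂ hM₁ hM₂ hM₃
  have e : ∀ (a : ℝ≥0∞) {t : ℝ}, 0 < t → (a ^ (1 / t)) ^ (l * t) = a ^ l := by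
    intro a t ht
    rw [← ENNReal.rpow_mul]; congr 1; field_simp
  have A' : ∫⁻ x in E₁, ∫⁻ y in E₂, (f y * g x * k (x - y)) ^ l
      ≤ (∫⁻ y in E₂, f y ^ (1 / u)) ^ (l * u) * (∫⁻ x in E₁, g x ^ (1 / v)) ^ (l * v)
          * (∫⁻ z in E₃, k z ^ (1 / w)) ^ (l * w) * M ^ (2 - (l * u + l * v + l * w)) := by
    refine le_trans (le_of_eq ?_) A
    simp_rw [e _ hu0, e _ hv0, e _ hw0, ENNReal.mul_rpow_of_nonneg _ _ hl0.le]
  calc _ ≤ ((∫⁻ y in E₂, f y ^ (1 / u)) ^ (l * u) * (∫⁻ x in E₁, g x ^ (1 / v)) ^ (l * v)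
          * (∫⁻ z in E₃, k z ^ (1 / w)) ^ (l * w) * M ^ (2 - (l * u + l * v + l * w))) ^ (1 / l)
          * (D ^ m * M ^ (2 : ℝ)) ^ (1 / m) := by gcongr
    _ = (∫⁻ y in E₂, f y ^ (1 / u)) ^ u * (∫⁻ x in E₁, g x ^ (1 / v)) ^ v
          * (∫⁻ z in E₃, k z ^ (1 / w)) ^ w
          * (M ^ ((2 - (l * u + l * v + l * w)) * (1 / l)) * M ^ (2 * (1 / m))) * D := by
        have hl' : 0 ≤ 1 / l := by positivity
        have hm' : 0 ≤ 1 / m := by positivity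
        rw [ENNReal.mul_rpow_of_nonneg _ _ hl', ENNReal.mul_rpow_of_nonneg _ _ hl',
          ENNReal.mul_rpow_of_nonneg _ _ hl', ENNReal.mul_rpow_of_nonneg _ _ hm']
        simp_rw [← ENNReal.rpow_mul]
        have e2 : ∀ t : ℝ, l * t * (1 / l) = t := fun t => by field_simp
        have e3 : m * (1 / m) = 1 := by field_simp
        rw [e2, e2, e2, e3, ENNReal.rpow_one]
        ring
    _ = _ := by
        rw [← ENNReal.rpow_add_of_nonneg _ _ (by
          refine mul_nonneg (by linarith) (by positivity)) (by positivity)]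
        congr 3
        have := hlm.inv_add_inv_eq_one
        field_simp at this ⊢
        linear_combination 2 * this

end Young

end VanishingMorrey

namespace VanishingMorrey

open MeasureTheory Filter Topology Set
open scoped ENNReal NNReal

/-! ### Volumes of balls -/

section Balls

variable {n : ℕ}

theorem volume_ball_mul (x y : Rn n) {c ρ : ℝ} (hc : 0 < c) (hρ : 0 < ρ) :
    volume (Metric.ball x (c * ρ)) = ENNReal.ofReal c ^ n * volume (Metric.ball y ρ) := by
  rw [Measure.addHaar_ball_of_pos _ _ (mul_pos hc hρ), Measure.addHaar_ball_of_pos _ _ hρ,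
    finrank_euclideanSpace_fin, mul_pow, ENNReal.ofReal_mul (by positivity),
    ENNReal.ofReal_pow hc.le, mul_assoc]

theorem volume_closedBall_eq (x : Rn n) {ρ : ℝ} (hρ : 0 < ρ) :
    volume (Metric.closedBall x ρ) = volume (Metric.ball x ρ) := by
  rw [Measure.addHaar_ball_of_pos _ _ hρ, Measure.addHaar_closedBall _ _ hρ.le]

theorem volume_ball_ne_zero (x : Rn n) {ρ : ℝ} (hρ : 0 < ρ) : volume (Metric.ball x ρ) ≠ 0 :=
  (Metric.measure_ball_pos _ _ hρ).ne'

theorem volume_ball_ne_top (x : Rn n) (ρ : ℝ) : volume (Metric.ball x ρ) ≠ ∞ :=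
  measure_ball_lt_top.ne

end Balls

/-! ### The John–Nirenberg inequality -/

section JohnNirenberg

variable {n : ℕ} {𝕜 : Type*} [RCLike 𝕜] {b : Rn n → 𝕜}

/-- The mean value of `b` over a ball. -/
noncomputable def ballAvg (b : Rn n → 𝕜) (x : Rn n) (r : ℝ) : 𝕜 := ⨍ z in Metric.ball x r, b z

/-- All mean oscillations of `b` over balls are at most `N`. -/
def OscillationLE (b : Rn n → 𝕜) (N : ℝ≥0) : Prop :=
  ∀ (x : Rn n) (r : ℝ), 0 < r →
    ∫⁻ y in Metric.ball x r, ‖b y - ballAvg b x r‖ₑ ≤ N * volume (Metric.ball x r)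

theorem enorm_ballAvg_sub_mul_le (hb : LocallyIntegrable b) (c : 𝕜) (x : Rn n) {r : ℝ}
    (hr : 0 < r) :
    ‖ballAvg b x r - c‖ₑ * volume (Metric.ball x r) ≤ ∫⁻ y in Metric.ball x r, ‖b y - c‖ₑ := by
  have h0 := volume_ball_ne_zero x hr
  have ht := volume_ball_ne_top x r
  have hi : IntegrableOn b (Metric.ball x r) :=
    (hb.integrableOn_isCompact (isCompact_closedBall x r)).mono_set Metric.ball_subset_closedBall
  have : IsFiniteMeasure (volume.restrict (Metric.ball x r)) :=
    ⟨by simpa using ht.lt_top⟩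
  have : NeZero (volume.restrict (Metric.ball x r)) :=
    ⟨by simpa [Measure.restrict_eq_zero] using h0⟩
  have e : ballAvg b x r - c = ⨍ y in Metric.ball x r, (b y - c) := by
    rw [ballAvg, average, average, integral_sub hi.to_average (integrable_const c)]
    simp [Measure.real, inv_mul_cancel₀ (ENNReal.toReal_ne_zero.2 ⟨h0, ht⟩)]
  rw [e, average]
  refine (mul_le_mul_left (enorm_integral_le_lintegral_enorm _) _).trans ?_
  rw [lintegral_smul_measure, Measure.restrict_apply_univ, smul_eq_mul, mul_comm, ← mul_assoc,
    ENNReal.mul_inv_cancel h0 ht, one_mul]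

theorem enorm_ballAvg_sub_ballAvg_le (hb : LocallyIntegrable b) {N : ℝ≥0}
    (hN : OscillationLE b N) {z w : Rn n} {ρ c : ℝ} (hρ : 0 < ρ) (hc : 0 < c)
    (h : Metric.ball z ρ ⊆ Metric.ball w (c * ρ)) :
    ‖ballAvg b z ρ - ballAvg b w (c * ρ)‖ₑ ≤ N * ENNReal.ofReal c ^ n := by
  have h0 := volume_ball_ne_zero z hρ
  have ht := volume_ball_ne_top z ρ
  rw [← ENNReal.mul_le_mul_iff_left h0 ht]
  refine (enorm_ballAvg_sub_mul_le hb _ z hρ).trans ?_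
  refine (lintegral_mono_set h).trans ((hN w (c * ρ) (by positivity)).trans ?_)
  rw [volume_ball_mul w z hc hρ, mul_assoc]

theorem lintegral_two_mul_ball_le (hb : LocallyIntegrable b) {N : ℝ≥0} (hN : OscillationLE b N)
    (x : Rn n) {r : ℝ} (hr : 0 < r) :
    ∫⁻ y in Metric.ball x (2 * r), ‖b y - ballAvg b x r‖ₑ
      ≤ (1 + 2 ^ n) * N * 2 ^ n * volume (Metric.ball x r) := by
  have h2 : (ENNReal.ofReal 2) = 2 := by simp
  have hd := enorm_ballAvg_sub_ballAvg_le hb hN (z := x) (w := x) hr (two_pos)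
    (Metric.ball_subset_ball (by linarith))
  rw [h2] at hd
  calc ∫⁻ y in Metric.ball x (2 * r), ‖b y - ballAvg b x r‖ₑ
      ≤ ∫⁻ y in Metric.ball x (2 * r), (‖b y - ballAvg b x (2 * r)‖ₑ + N * 2 ^ n) := by
        refine lintegral_mono fun y => ?_
        have : b y - ballAvg b x r = (b y - ballAvg b x (2 * r))
          - (ballAvg b x r - ballAvg b x (2 * r)) := by ring
        rw [this]
        exact (enorm_sub_le).trans (by gcongr)
    _ ≤ N * volume (Metric.ball x (2 * r)) + N * 2 ^ n * volume (Metric.ball x (2 * r)) := by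
        rw [lintegral_add_right _ measurable_const]
        simp only [lintegral_const, Measure.restrict_apply_univ]
        gcongr
        exact hN x _ (by positivity)
    _ = _ := by
        rw [volume_ball_mul x x two_pos hr, h2]; ring

/-- A Calderón–Zygmund stopping argument with balls. Around each point of the high level set take
the first radius at which the mean of |b - c| exceeds Λ. On the ball six times larger the mean of b
is still within Λ of c, so the induction hypothesis at level k applies there. Disjointness of the
selected balls bounds their total measure by ∫ H / Λ, and Λ is chosen so that this gains a factor
1/2 after the enlargement. -/
theorem volume_oscillation_step (hb : LocallyIntegrable b) {N : ℝ≥0} (hN0 : 0 < N)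
    (hN : OscillationLE b N) {Λ : ℝ≥0∞} (hΛ : Λ = 2 * 12 ^ n * ((1 + 2 ^ n) * N)) {k : ℕ}
    (ih : ∀ (x : Rn n) (r : ℝ), 0 < r →
      volume {y ∈ Metric.ball x r | k * Λ < ‖b y - ballAvg b x r‖ₑ}
        ≤ 2⁻¹ ^ k * volume (Metric.ball x r)) (x₀ : Rn n) {r₀ : ℝ} (hr₀ : 0 < r₀) :
    volume {y ∈ Metric.ball x₀ r₀ | (k + 1 : ℕ) * Λ < ‖b y - ballAvg b x₀ r₀‖ₑ}
      ≤ 2⁻¹ ^ (k + 1) * volume (Metric.ball x₀ r₀) := by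
  set c := ballAvg b x₀ r₀ with hc
  have hΛ0 : Λ ≠ 0 := by
    rw [hΛ]; positivity
  have hΛt : Λ ≠ ∞ := by
    rw [hΛ]; finiteness
  -- Truncation makes H integrable, while the doubled ball still contains every ball of radius at
  -- most r₀ centred in B(x₀,r₀).
  set H : Rn n → ℝ≥0∞ := (Metric.ball x₀ (2 * r₀)).indicator fun y => ‖b y - c‖ₑ with hH
  have hHm : AEMeasurable H :=
    ((hb.aestronglyMeasurable.sub aestronglyMeasurable_const).enorm).indicator measurableSet_ball
  have hHi : ∫⁻ y, H y ≤ (1 + 2 ^ n) * N * 2 ^ n * volume (Metric.ball x₀ r₀) := by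
    rw [hH, lintegral_indicator measurableSet_ball]
    exact lintegral_two_mul_ball_le hb hN x₀ hr₀
  have hHt : ∫⁻ y, H y ≠ ∞ :=
    ne_top_of_le_ne_top (by have := volume_ball_ne_top x₀ r₀; finiteness) hHi
  have hleb := (Besicovitch.vitaliFamily (volume : Measure (Rn n))).ae_tendsto_lintegral_div
    hHm hHt
  -- Only points at which averages of H over shrinking balls converge to H are kept; almost nothing
  -- is lost.
  set E : Set (Rn n) := {y | y ∈ Metric.ball x₀ r₀ ∧ (k + 1 : ℕ) * Λ < ‖b y - c‖ₑ ∧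
    Tendsto (fun a => (∫⁻ y in a, H y) / volume a)
      ((Besicovitch.vitaliFamily (volume : Measure (Rn n))).filterAt y) (𝓝 (H y))} with hE
  have hvE : volume {y ∈ Metric.ball x₀ r₀ | (k + 1 : ℕ) * Λ < ‖b y - c‖ₑ} ≤ volume E := by
    refine measure_mono_ae ?_
    filter_upwards [hleb] with y hy h
    exact ⟨h.1, h.2, hy⟩
  refine hvE.trans ?_
  have hsub : ∀ y ∈ Metric.ball x₀ r₀, Metric.closedBall y r₀ ⊆ Metric.ball x₀ (2 * r₀) := by
    intro y hy z hz
    rw [Metric.mem_ball] at hy ⊢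
    rw [Metric.mem_closedBall] at hz
    linarith [dist_triangle z y x₀]
  have hrad : ∀ y ∈ E, ∃ r : ℝ, 0 < r ∧ 6 * r ≤ r₀ ∧
      Λ * volume (Metric.closedBall y r) ≤ ∫⁻ z in Metric.closedBall y r, H z ∧
      ∫⁻ z in Metric.closedBall y (6 * r), H z ≤ Λ * volume (Metric.closedBall y (6 * r)) := by
    intro y hy
    obtain ⟨hyB, hyΛ, hyt⟩ := hy
    have hHy : Λ < H y := by
      rw [hH, indicator_of_mem (Metric.ball_subset_ball (by linarith) hyB)]
      refine lt_of_le_of_lt ?_ hyΛ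
      calc Λ = 1 * Λ := (one_mul _).symm
        _ ≤ _ := by gcongr; norm_cast; omega
    have hseq : Tendsto (fun i : ℕ => r₀ / 6 ^ i) atTop (𝓝[>] 0) := by
      refine tendsto_nhdsWithin_iff.2 ⟨?_, Eventually.of_forall fun i => by
        simp only [mem_Ioi]; positivity⟩
      have := (tendsto_pow_atTop_nhds_zero_of_lt_one (r := (6 : ℝ)⁻¹) (by norm_num)
        (by norm_num)).const_mul r₀
      simpa [div_eq_mul_inv] using this
    have hex : ∃ i : ℕ, Λ * volume (Metric.closedBall y (r₀ / 6 ^ i))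
        < ∫⁻ z in Metric.closedBall y (r₀ / 6 ^ i), H z := by
      have h1 := (hyt.comp ((Besicovitch.tendsto_filterAt (volume : Measure (Rn n)) y).comp
        hseq)).eventually (lt_mem_nhds hHy)
      obtain ⟨i, hi⟩ := h1.exists
      refine ⟨i, ?_⟩
      simp only [Function.comp_apply] at hi
      exact ENNReal.mul_lt_of_lt_div hi
    classical
    set i := Nat.find hex with hi
    have hispec := Nat.find_spec hex
    rw [← hi] at hispec
    -- At the initial radius r₀ the mean of H does not exceed Λ, by the choice of Λ, so a previous
    -- radius exists at which the selection failed.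
    have hi0 : i ≠ 0 := by
      intro h0
      rw [h0] at hispec
      refine absurd hispec (not_lt.2 ?_)
      simp only [pow_zero, div_one]
      rw [volume_closedBall_eq y hr₀]
      refine (setLIntegral_le_lintegral _ _).trans (hHi.trans ?_)
      have e1 : volume (Metric.ball x₀ r₀) = volume (Metric.ball y r₀) := by
        have := volume_ball_mul x₀ y one_pos hr₀
        simpa using this
      rw [e1, hΛ]
      refine mul_le_mul' ?_ le_rfl
      calc (1 + 2 ^ n) * (N : ℝ≥0∞) * 2 ^ n = 1 * 2 ^ n * ((1 + 2 ^ n) * N) := by ring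
        _ ≤ _ := by gcongr <;> norm_num
    obtain ⟨j, hj⟩ := Nat.exists_eq_succ_of_ne_zero hi0
    have hjn := Nat.find_min hex (m := j) (by omega)
    have h6 : 6 * (r₀ / 6 ^ i) = r₀ / 6 ^ j := by
      rw [hj, Nat.succ_eq_add_one, pow_succ]; field_simp
    refine ⟨r₀ / 6 ^ i, by positivity, ?_, hispec.le, ?_⟩
    · rw [h6]
      exact div_le_self hr₀.le (one_le_pow₀ (by norm_num))
    · rw [h6]; exact not_lt.1 hjn
  choose! r hr0 hr6 hrl hru using hrad
  -- The dilation 5 is below the ratio 6 of consecutive radii, so the closed enlargements fit in the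
  -- open balls of radius 6r, where the stopping condition failed.
  obtain ⟨u, huE, hud, hcov⟩ := Vitali.exists_disjoint_subfamily_covering_enlargement_closedBall
    E id r r₀ (fun y hy => by linarith [hr0 y hy, hr6 y hy]) 5 (by norm_num)
  have hucount : u.Countable := by
    refine hud.countable_of_nonempty_interior fun y hy => ?_
    exact ⟨y, Metric.ball_subset_interior_closedBall (Metric.mem_ball_self (hr0 y (huE hy)))⟩
  have hEsub : E ⊆ ⋃ y ∈ u, (E ∩ Metric.ball y (6 * r y)) := by
    intro z hz
    obtain ⟨y, hy, hyz⟩ := hcov z hz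
    have hpos := hr0 y (huE hy)
    refine mem_iUnion₂.2 ⟨y, hy, hz, ?_⟩
    have := hyz (Metric.mem_closedBall_self (hr0 z hz).le)
    simp only [id, Metric.mem_closedBall] at this
    rw [Metric.mem_ball]; linarith
  have hpiece : ∀ y ∈ u, Λ * volume (E ∩ Metric.ball y (6 * r y))
      ≤ 2⁻¹ ^ k * 6 ^ n * ∫⁻ z in Metric.closedBall y (r y), H z := by
    intro y hy
    have hpos := hr0 y (huE hy)
    have hpos6 : 0 < 6 * r y := by positivity
    have hyB : y ∈ Metric.ball x₀ r₀ := (huE hy).1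
    have havg : ‖ballAvg b y (6 * r y) - c‖ₑ ≤ Λ := by
      rw [← ENNReal.mul_le_mul_iff_left (volume_ball_ne_zero y hpos6) (volume_ball_ne_top y _)]
      refine (enorm_ballAvg_sub_mul_le hb c y hpos6).trans ?_
      rw [← volume_closedBall_eq y hpos6]
      refine le_trans ?_ (hru y (huE hy))
      refine le_trans ?_ (lintegral_mono_set Metric.ball_subset_closedBall)
      refine setLIntegral_mono' measurableSet_ball fun z hz => ?_
      rw [hH, indicator_of_mem]
      exact hsub y hyB (Metric.closedBall_subset_closedBall (hr6 y (huE hy))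
        (Metric.ball_subset_closedBall hz))
    have hin : E ∩ Metric.ball y (6 * r y) ⊆ {z ∈ Metric.ball y (6 * r y) |
        k * Λ < ‖b z - ballAvg b y (6 * r y)‖ₑ} := by
      rintro z ⟨hzE, hzB⟩
      refine ⟨hzB, ?_⟩
      by_contra hcon
      rw [not_lt] at hcon
      refine absurd hzE.2.1 (not_lt.2 ?_)
      have : b z - c = (b z - ballAvg b y (6 * r y)) + (ballAvg b y (6 * r y) - c) := by ring
      rw [this]
      refine (enorm_add_le _ _).trans ((add_le_add hcon havg).trans (le_of_eq ?_))
      push_cast; ring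
    calc Λ * volume (E ∩ Metric.ball y (6 * r y))
        ≤ Λ * (2⁻¹ ^ k * volume (Metric.ball y (6 * r y))) := by
          gcongr
          exact (measure_mono hin).trans (ih y _ hpos6)
      _ = 2⁻¹ ^ k * 6 ^ n * (Λ * volume (Metric.closedBall y (r y))) := by
          rw [volume_ball_mul y y (by norm_num) hpos, volume_closedBall_eq y hpos]
          have : ENNReal.ofReal 6 = 6 := by simp
          rw [this]; ring
      _ ≤ _ := by gcongr; exact hrl y (huE hy)
  rw [← ENNReal.mul_le_mul_iff_right hΛ0 hΛt]
  have := hucount.to_subtype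
  calc Λ * volume E ≤ Λ * ∑' y : u, volume (E ∩ Metric.ball (y : Rn n) (6 * r y)) := by
        gcongr
        exact (measure_mono hEsub).trans (measure_biUnion_le _ hucount _)
    _ = ∑' y : u, Λ * volume (E ∩ Metric.ball (y : Rn n) (6 * r y)) := ENNReal.tsum_mul_left.symm
    _ ≤ ∑' y : u, 2⁻¹ ^ k * 6 ^ n * ∫⁻ z in Metric.closedBall (y : Rn n) (r y), H z :=
        ENNReal.tsum_le_tsum fun y => hpiece y y.2
    _ = 2⁻¹ ^ k * 6 ^ n * ∑' y : u, ∫⁻ z in Metric.closedBall (y : Rn n) (r y), H z :=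
        ENNReal.tsum_mul_left
    _ = 2⁻¹ ^ k * 6 ^ n * ∫⁻ z in ⋃ y ∈ u, Metric.closedBall y (r y), H z := by
        congr 1
        exact (lintegral_biUnion hucount (fun _ _ => measurableSet_closedBall) hud H).symm
    _ ≤ 2⁻¹ ^ k * 6 ^ n * ((1 + 2 ^ n) * N * 2 ^ n * volume (Metric.ball x₀ r₀)) := by
        gcongr
        exact (setLIntegral_le_lintegral _ _).trans hHi
    _ = Λ * (2⁻¹ ^ (k + 1) * volume (Metric.ball x₀ r₀)) := by
        rw [hΛ]
        have h12 : (12 : ℝ≥0∞) ^ n = 6 ^ n * 2 ^ n := by rw [← mul_pow]; norm_num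
        have h22 : (2 : ℝ≥0∞) * 2⁻¹ = 1 := ENNReal.mul_inv_cancel (by norm_num) (by norm_num)
        rw [h12, pow_succ]
        calc _ = (2⁻¹ ^ k * 6 ^ n * ((1 + 2 ^ n) * N * 2 ^ n * volume (Metric.ball x₀ r₀))) * 1 := by
              ring
          _ = _ := by rw [← h22]; ring

/-- The John–Nirenberg inequality, in the form of a decay of distribution functions. -/
theorem volume_oscillation_le (hb : LocallyIntegrable b) {N : ℝ≥0} (hN0 : 0 < N)
    (hN : OscillationLE b N) {Λ : ℝ≥0∞} (hΛ : Λ = 2 * 12 ^ n * ((1 + 2 ^ n) * N)) (k : ℕ)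
    (x : Rn n) {r : ℝ} (hr : 0 < r) :
    volume {y ∈ Metric.ball x r | k * Λ < ‖b y - ballAvg b x r‖ₑ}
        ≤ 2⁻¹ ^ k * volume (Metric.ball x r) := by
  induction k generalizing x r with
  | zero => exact (measure_mono (sep_subset _ _)).trans (by simp)
  | succ k ih => exact volume_oscillation_step hb hN0 hN hΛ (fun x r hr => ih x hr) x hr

theorem tsum_rpow_mul_two_inv_pow_lt_top {Λ : ℝ≥0∞} (hΛ : Λ ≠ ∞) {m : ℝ} (hm : 0 < m) :
    ∑' k : ℕ, ((k + 1 : ℕ) * Λ) ^ m * (2⁻¹ : ℝ≥0∞) ^ k < ∞ := by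
  set M := ⌈m⌉₊
  have hs : Summable fun k : ℕ => ((k + 1 : ℕ) : ℝ) ^ M * (1 / 2 : ℝ) ^ (k + 1) :=
    (summable_nat_add_iff 1).2
      (summable_pow_mul_geometric_of_norm_lt_one (R := ℝ) M (r := 1 / 2) (by norm_num))
  have h1 := hs.tsum_ofReal_lt_top
  have h2 : ∑' k : ℕ, ((k + 1 : ℕ) * Λ) ^ m * (2⁻¹ : ℝ≥0∞) ^ k
      ≤ ∑' k : ℕ, (Λ ^ m * 2) * ENNReal.ofReal (((k + 1 : ℕ) : ℝ) ^ M * (1 / 2 : ℝ) ^ (k + 1)) := by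
    refine ENNReal.tsum_le_tsum fun k => ?_
    rw [ENNReal.mul_rpow_of_nonneg _ _ hm.le, ENNReal.ofReal_mul (by positivity),
      ENNReal.ofReal_pow (by positivity), ENNReal.ofReal_natCast, ENNReal.ofReal_pow (by norm_num)]
    have h3 : ((k + 1 : ℕ) : ℝ≥0∞) ^ m ≤ ((k + 1 : ℕ) : ℝ≥0∞) ^ M := by
      rw [← ENNReal.rpow_natCast]
      exact ENNReal.rpow_le_rpow_of_exponent_le (by norm_cast; omega) (Nat.le_ceil m)
    have h4 : ENNReal.ofReal (1 / 2) = 2⁻¹ := by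
      rw [one_div, ENNReal.ofReal_inv_of_pos two_pos]; simp
    have h22 : (2 : ℝ≥0∞) * 2⁻¹ = 1 := ENNReal.mul_inv_cancel (by norm_num) (by norm_num)
    rw [h4]
    calc _ ≤ ((k + 1 : ℕ) : ℝ≥0∞) ^ M * Λ ^ m * 2⁻¹ ^ k * (2 * 2⁻¹) := by
          rw [h22, mul_one]; gcongr
      _ = _ := by rw [pow_succ]; ring
  refine h2.trans_lt ?_
  rw [ENNReal.tsum_mul_left]
  exact ENNReal.mul_lt_top (ENNReal.mul_lt_top (ENNReal.rpow_lt_top_of_nonneg hm.le hΛ)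
    (by norm_num)) h1

/-- All `L^m` mean oscillations of a function with bounded mean oscillation are bounded. -/
theorem exists_lintegral_oscillation_rpow_le (hbm : StronglyMeasurable b)
    (hb : LocallyIntegrable b) {N : ℝ≥0} (hN : OscillationLE b N) {m : ℝ} (hm : 0 < m) :
    ∃ C : ℝ≥0, ∀ (x : Rn n) (r : ℝ), 0 < r →
      ∫⁻ y in Metric.ball x r, ‖b y - ballAvg b x r‖ₑ ^ m ≤ C * volume (Metric.ball x r) := by
  -- The decay estimate needs a positive bound, and N may vanish.
  have hN' : OscillationLE b (N + 1) := fun x r hr => (hN x r hr).trans (by gcongr; simp)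
  set Λ : ℝ≥0∞ := 2 * 12 ^ n * ((1 + 2 ^ n) * (N + 1 : ℝ≥0)) with hΛ
  have hΛ0 : Λ ≠ 0 := by
    rw [hΛ]; positivity
  have hΛt : Λ ≠ ∞ := by
    rw [hΛ]; finiteness
  have hfin := tsum_rpow_mul_two_inv_pow_lt_top hΛt hm
  refine ⟨(∑' k : ℕ, ((k + 1 : ℕ) * Λ) ^ m * (2⁻¹ : ℝ≥0∞) ^ k).toNNReal, fun x r hr => ?_⟩
  rw [ENNReal.coe_toNNReal hfin.ne]
  have hms : ∀ k : ℕ, MeasurableSet {y | k * Λ < ‖b y - ballAvg b x r‖ₑ} := fun k =>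
    measurableSet_lt measurable_const (hbm.sub stronglyMeasurable_const).enorm
  -- Only one term is used: the k for which the oscillation lies in (kΛ, (k+1)Λ].
  have hpt : ∀ y, ‖b y - ballAvg b x r‖ₑ ^ m ≤ ∑' k : ℕ,
      {y | k * Λ < ‖b y - ballAvg b x r‖ₑ}.indicator (fun _ => ((k + 1 : ℕ) * Λ) ^ m) y := by
    intro y
    set X := ‖b y - ballAvg b x r‖ₑ with hX
    rcases eq_or_ne X 0 with h0 | h0
    · rw [h0, ENNReal.zero_rpow_of_pos hm]; exact zero_le
    have hex : ∃ k : ℕ, X ≤ (k + 1 : ℕ) * Λ := by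
      obtain ⟨k, hk⟩ := ENNReal.exists_nat_mul_gt hΛ0 (enorm_ne_top (x := b y - ballAvg b x r))
      refine ⟨k, hk.le.trans ?_⟩
      gcongr; omega
    classical
    set k := Nat.find hex with hk
    have hspec := Nat.find_spec hex
    rw [← hk] at hspec
    have hlt : k * Λ < X := by
      rcases Nat.eq_zero_or_pos k with h | h
      · rw [h]; simpa using pos_iff_ne_zero.2 h0
      · have := Nat.find_min hex (m := k - 1) (by omega)
        rw [Nat.sub_add_cancel h] at this
        exact not_le.1 this
    refine le_trans ?_ (ENNReal.le_tsum k)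
    rw [indicator_of_mem (by exact hlt)]
    gcongr
  calc ∫⁻ y in Metric.ball x r, ‖b y - ballAvg b x r‖ₑ ^ m
      ≤ ∫⁻ y in Metric.ball x r, ∑' k : ℕ, {y | k * Λ < ‖b y - ballAvg b x r‖ₑ}.indicator
        (fun _ => ((k + 1 : ℕ) * Λ) ^ m) y := lintegral_mono fun y => hpt y
    _ = ∑' k : ℕ, ∫⁻ y in Metric.ball x r, {y | k * Λ < ‖b y - ballAvg b x r‖ₑ}.indicator
        (fun _ => ((k + 1 : ℕ) * Λ) ^ m) y :=
        lintegral_tsum fun k => (measurable_const.indicator (hms k)).aemeasurable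
    _ ≤ ∑' k : ℕ, (((k + 1 : ℕ) * Λ) ^ m * 2⁻¹ ^ k) * volume (Metric.ball x r) := by
        refine ENNReal.tsum_le_tsum fun k => ?_
        rw [lintegral_indicator_const (hms k), Measure.restrict_apply (hms k), mul_assoc]
        gcongr
        refine le_trans (le_of_eq ?_) (volume_oscillation_le hb (by positivity) hN' hΛ k x hr)
        rw [inter_comm]; rfl
    _ = _ := ENNReal.tsum_mul_right

end JohnNirenberg

end VanishingMorrey

namespace VanishingMorrey

open MeasureTheory Filter Topology Set
open scoped ENNReal NNReal

/-! ### Oscillation of b over pairs of balls -/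

section OscillationWeight

variable {n : ℕ} {𝕜 : Type*} [RCLike 𝕜] {b : Rn n → 𝕜}

/-- Telescoping over successive doublings of the radius, each of which costs N 2^n. -/
theorem enorm_ballAvg_sub_pow_two_mul_le (hb : LocallyIntegrable b) {N : ℝ≥0}
    (hN : OscillationLE b N) (z : Rn n) {ρ : ℝ} (hρ : 0 < ρ) (j : ℕ) :
    ‖ballAvg b z ρ - ballAvg b z (2 ^ j * ρ)‖ₑ ≤ j * (N * 2 ^ n) := by
  induction j with
  | zero => simp
  | succ j ih =>
    have h := enorm_ballAvg_sub_ballAvg_le hb hN (z := z) (w := z) (ρ := 2 ^ j * ρ)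
      (by positivity) two_pos (Metric.ball_subset_ball (by linarith [show 0 < 2 ^ j * ρ by positivity]))
    have e : ballAvg b z ρ - ballAvg b z (2 ^ (j + 1) * ρ)
        = (ballAvg b z ρ - ballAvg b z (2 ^ j * ρ))
          + (ballAvg b z (2 ^ j * ρ) - ballAvg b z (2 * (2 ^ j * ρ))) := by
      rw [← mul_assoc 2, ← pow_succ']; ring
    rw [e]
    refine (enorm_add_le _ _).trans ((add_le_add ih h).trans (le_of_eq ?_))
    simp only [ENNReal.ofReal_ofNat]
    push_cast; ring

/-- Mean values over comparable balls differ by at most a logarithm of the ratio of the radii. -/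
theorem enorm_ballAvg_sub_le_log (hb : LocallyIntegrable b) {N : ℝ≥0}
    (hN : OscillationLE b N) {z w : Rn n} {ρ σ : ℝ} (hρ : 0 < ρ) (hρσ : ρ ≤ σ)
    (hzw : dist z w ≤ σ) :
    ‖ballAvg b z ρ - ballAvg b w (2 * σ)‖ₑ
      ≤ N * 4 ^ n * 2 * ENNReal.ofReal (1 + Real.log (σ / ρ)) := by
  have hσ : 0 < σ := hρ.trans_le hρσ
  obtain ⟨j, hj1, hj2⟩ := exists_nat_pow_near ((one_le_div hρ).2 hρσ) (one_lt_two : (1 : ℝ) < 2)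
  rw [le_div_iff₀ hρ] at hj1
  rw [div_lt_iff₀ hρ] at hj2
  have hjρ : 0 < 2 ^ j * ρ := by positivity
  -- After j doublings one final step changes the centre. B(w,2σ) contains B(z,2^j ρ) because 2^j ρ
  -- and dist z w are both at most σ, and the maximality of j keeps the ratio c below 4.
  set c := 2 * σ / (2 ^ j * ρ) with hc
  have hc0 : 0 < c := by positivity
  have hcσ : c * (2 ^ j * ρ) = 2 * σ := by rw [hc]; field_simp
  have hc4 : c ≤ 4 := by
    rw [hc, div_le_iff₀ hjρ]; rw [pow_succ] at hj2; linarith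
  have h1 := enorm_ballAvg_sub_pow_two_mul_le hb hN z hρ j
  have h2 := enorm_ballAvg_sub_ballAvg_le hb hN (z := z) (w := w) hjρ hc0 (by
    rw [hcσ]; exact Metric.ball_subset_ball' (by linarith))
  rw [hcσ] at h2
  have hlog : (1 + j : ℝ) ≤ 2 * (1 + Real.log (σ / ρ)) := by
    have h3 : (j : ℝ) * Real.log 2 ≤ Real.log (σ / ρ) := by
      rw [← Real.log_pow]
      exact Real.log_le_log (by positivity) (by rwa [le_div_iff₀ hρ])
    have h4 : (1 : ℝ) / 2 ≤ Real.log 2 := by linarith [Real.log_two_gt_d9]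
    have : (j : ℝ) * (1 / 2) ≤ j * Real.log 2 := by gcongr
    linarith
  have hlog' : (1 + j : ℝ≥0∞) ≤ 2 * ENNReal.ofReal (1 + Real.log (σ / ρ)) := by
    have := ENNReal.ofReal_le_ofReal hlog
    rwa [ENNReal.ofReal_add zero_le_one (by positivity), ENNReal.ofReal_one,
      ENNReal.ofReal_natCast, ENNReal.ofReal_mul two_pos.le, ENNReal.ofReal_ofNat] at this
  have e : ballAvg b z ρ - ballAvg b w (2 * σ) = (ballAvg b z ρ - ballAvg b z (2 ^ j * ρ))
      + (ballAvg b z (2 ^ j * ρ) - ballAvg b w (2 * σ)) := by ring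
  rw [e]
  calc _ ≤ j * (N * 2 ^ n) + N * ENNReal.ofReal c ^ n :=
        (enorm_add_le _ _).trans (add_le_add h1 h2)
    _ ≤ j * (N * 4 ^ n) + N * 4 ^ n := by
        gcongr
        · norm_num
        · exact ENNReal.ofReal_le_of_le_toReal (by simpa using hc4)
    _ = N * 4 ^ n * (1 + j) := by ring
    _ ≤ _ := by rw [mul_assoc _ 2]; gcongr

theorem one_le_ofReal_one_add_log {ρ σ : ℝ} (hρ : 0 < ρ) (hρσ : ρ ≤ σ) :
    1 ≤ ENNReal.ofReal (1 + Real.log (σ / ρ)) := by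
  rw [ENNReal.one_le_ofReal]
  linarith [Real.log_nonneg ((one_le_div hρ).2 hρσ)]

/-- Compare b with its mean over B(z,ρ), where John–Nirenberg applies, and that mean with the one
over B(w,2σ), where the logarithm enters. Since the logarithmic factor is at least 1, it absorbs all
constants. -/
theorem exists_lintegral_one_add_oscillation_rpow_le (hbm : StronglyMeasurable b)
    (hb : LocallyIntegrable b) {N : ℝ≥0} (hN : OscillationLE b N) {m : ℝ} (hm : 1 ≤ m) :
    ∃ C : ℝ≥0, ∀ (z w : Rn n) (ρ σ : ℝ), 0 < ρ → ρ ≤ σ → dist z w ≤ σ →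
      ∫⁻ y in Metric.ball z ρ, (1 + ‖b y - ballAvg b w (2 * σ)‖ₑ) ^ m
        ≤ (C * ENNReal.ofReal (1 + Real.log (σ / ρ))) ^ m * volume (Metric.ball z ρ) := by
  have hm0 : 0 < m := by linarith
  obtain ⟨A, hA⟩ := exists_lintegral_oscillation_rpow_le hbm hb hN hm0
  set K : ℝ≥0∞ := 1 + N * 4 ^ n * 2 with hK
  set D : ℝ≥0∞ := 2 ^ (m - 1) * (A + K ^ m) with hD
  have hKt : K ≠ ∞ := by rw [hK]; finiteness
  have hDt : D ≠ ∞ := by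
    have h1 : (2 : ℝ≥0∞) ^ (m - 1) ≠ ∞ :=
      ENNReal.rpow_ne_top_of_nonneg (by linarith) (by norm_num)
    have h2 : K ^ m ≠ ∞ := ENNReal.rpow_ne_top_of_nonneg hm0.le hKt
    rw [hD]; finiteness
  have hD't : D ^ (1 / m) ≠ ∞ := ENNReal.rpow_ne_top_of_nonneg (by positivity) hDt
  refine ⟨(D ^ (1 / m)).toNNReal, fun z w ρ σ hρ hρσ hzw => ?_⟩
  rw [ENNReal.coe_toNNReal hD't]
  set L := ENNReal.ofReal (1 + Real.log (σ / ρ)) with hL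
  have hL1 : 1 ≤ L := one_le_ofReal_one_add_log hρ hρσ
  have hcmp := enorm_ballAvg_sub_le_log hb hN hρ hρσ hzw
  rw [← hL] at hcmp
  have hpt : ∀ y, (1 + ‖b y - ballAvg b w (2 * σ)‖ₑ) ^ m
      ≤ 2 ^ (m - 1) * (‖b y - ballAvg b z ρ‖ₑ ^ m + (K * L) ^ m) := by
    intro y
    refine le_trans ?_ (ENNReal.rpow_add_le_mul_rpow_add_rpow _ _ hm)
    refine ENNReal.rpow_le_rpow ?_ hm0.le
    have e : b y - ballAvg b w (2 * σ) = (b y - ballAvg b z ρ)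
      + (ballAvg b z ρ - ballAvg b w (2 * σ)) := by ring
    rw [e]
    calc _ ≤ L + (‖b y - ballAvg b z ρ‖ₑ + N * 4 ^ n * 2 * L) := by
          gcongr; exact (enorm_add_le _ _).trans (by gcongr)
      _ = _ := by rw [hK]; ring
  have hmeas : Measurable fun y => ‖b y - ballAvg b z ρ‖ₑ ^ m :=
    (hbm.sub stronglyMeasurable_const).enorm.pow_const m
  calc _ ≤ ∫⁻ y in Metric.ball z ρ, 2 ^ (m - 1) * (‖b y - ballAvg b z ρ‖ₑ ^ m + (K * L) ^ m) :=
        lintegral_mono hpt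
    _ = 2 ^ (m - 1) * ((∫⁻ y in Metric.ball z ρ, ‖b y - ballAvg b z ρ‖ₑ ^ m)
          + (K * L) ^ m * volume (Metric.ball z ρ)) := by
        rw [lintegral_const_mul _ (hmeas.add_const _), lintegral_add_right _ measurable_const]
        simp
    _ ≤ 2 ^ (m - 1) * (A * L ^ m * volume (Metric.ball z ρ)
          + (K * L) ^ m * volume (Metric.ball z ρ)) := by
        gcongr
        refine (hA z ρ hρ).trans ?_
        gcongr
        exact le_mul_of_one_le_right' (ENNReal.one_le_rpow hL1 hm0)
    _ = _ := by
        rw [ENNReal.mul_rpow_of_nonneg _ _ hm0.le, ENNReal.mul_rpow_of_nonneg _ _ hm0.le,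
          ← ENNReal.rpow_mul, one_div_mul_cancel hm0.ne', ENNReal.rpow_one, hD]
        ring

/-- The weight `1 + |b(x) - b(y)|`. -/
noncomputable def oscWeight (b : Rn n → 𝕜) (x y : Rn n) : ℝ≥0∞ := 1 + ‖b x - b y‖ₑ

theorem measurable_oscWeight (hbm : StronglyMeasurable b) :
    Measurable (Function.uncurry (oscWeight b)) :=
  measurable_const.add
    ((hbm.comp_measurable measurable_fst).sub (hbm.comp_measurable measurable_snd)).enorm

/-- Both b(x) and b(y) are compared with the single mean over B(w,2σ), so that the weight is
dominated by a sum of functions of one variable. Two radii ρ₁, ρ₂ above a common ρ serve balls of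
equal size as well as pairs of very different sizes. -/
theorem exists_lintegral_oscWeight_rpow_le (hbm : StronglyMeasurable b)
    (hb : LocallyIntegrable b) {N : ℝ≥0} (hN : OscillationLE b N) {m : ℝ} (hm : 1 ≤ m) :
    ∃ C : ℝ≥0, ∀ (z₁ z₂ w : Rn n) (ρ ρ₁ ρ₂ σ : ℝ), 0 < ρ → ρ ≤ ρ₁ → ρ₁ ≤ σ → ρ ≤ ρ₂ → ρ₂ ≤ σ →
      dist z₁ w ≤ σ → dist z₂ w ≤ σ →
      ∫⁻ x in Metric.ball z₁ ρ₁, ∫⁻ y in Metric.ball z₂ ρ₂, oscWeight b x y ^ m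
        ≤ (C * ENNReal.ofReal (1 + Real.log (σ / ρ))) ^ m
          * (volume (Metric.ball z₁ ρ₁) * volume (Metric.ball z₂ ρ₂)) := by
  have hm0 : 0 < m := by linarith
  obtain ⟨C, hC⟩ := exists_lintegral_one_add_oscillation_rpow_le hbm hb hN hm
  refine ⟨2 * C, fun z₁ z₂ w ρ ρ₁ ρ₂ σ hρ h1 h1σ h2 h2σ hz1 hz2 => ?_⟩
  set L := ENNReal.ofReal (1 + Real.log (σ / ρ)) with hL
  set A : Rn n → ℝ≥0∞ := fun y => (1 + ‖b y - ballAvg b w (2 * σ)‖ₑ) ^ m with hA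
  have hAm : Measurable A :=
    (measurable_const.add (hbm.sub stronglyMeasurable_const).enorm).pow_const m
  have hball : ∀ (z : Rn n) (ρ' : ℝ), ρ ≤ ρ' → ρ' ≤ σ → dist z w ≤ σ →
      ∫⁻ y in Metric.ball z ρ', A y ≤ (C * L) ^ m * volume (Metric.ball z ρ') := by
    intro z ρ' h hσ hz
    refine (hC z w ρ' σ (hρ.trans_le h) hσ hz).trans ?_
    gcongr
    exact ENNReal.ofReal_le_ofReal (by
      have := Real.log_le_log (x := σ / ρ') (y := σ / ρ)
        (div_pos (hρ.trans_le (h.trans hσ)) (hρ.trans_le h))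
        (div_le_div_of_nonneg_left (hρ.le.trans (h.trans hσ)) hρ h)
      linarith)
  have hpt : ∀ x y, oscWeight b x y ^ m ≤ 2 ^ (m - 1) * (A x + A y) := by
    intro x y
    refine le_trans ?_ (ENNReal.rpow_add_le_mul_rpow_add_rpow _ _ hm)
    refine ENNReal.rpow_le_rpow ?_ hm0.le
    rw [oscWeight]
    have e : b x - b y = (b x - ballAvg b w (2 * σ)) - (b y - ballAvg b w (2 * σ)) := by ring
    rw [e]
    calc _ ≤ 1 + (‖b x - ballAvg b w (2 * σ)‖ₑ + ‖b y - ballAvg b w (2 * σ)‖ₑ) := by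
          gcongr; exact enorm_sub_le
      _ ≤ 1 + (‖b x - ballAvg b w (2 * σ)‖ₑ + ‖b y - ballAvg b w (2 * σ)‖ₑ) + 1 := le_self_add
      _ = _ := by ring
  have hin : ∀ x, ∫⁻ y in Metric.ball z₂ ρ₂, oscWeight b x y ^ m
      ≤ 2 ^ (m - 1) * (A x * volume (Metric.ball z₂ ρ₂)
        + (C * L) ^ m * volume (Metric.ball z₂ ρ₂)) := by
    intro x
    refine (lintegral_mono (hpt x)).trans ?_
    rw [lintegral_const_mul _ (hAm.const_add _), lintegral_add_left measurable_const]
    simp only [lintegral_const, Measure.restrict_apply_univ]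
    gcongr
    exact hball z₂ ρ₂ h2 h2σ hz2
  refine (lintegral_mono hin).trans ?_
  rw [lintegral_const_mul _ ((hAm.mul_const _).add_const _),
    lintegral_add_right _ measurable_const, lintegral_mul_const _ hAm]
  simp only [lintegral_const, Measure.restrict_apply_univ]
  calc _ ≤ 2 ^ (m - 1) * ((C * L) ^ m * volume (Metric.ball z₁ ρ₁) * volume (Metric.ball z₂ ρ₂)
        + (C * L) ^ m * volume (Metric.ball z₂ ρ₂) * volume (Metric.ball z₁ ρ₁)) := by
        gcongr
        exact hball z₁ ρ₁ h1 h1σ hz1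
    _ = (2 ^ (m - 1) * 2) * (C * L) ^ m
        * (volume (Metric.ball z₁ ρ₁) * volume (Metric.ball z₂ ρ₂)) := by ring
    _ = _ := by
        have h2m : (2 : ℝ≥0∞) ^ (m - 1) * 2 = 2 ^ m := by
          conv_lhs => rw [← ENNReal.rpow_one 2, ← ENNReal.rpow_mul,
            ← ENNReal.rpow_add _ _ (by norm_num) (by norm_num)]
          congr 1; ring
        rw [h2m, ENNReal.coe_mul, mul_assoc (_ : ℝ≥0∞) (C : ℝ≥0∞),
          ENNReal.mul_rpow_of_nonneg (_ : ℝ≥0∞) (C * L) hm0.le]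
        simp

end OscillationWeight

end VanishingMorrey

namespace VanishingMorrey

open MeasureTheory Filter Topology Set
open scoped ENNReal NNReal

/-! ### The bilinear form at a single scale -/

section Scale

variable {n : ℕ} {𝕜 : Type*} [RCLike 𝕜] {b : Rn n → 𝕜}

theorem volume_ball_mul_rpow (x : Rn n) {c ρ : ℝ} (hc : 0 < c) (hρ : 0 < ρ) :
    volume (Metric.ball x (c * ρ))
      = ENNReal.ofReal ρ ^ (n : ℝ) * volume (Metric.ball (0 : Rn n) c) := by
  rw [mul_comm c, volume_ball_mul x 0 hρ hc, ENNReal.rpow_natCast]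

theorem measurable_lintegral_ball (ρ : ℝ) {F : Rn n → ℝ≥0∞} (hF : Measurable F) :
    Measurable fun z => ∫⁻ y in Metric.ball z ρ, F y := by
  have : ∀ z, ∫⁻ y in Metric.ball z ρ, F y = ∫⁻ y,
      {p : Rn n × Rn n | dist p.2 p.1 < ρ}.indicator (fun p => F p.2) (z, y) := by
    intro z
    rw [← lintegral_indicator measurableSet_ball]; rfl
  simp_rw [this]
  exact ((hF.comp measurable_snd).indicator
    (measurableSet_lt (measurable_snd.dist measurable_fst)
      measurable_const)).lintegral_prod_right'

/-- Tonelli: a given x lies in B(z,ρ) exactly for z in B(x,ρ), whose volume does not depend on x. -/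
theorem volume_ball_mul_lintegral {I : Rn n → ℝ≥0∞} (hI : Measurable I) (w : Rn n) (ρ : ℝ) :
    ∫⁻ z, ∫⁻ x in Metric.ball z ρ, I x = volume (Metric.ball w ρ) * ∫⁻ x, I x := by
  have hm : Measurable (Function.uncurry fun z x : Rn n =>
      {p : Rn n × Rn n | dist p.2 p.1 < ρ}.indicator (fun p => I p.2) (z, x)) :=
    (hI.comp measurable_snd).indicator
      (measurableSet_lt (measurable_snd.dist measurable_fst) measurable_const)
  have h1 : ∀ z, ∫⁻ x in Metric.ball z ρ, I x = ∫⁻ x,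
      {p : Rn n × Rn n | dist p.2 p.1 < ρ}.indicator (fun p => I p.2) (z, x) := by
    intro z
    rw [← lintegral_indicator measurableSet_ball]
    rfl
  simp_rw [h1]
  rw [lintegral_lintegral_swap hm.aemeasurable]
  have h2 : ∀ x, ∫⁻ z, {p : Rn n × Rn n | dist p.2 p.1 < ρ}.indicator (fun p => I p.2) (z, x)
      = volume (Metric.ball w ρ) * I x := by
    intro x
    have : ∀ z, {p : Rn n × Rn n | dist p.2 p.1 < ρ}.indicator (fun p => I p.2) (z, x)
        = (Metric.ball x ρ).indicator (fun _ => I x) z := by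
      intro z
      simp only [indicator, mem_ofPred_eq, Metric.mem_ball, dist_comm x z]
    simp_rw [this]
    rw [lintegral_indicator_const measurableSet_ball, mul_comm,
      Measure.addHaar_ball_center, Measure.addHaar_ball_center volume w]
  simp_rw [h2]
  rw [lintegral_const_mul _ hI]

/-- The `L^s` norm of `W` over balls centred at the origin grows at most like that of a constant. -/
def GrowthLE (W : Rn n → ℝ≥0∞) (s : ℝ) (A : ℝ≥0) : Prop :=
  ∀ R : ℝ, 0 < R → ∫⁻ z in Metric.ball (0 : Rn n) R, W z ^ s ≤ A * ENNReal.ofReal R ^ (n : ℝ)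

/-- The integrand of the bilinear form of the operators considered here, without its kernel of
homogeneity. -/
noncomputable def pairing (b : Rn n → 𝕜) (W f g : Rn n → ℝ≥0∞) (x y : Rn n) : ℝ≥0∞ :=
  f y * g x * W (x - y) * oscWeight b x y

theorem measurable_pairing (hbm : StronglyMeasurable b) {W f g : Rn n → ℝ≥0∞}
    (hW : Measurable W) (hf : Measurable f) (hg : Measurable g) :
    Measurable (Function.uncurry (pairing b W f g)) :=
  (((hf.comp measurable_snd).mul (hg.comp measurable_fst)).mul
    (hW.comp (measurable_fst.sub measurable_snd))).mul (measurable_oscWeight hbm)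

/-- The truncated form is localised to balls of radius 2ρ by averaging over their centres. On each
such ball the mean oscillations of b are bounded without a logarithm and the bilinear bound applies;
the local norms are then reassembled, which requires u + v ≥ 1. The exponent w disappears from the
power of ρ since W grows like a constant. -/
theorem exists_lintegral_pairing_le (hbm : StronglyMeasurable b)
    (hb : LocallyIntegrable b) {N : ℝ≥0} (hN : OscillationLE b N) {W : Rn n → ℝ≥0∞}
    (hW : Measurable W) {u v w : ℝ} {A : ℝ≥0} (hWA : GrowthLE W (1 / w) A)
    (hu0 : 0 < u) (hv0 : 0 < v) (hw0 : 0 < w)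
    (hu : u < 1) (hv : v < 1) (hw : w < 1) (h : u + v + w < 2) (huv : 1 ≤ u + v) :
    ∃ C : ℝ≥0, ∀ (ρ : ℝ) (f g : Rn n → ℝ≥0∞), 0 < ρ → Measurable f → Measurable g →
      ∫⁻ x, ∫⁻ y, pairing b ((Metric.ball 0 ρ).indicator W) f g x y
        ≤ C * ENNReal.ofReal ρ ^ (n * (2 - u - v))
          * ((∫⁻ y, f y ^ (1 / u)) ^ u * (∫⁻ x, g x ^ (1 / v)) ^ v) := by
  obtain ⟨m, hm, hbil⟩ := exists_bilinear_bound hu0 hv0 hw0 hu hv hw h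
  have hm0 : 0 < m := by linarith
  obtain ⟨B, hB⟩ := exists_lintegral_oscWeight_rpow_le hbm hb hN hm
  set V₁ := volume (Metric.ball (0 : Rn n) 1) with hV₁
  set V₂ := volume (Metric.ball (0 : Rn n) 2) with hV₂
  set V₄ := volume (Metric.ball (0 : Rn n) 4) with hV₄
  have hV₁0 : V₁ ≠ 0 := volume_ball_ne_zero _ one_pos
  have hV₁t : V₁ ≠ ∞ := volume_ball_ne_top _ _
  have hV₂t : V₂ ≠ ∞ := volume_ball_ne_top _ _
  have hV₄t : V₄ ≠ ∞ := volume_ball_ne_top _ _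
  have hS : 0 ≤ 2 - (u + v + w) := by linarith
  set C₀ : ℝ≥0∞ := V₁⁻¹ * (V₂ * ((A * 4 ^ n) ^ w * V₄ ^ (2 - (u + v + w)) * B)) with hC₀
  have hC₀t : C₀ ≠ ∞ := by
    have h1 : ((A : ℝ≥0∞) * 4 ^ n) ^ w ≠ ∞ := ENNReal.rpow_ne_top_of_nonneg hw0.le (by finiteness)
    have h2 : V₄ ^ (2 - (u + v + w)) ≠ ∞ := ENNReal.rpow_ne_top_of_nonneg hS hV₄t
    have h3 : V₁⁻¹ ≠ ∞ := ENNReal.inv_ne_top.2 hV₁0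
    rw [hC₀]; finiteness
  refine ⟨C₀.toNNReal, fun ρ f g hρ hf hg => ?_⟩
  rw [ENNReal.coe_toNNReal hC₀t]
  set R := ENNReal.ofReal ρ with hR
  have hR0 : R ≠ 0 := by simpa [hR] using hρ
  have hRt : R ≠ ∞ := ENNReal.ofReal_ne_top
  set k := (Metric.ball (0 : Rn n) ρ).indicator W with hk
  have hkm : Measurable k := hW.indicator measurableSet_ball
  have hv1 : volume (Metric.ball (0 : Rn n) ρ) = R ^ (n : ℝ) * V₁ := by
    simpa using volume_ball_mul_rpow (0 : Rn n) one_pos hρ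
  have hv2 : ∀ z : Rn n, volume (Metric.ball z (2 * ρ)) = R ^ (n : ℝ) * V₂ := fun z =>
    volume_ball_mul_rpow z two_pos hρ
  have hv4 : volume (Metric.ball (0 : Rn n) (4 * ρ)) = R ^ (n : ℝ) * V₄ :=
    volume_ball_mul_rpow _ four_pos hρ
  have hv24 : V₂ ≤ V₄ := measure_mono (Metric.ball_subset_ball (by norm_num))
  set M := R ^ (n : ℝ) * V₄ with hM
  set P : Rn n → ℝ≥0∞ := fun z => ∫⁻ y in Metric.ball z (2 * ρ), f y ^ (1 / u) with hP
  set Q : Rn n → ℝ≥0∞ := fun z => ∫⁻ y in Metric.ball z (2 * ρ), g y ^ (1 / v) with hQ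
  have hloc : ∀ z, ∫⁻ x in Metric.ball z (2 * ρ), ∫⁻ y in Metric.ball z (2 * ρ),
      pairing b k f g x y
      ≤ P z ^ u * Q z ^ v * ((A * (4 * R) ^ (n : ℝ)) ^ w * M ^ (2 - (u + v + w)) * B) := by
    intro z
    have hMz : volume (Metric.ball z (2 * ρ)) ≤ M := by
      rw [hv2, hM]; exact mul_le_mul' le_rfl hv24
    have h1 := hbil hf hg hkm (measurable_oscWeight hbm) (E₁ := Metric.ball z (2 * ρ))
      (E₂ := Metric.ball z (2 * ρ)) (E₃ := Metric.ball 0 (4 * ρ)) measurableSet_ball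
      measurableSet_ball measurableSet_ball (by
        intro x hx y hy
        rw [Metric.mem_ball] at hx hy
        rw [mem_ball_zero_iff, ← dist_eq_norm]
        linarith [dist_triangle_right x y z]) (M := M) (D := B) hMz hMz hv4.le (by
        have := hB z z z (2 * ρ) (2 * ρ) (2 * ρ) (2 * ρ) (by positivity) le_rfl le_rfl le_rfl le_rfl
          (by simpa using hρ.le) (by simpa using hρ.le)
        rw [div_self (by positivity), Real.log_one, add_zero, ENNReal.ofReal_one, mul_one] at this
        refine this.trans ?_
        rw [ENNReal.rpow_two, sq]
        gcongr)
    refine h1.trans ?_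
    have h2 : ∫⁻ z in Metric.ball 0 (4 * ρ), k z ^ (1 / w) ≤ A * (4 * R) ^ (n : ℝ) := by
      have h3 := hWA (4 * ρ) (by positivity)
      rw [ENNReal.ofReal_mul (by norm_num), ENNReal.ofReal_ofNat] at h3
      refine le_trans (lintegral_mono fun z => ?_) h3
      have hw' : 0 ≤ 1 / w := by positivity
      gcongr
      exact indicator_le_self _ _ _
    calc _ ≤ P z ^ u * Q z ^ v * (A * (4 * R) ^ (n : ℝ)) ^ w * M ^ (2 - (u + v + w)) * B := by
          gcongr
      _ = _ := by ring
  have hI : Measurable fun x => ∫⁻ y, pairing b k f g x y :=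
    (measurable_pairing hbm hkm hf hg).lintegral_prod_right'
  -- If x ∈ B(z,ρ) and |x-y| < ρ, then y ∈ B(z,2ρ).
  have havg : volume (Metric.ball (0 : Rn n) ρ) * ∫⁻ x, ∫⁻ y, pairing b k f g x y
      ≤ ∫⁻ z, ∫⁻ x in Metric.ball z (2 * ρ), ∫⁻ y in Metric.ball z (2 * ρ),
        pairing b k f g x y := by
    rw [← volume_ball_mul_lintegral hI]
    refine lintegral_mono fun z => ?_
    calc _ ≤ ∫⁻ x in Metric.ball z ρ, ∫⁻ y in Metric.ball z (2 * ρ), pairing b k f g x y := by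
          refine setLIntegral_mono' measurableSet_ball fun x hx => ?_
          rw [← lintegral_indicator measurableSet_ball]
          refine lintegral_mono fun y => ?_
          by_cases hy : y ∈ Metric.ball z (2 * ρ)
          · rw [indicator_of_mem hy]
          · have : k (x - y) = 0 := by
              rw [hk]
              refine indicator_of_notMem (fun hxy => hy ?_) _
              rw [mem_ball_zero_iff, ← dist_eq_norm] at hxy
              rw [Metric.mem_ball] at hx ⊢
              linarith [dist_triangle_left y z x, dist_comm x z]
            simp [pairing, this]
      _ ≤ _ := lintegral_mono_set (Metric.ball_subset_ball (by linarith))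
  -- P is bounded by the total mass of f^{1/u}, which absorbs the surplus u + v - 1.
  have hPQ : ∫⁻ z, P z ^ u * Q z ^ v
      ≤ R ^ (n : ℝ) * V₂ * ((∫⁻ y, f y ^ (1 / u)) ^ u * (∫⁻ x, g x ^ (1 / v)) ^ v) := by
    have h1 := lintegral_rpow_mul_rpow_le (μ := volume) (P := P) (Q := Q) (u := u) (v := v)
      (S := ∫⁻ y, f y ^ (1 / u)) (measurable_lintegral_ball _ (hf.pow_const _)).aemeasurable
      (measurable_lintegral_ball _ (hg.pow_const _)).aemeasurable hv0.le hv.le huv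
      (Eventually.of_forall fun z => setLIntegral_le_lintegral _ _)
    rw [hP, hQ, volume_ball_mul_lintegral (hf.pow_const _) 0,
      volume_ball_mul_lintegral (hg.pow_const _) 0, hv2] at h1
    refine h1.trans (le_of_eq ?_)
    rw [ENNReal.mul_rpow_of_nonneg _ _ (by linarith), ENNReal.mul_rpow_of_nonneg _ _ hv0.le]
    have e1 : ∀ a : ℝ≥0∞, a ^ u = a ^ (u + v - 1) * a ^ (1 - v) := fun a => by
      rw [← ENNReal.rpow_add_of_nonneg _ _ (by linarith) (by linarith)]; congr 1; ring
    have e2 : ∀ a : ℝ≥0∞, a = a ^ (1 - v) * a ^ v := fun a => by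
      rw [← ENNReal.rpow_add_of_nonneg _ _ (by linarith) hv0.le, sub_add_cancel, ENNReal.rpow_one]
    rw [e1 (∫⁻ y, f y ^ (1 / u))]
    conv_rhs => rw [e2 (R ^ (n : ℝ) * V₂)]
    ring
  have hfin : volume (Metric.ball (0 : Rn n) ρ) * ∫⁻ x, ∫⁻ y, pairing b k f g x y
      ≤ R ^ (n : ℝ) * V₂ * ((∫⁻ y, f y ^ (1 / u)) ^ u * (∫⁻ x, g x ^ (1 / v)) ^ v)
        * ((A * (4 * R) ^ (n : ℝ)) ^ w * M ^ (2 - (u + v + w)) * B) := by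
    refine havg.trans ((lintegral_mono hloc).trans ?_)
    have hPQm : Measurable fun z => P z ^ u * Q z ^ v :=
      ((measurable_lintegral_ball _ (hf.pow_const _)).pow_const _).mul ((measurable_lintegral_ball _ (hg.pow_const _)).pow_const _)
    rw [lintegral_mul_const _ hPQm]
    gcongr
  have hvol0 : volume (Metric.ball (0 : Rn n) ρ) ≠ 0 := volume_ball_ne_zero _ hρ
  rw [← ENNReal.mul_le_mul_iff_right hvol0 (volume_ball_ne_top _ _)]
  refine hfin.trans (le_of_eq ?_)
  rw [hv1, hC₀, hM]
  have e3 : ((A : ℝ≥0∞) * (4 * R) ^ (n : ℝ)) ^ w = (A * 4 ^ n) ^ w * R ^ (n * w) := by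
    rw [ENNReal.mul_rpow_of_nonneg _ _ (Nat.cast_nonneg n), ENNReal.rpow_natCast 4, ← mul_assoc,
      ENNReal.mul_rpow_of_nonneg _ _ hw0.le, ← ENNReal.rpow_mul]
  have e4 : (R ^ (n : ℝ) * V₄) ^ (2 - (u + v + w))
      = R ^ (n * (2 - (u + v + w))) * V₄ ^ (2 - (u + v + w)) := by
    rw [ENNReal.mul_rpow_of_nonneg _ _ hS, ← ENNReal.rpow_mul]
  have e5 : R ^ (n * (2 - u - v)) = R ^ (n * w) * R ^ (n * (2 - (u + v + w))) := by
    rw [← ENNReal.rpow_add _ _ hR0 hRt]; congr 1; ring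
  rw [e3, e4, e5]
  calc _ = 1 * (R ^ (n : ℝ) * V₂ * ((∫⁻ y, f y ^ (1 / u)) ^ u * (∫⁻ x, g x ^ (1 / v)) ^ v)
        * ((A * 4 ^ n) ^ w * R ^ (n * w) * (R ^ (n * (2 - (u + v + w)))
          * V₄ ^ (2 - (u + v + w))) * B)) := (one_mul _).symm
    _ = _ := by rw [← ENNReal.mul_inv_cancel hV₁0 hV₁t]; ring

end Scale

end VanishingMorrey

namespace VanishingMorrey

open MeasureTheory Filter Topology Set
open scoped ENNReal NNReal

/-! ### Integrals of powers across a threshold -/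

section PowerIntegrals

theorem lintegral_Ioi_rpow {γ d : ℝ} (hγ : 0 < γ) (hd : 0 < d) :
    ∫⁻ ρ in Ioi d, ENNReal.ofReal (ρ ^ (-γ - 1)) = ENNReal.ofReal (d ^ (-γ) / γ) := by
  rw [← ofReal_integral_eq_lintegral_ofReal (integrableOn_Ioi_rpow_of_lt (by linarith) hd),
    integral_Ioi_rpow_of_lt (by linarith) hd]
  · congr 1
    have e : -γ - 1 + 1 = -γ := by ring
    rw [e, neg_div_neg_eq]
  · refine (ae_restrict_iff' measurableSet_Ioi).2 (Eventually.of_forall fun ρ hρ => ?_)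
    exact Real.rpow_nonneg (hd.le.trans (le_of_lt hρ)) _

theorem lintegral_Ioc_rpow {γ a : ℝ} (hγ : 0 < γ) (ha : 0 < a) :
    ∫⁻ ρ in Ioc 0 a, ENNReal.ofReal (ρ ^ (γ - 1)) = ENNReal.ofReal (a ^ γ / γ) := by
  have hi : IntervalIntegrable (fun ρ : ℝ => ρ ^ (γ - 1)) volume 0 a :=
    intervalIntegral.intervalIntegrable_rpow' (by linarith)
  rw [← ofReal_integral_eq_lintegral_ofReal
    ((intervalIntegrable_iff_integrableOn_Ioc_of_le ha.le).1 hi),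
    ← intervalIntegral.integral_of_le ha.le, integral_rpow (Or.inl (by linarith))]
  · simp [Real.zero_rpow hγ.ne']
  · refine (ae_restrict_iff' measurableSet_Ioc).2 (Eventually.of_forall fun ρ hρ => ?_)
    exact Real.rpow_nonneg hρ.1.le _

variable {ν : ℝ} {T : ℝ≥0∞}

theorem rpow_mul_rpow_le_of_lt {R : ℝ≥0∞} {θ : ℝ} (hθ0 : 0 < θ) (hθ1 : θ < 1)
    (h : R ^ (-ν) < T) : R ^ (-(ν * θ)) * T ^ (1 - θ) ≤ T := by
  calc R ^ (-(ν * θ)) * T ^ (1 - θ) = (R ^ (-ν)) ^ θ * T ^ (1 - θ) := by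
        rw [← ENNReal.rpow_mul]; congr 2; ring
    _ ≤ T ^ θ * T ^ (1 - θ) := by gcongr
    _ = T := by
        rw [← ENNReal.rpow_add_of_nonneg _ _ hθ0.le (by linarith), add_sub_cancel,
          ENNReal.rpow_one]

theorem rpow_mul_rpow_le_of_le {R : ℝ≥0∞} (hR0 : R ≠ 0) (hRt : R ≠ ∞) {η : ℝ} (hη : 0 < η)
    (h : T ≤ R ^ (-ν)) : R ^ (ν * η) * T ^ (1 + η) ≤ T := by
  calc R ^ (ν * η) * T ^ (1 + η) = R ^ (ν * η) * T ^ η * T := by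
        rw [ENNReal.rpow_add_of_nonneg _ _ zero_le_one hη.le, ENNReal.rpow_one]; ring
    _ ≤ R ^ (ν * η) * (R ^ (-ν)) ^ η * T := by gcongr
    _ = T := by
        rw [← ENNReal.rpow_mul, ← ENNReal.rpow_add _ _ hR0 hRt]
        simp

/-- The condition says ρ > a with a = T^{-1/ν}; on that side the power of ρ decays, so its integral
is governed by the endpoint a, where the homogeneity restores exactly T. The complementary range has
a growing power and is treated in `lintegral_level_le_le`. -/
theorem lintegral_level_lt_le (hν : 0 < ν) {θ : ℝ} (hθ0 : 0 < θ) :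
    ∫⁻ ρ in Ioi (0 : ℝ), {ρ | ENNReal.ofReal ρ ^ (-ν) < T}.indicator (fun ρ =>
      ENNReal.ofReal ρ⁻¹ * (ENNReal.ofReal ρ ^ (-(ν * θ)) * T ^ (1 - θ))) ρ
      ≤ ENNReal.ofReal (1 / (ν * θ)) * T := by
  rcases eq_or_ne T 0 with rfl | hT0
  · simp
  rcases eq_or_ne T ∞ with rfl | hTt
  · rw [ENNReal.mul_top]
    · exact le_top
    · simp; positivity
  obtain ⟨t, rfl⟩ : ∃ t : ℝ, T = ENNReal.ofReal t := ⟨T.toReal, (ENNReal.ofReal_toReal hTt).symm⟩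
  have ht : 0 < t := by simpa using hT0
  set a := t ^ (-1 / ν) with ha
  have ha0 : 0 < a := by positivity
  have haν : a ^ (-ν) = t := by
    rw [ha, ← Real.rpow_mul ht.le]
    have : -1 / ν * -ν = 1 := by field_simp
    rw [this, Real.rpow_one]
  set G : ℝ → ℝ≥0∞ := fun ρ => ENNReal.ofReal (ρ ^ (-(ν * θ) - 1)) * ENNReal.ofReal t ^ (1 - θ)
    with hG
  have hle : ∀ ρ ∈ Ioi (0 : ℝ), {ρ | ENNReal.ofReal ρ ^ (-ν) < ENNReal.ofReal t}.indicator
      (fun ρ => ENNReal.ofReal ρ⁻¹ * (ENNReal.ofReal ρ ^ (-(ν * θ))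
        * ENNReal.ofReal t ^ (1 - θ))) ρ ≤ (Ioi a).indicator G ρ := by
    intro ρ hρ
    rw [mem_Ioi] at hρ
    by_cases h : ENNReal.ofReal ρ ^ (-ν) < ENNReal.ofReal t
    · rw [indicator_of_mem (by exact h)]
      rw [ENNReal.ofReal_rpow_of_pos hρ, ENNReal.ofReal_lt_ofReal_iff ht] at h
      have haρ : a < ρ := by
        by_contra hcon
        have := Real.rpow_le_rpow_of_nonpos hρ (not_lt.1 hcon) (by linarith : -ν ≤ 0)
        linarith
      rw [indicator_of_mem (by exact haρ), hG]
      simp only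
      rw [← mul_assoc, ENNReal.ofReal_rpow_of_pos hρ, ← ENNReal.ofReal_mul (by positivity),
        ← Real.rpow_neg_one ρ, ← Real.rpow_add hρ, add_comm, ← sub_eq_add_neg]
    · rw [indicator_of_notMem (by exact h)]; exact zero_le
  calc _ ≤ ∫⁻ ρ in Ioi (0 : ℝ), (Ioi a).indicator G ρ := setLIntegral_mono' measurableSet_Ioi hle
    _ ≤ ∫⁻ ρ, (Ioi a).indicator G ρ := setLIntegral_le_lintegral _ _
    _ = (∫⁻ ρ in Ioi a, ENNReal.ofReal (ρ ^ (-(ν * θ) - 1))) * ENNReal.ofReal t ^ (1 - θ) := by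
        rw [lintegral_indicator measurableSet_Ioi, hG, lintegral_mul_const _ (by fun_prop)]
    _ = ENNReal.ofReal (1 / (ν * θ)) * (ENNReal.ofReal t ^ θ * ENNReal.ofReal t ^ (1 - θ)) := by
        rw [lintegral_Ioi_rpow (by positivity) ha0, ← neg_mul, Real.rpow_mul ha0.le, haν,
          ENNReal.ofReal_rpow_of_pos (p := θ) ht, ← mul_assoc, ← ENNReal.ofReal_mul (by positivity)]
        congr 2
        ring
    _ = _ := by
        rw [← ENNReal.rpow_add _ _ (by simpa using ht) ENNReal.ofReal_ne_top, add_sub_cancel,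
          ENNReal.rpow_one]

theorem lintegral_level_le_le (hν : 0 < ν) {η : ℝ} (hη : 0 < η) :
    ∫⁻ ρ in Ioi (0 : ℝ), {ρ | T ≤ ENNReal.ofReal ρ ^ (-ν)}.indicator (fun ρ =>
      ENNReal.ofReal ρ⁻¹ * (ENNReal.ofReal ρ ^ (ν * η) * T ^ (1 + η))) ρ
      ≤ ENNReal.ofReal (1 / (ν * η)) * T := by
  rcases eq_or_ne T 0 with rfl | hT0
  · simp [ENNReal.zero_rpow_of_pos (show 0 < 1 + η by linarith)]
  rcases eq_or_ne T ∞ with rfl | hTt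
  · rw [ENNReal.mul_top]
    · exact le_top
    · simp; positivity
  obtain ⟨t, rfl⟩ : ∃ t : ℝ, T = ENNReal.ofReal t := ⟨T.toReal, (ENNReal.ofReal_toReal hTt).symm⟩
  have ht : 0 < t := by simpa using hT0
  set a := t ^ (-1 / ν) with ha
  have ha0 : 0 < a := by positivity
  have haν : a ^ (-ν) = t := by
    rw [ha, ← Real.rpow_mul ht.le]
    have : -1 / ν * -ν = 1 := by field_simp
    rw [this, Real.rpow_one]
  set G : ℝ → ℝ≥0∞ := fun ρ => ENNReal.ofReal (ρ ^ (ν * η - 1)) * ENNReal.ofReal t ^ (1 + η)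
    with hG
  have hle : ∀ ρ ∈ Ioi (0 : ℝ), {ρ | ENNReal.ofReal t ≤ ENNReal.ofReal ρ ^ (-ν)}.indicator
      (fun ρ => ENNReal.ofReal ρ⁻¹ * (ENNReal.ofReal ρ ^ (ν * η)
        * ENNReal.ofReal t ^ (1 + η))) ρ ≤ (Ioc 0 a).indicator G ρ := by
    intro ρ hρ
    rw [mem_Ioi] at hρ
    by_cases h : ENNReal.ofReal t ≤ ENNReal.ofReal ρ ^ (-ν)
    · rw [indicator_of_mem (by exact h)]
      rw [ENNReal.ofReal_rpow_of_pos hρ, ENNReal.ofReal_le_ofReal_iff (by positivity)] at h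
      have haρ : ρ ≤ a := by
        by_contra hcon
        have := Real.rpow_lt_rpow_of_neg ha0 (not_le.1 hcon) (by linarith : -ν < 0)
        linarith
      rw [indicator_of_mem (by exact ⟨hρ, haρ⟩), hG]
      simp only
      rw [← mul_assoc, ENNReal.ofReal_rpow_of_pos hρ, ← ENNReal.ofReal_mul (by positivity),
        ← Real.rpow_neg_one ρ, ← Real.rpow_add hρ, add_comm, ← sub_eq_add_neg]
    · rw [indicator_of_notMem (by exact h)]; exact zero_le
  calc _ ≤ ∫⁻ ρ in Ioi (0 : ℝ), (Ioc 0 a).indicator G ρ := setLIntegral_mono' measurableSet_Ioi hle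
    _ ≤ ∫⁻ ρ, (Ioc 0 a).indicator G ρ := setLIntegral_le_lintegral _ _
    _ = (∫⁻ ρ in Ioc 0 a, ENNReal.ofReal (ρ ^ (ν * η - 1))) * ENNReal.ofReal t ^ (1 + η) := by
        rw [lintegral_indicator measurableSet_Ioc, hG, lintegral_mul_const _ (by fun_prop)]
    _ = ENNReal.ofReal (1 / (ν * η)) * (ENNReal.ofReal t ^ (-η) * ENNReal.ofReal t ^ (1 + η)) := by
        have : a ^ (ν * η) = t ^ (-η) := by
          rw [show ν * η = -ν * -η by ring, Real.rpow_mul ha0.le, haν]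
        rw [lintegral_Ioc_rpow (by positivity) ha0, this,
          ENNReal.ofReal_rpow_of_pos (p := -η) ht, ← mul_assoc, ← ENNReal.ofReal_mul (by positivity)]
        congr 2
        ring
    _ = _ := by
        rw [← ENNReal.rpow_add _ _ (by simpa using ht) ENNReal.ofReal_ne_top]
        simp

end PowerIntegrals

/-! ### Decomposition by height and scale -/

section Levels

variable {n : ℕ}

/-- A family `h ρ` of functions whose `L^{1/u}` norms, rescaled by `ρ^{-ne}`, are bounded by one
and have bounded `L^{1/u}` norm with respect to `dρ/ρ`. -/
structure IsScaleBounded (u e : ℝ) (C : ℝ≥0∞) (h : ℝ → Rn n → ℝ≥0∞) : Prop where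
  measurable : Measurable (Function.uncurry h)
  le_one : ∀ ρ : ℝ, 0 < ρ →
    ENNReal.ofReal ρ ^ (-(n * (e / u))) * ∫⁻ y, h ρ y ^ (1 / u) ≤ 1
  lintegral_le : ∫⁻ ρ in Ioi (0 : ℝ), ENNReal.ofReal ρ⁻¹ *
    (ENNReal.ofReal ρ ^ (-(n * (e / u))) * ∫⁻ y, h ρ y ^ (1 / u)) ≤ C

/-- The relation `hp` rewrites f^{1/u} as a power of f^p. By Tonelli, both bounds then reduce to
inequalities at a fixed y, with T = f(y)^p. -/
theorem isScaleBounded_indicator {f : Rn n → ℝ≥0∞} (hf : Measurable f) {p u e : ℝ} (hu : 0 < u)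
    (hp : 1 / u = p * (1 - e / u)) (hfp : ∫⁻ y, f y ^ p ≤ 1) {C : ℝ≥0∞} {S : Set (ℝ × Rn n)}
    (hS : MeasurableSet S)
    (h₁ : ∀ ρ : ℝ, 0 < ρ → ∀ y, (ρ, y) ∈ S →
      ENNReal.ofReal ρ ^ (-(n * (e / u))) * (f y ^ p) ^ (1 - e / u) ≤ f y ^ p)
    (h₂ : ∀ y, ∫⁻ ρ in Ioi (0 : ℝ), {ρ | (ρ, y) ∈ S}.indicator (fun ρ => ENNReal.ofReal ρ⁻¹ *
      (ENNReal.ofReal ρ ^ (-(n * (e / u))) * (f y ^ p) ^ (1 - e / u))) ρ ≤ C * f y ^ p) :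
    IsScaleBounded u e C (fun ρ y => S.indicator (fun q => f q.2) (ρ, y)) := by
  have hu' : 0 < 1 / u := by positivity
  have hpow : ∀ ρ y, S.indicator (fun q => f q.2) (ρ, y) ^ (1 / u)
      = S.indicator (fun q => (f q.2 ^ p) ^ (1 - e / u)) (ρ, y) := by
    intro ρ y
    by_cases h : (ρ, y) ∈ S
    · rw [indicator_of_mem h, indicator_of_mem h, ← ENNReal.rpow_mul, ← hp]
    · rw [indicator_of_notMem h, indicator_of_notMem h, ENNReal.zero_rpow_of_pos hu']
  have hm : Measurable fun q : ℝ × Rn n => S.indicator (fun q => (f q.2 ^ p) ^ (1 - e / u)) q :=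
    (((hf.comp measurable_snd).pow_const _).pow_const _).indicator hS
  have hmρ : ∀ ρ, Measurable fun y => S.indicator (fun q => (f q.2 ^ p) ^ (1 - e / u)) (ρ, y) :=
    fun ρ => hm.comp measurable_prodMk_left
  refine ⟨(hf.comp measurable_snd).indicator hS, fun ρ hρ => ?_, ?_⟩
  · simp_rw [hpow]
    rw [← lintegral_const_mul _ (hmρ ρ)]
    refine le_trans (lintegral_mono fun y => ?_) hfp
    by_cases h : (ρ, y) ∈ S
    · rw [indicator_of_mem h]; exact h₁ ρ hρ y h
    · rw [indicator_of_notMem h, mul_zero]; exact zero_le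
  · simp_rw [hpow]
    have e1 : ∀ ρ : ℝ, ENNReal.ofReal ρ⁻¹ * (ENNReal.ofReal ρ ^ (-(n * (e / u)))
        * ∫⁻ y, S.indicator (fun q => (f q.2 ^ p) ^ (1 - e / u)) (ρ, y))
        = ∫⁻ y, {ρ | (ρ, y) ∈ S}.indicator (fun ρ => ENNReal.ofReal ρ⁻¹ *
      (ENNReal.ofReal ρ ^ (-(n * (e / u))) * (f y ^ p) ^ (1 - e / u))) ρ := by
      intro ρ
      rw [← mul_assoc, ← lintegral_const_mul _ (hmρ ρ)]
      refine lintegral_congr fun y => ?_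
      by_cases h : (ρ, y) ∈ S
      · rw [indicator_of_mem h, indicator_of_mem (by exact h), mul_assoc]
      · rw [indicator_of_notMem h, indicator_of_notMem (by exact h), mul_zero]
    simp_rw [e1]
    rw [lintegral_lintegral_swap]
    · refine (lintegral_mono h₂).trans ?_
      rw [lintegral_const_mul _ (hf.pow_const _)]
      exact mul_le_of_le_one_right' hfp
    · have : Measurable (S.indicator fun q : ℝ × Rn n => ENNReal.ofReal q.1⁻¹ *
          (ENNReal.ofReal q.1 ^ (-(n * (e / u))) * (f q.2 ^ p) ^ (1 - e / u))) :=
        Measurable.indicator (by fun_prop) hS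
      exact this.aemeasurable

/-- The set where `f(y)^p` exceeds `ρ^{-n}`. -/
def levelSet (f : Rn n → ℝ≥0∞) (p : ℝ) : Set (ℝ × Rn n) :=
  {q | ENNReal.ofReal q.1 ^ (-(n : ℝ)) < f q.2 ^ p}

theorem measurableSet_levelSet {f : Rn n → ℝ≥0∞} (hf : Measurable f) (p : ℝ) :
    MeasurableSet (levelSet f p) :=
  measurableSet_lt (by fun_prop) (by fun_prop)

/-- The high part of f is measured in a Lebesgue exponent below p, here 1/(1/p + e). The low part,
in `isScaleBounded_compl_levelSet`, is measured in one above p, whence the sign change of e. -/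
theorem isScaleBounded_levelSet {f : Rn n → ℝ≥0∞} (hf : Measurable f) {p e : ℝ} (hn : 0 < n)
    (hp : 1 < p) (he : 0 < e) (hfp : ∫⁻ y, f y ^ p ≤ 1) :
    IsScaleBounded (1 / p + e) e (ENNReal.ofReal (1 / (n * (e / (1 / p + e)))))
      (fun ρ y => (levelSet f p).indicator (fun q => f q.2) (ρ, y)) := by
  have hp0 : 0 < p := by linarith
  have hu : 0 < 1 / p + e := by positivity
  have hn' : (0 : ℝ) < n := by exact_mod_cast hn
  refine isScaleBounded_indicator hf hu (by field_simp; ring) hfp (measurableSet_levelSet hf p) ?_ ?_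
  · intro ρ hρ y hy
    refine rpow_mul_rpow_le_of_lt (by positivity) ?_ hy
    rw [div_lt_one hu]
    linarith [show 0 < 1 / p by positivity]
  · intro y
    exact lintegral_level_lt_le hn' (by positivity)

theorem isScaleBounded_compl_levelSet {f : Rn n → ℝ≥0∞} (hf : Measurable f) {p e : ℝ} (hn : 0 < n)
    (hp : 1 < p) (he : 0 < e) (hep : e < 1 / p) (hfp : ∫⁻ y, f y ^ p ≤ 1) :
    IsScaleBounded (1 / p + -e) (-e) (ENNReal.ofReal (1 / (n * (e / (1 / p + -e)))))
      (fun ρ y => (levelSet f p)ᶜ.indicator (fun q => f q.2) (ρ, y)) := by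
  have hp0 : 0 < p := by linarith
  have hu : 0 < 1 / p + -e := by linarith
  have hn' : (0 : ℝ) < n := by exact_mod_cast hn
  have e1 : -(n * (-e / (1 / p + -e))) = n * (e / (1 / p + -e)) := by ring
  have e2 : 1 - -e / (1 / p + -e) = 1 + e / (1 / p + -e) := by ring
  refine isScaleBounded_indicator hf hu ?_ hfp
    (measurableSet_levelSet hf p).compl ?_ ?_
  · rw [e2]
    have : p * (1 / p) = 1 := by field_simp
    rw [eq_comm, eq_div_iff hu.ne', mul_assoc, add_mul, div_mul_cancel₀ _ hu.ne']
    linarith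
  · intro ρ hρ y hy
    rw [e1, e2]
    exact rpow_mul_rpow_le_of_le (by simpa using hρ) ENNReal.ofReal_ne_top (by positivity)
      (not_lt.1 hy)
  · intro y
    rw [e1, e2]
    have e3 : {ρ | (ρ, y) ∈ (levelSet f p)ᶜ} = {ρ | f y ^ p ≤ ENNReal.ofReal ρ ^ (-(n : ℝ))} := by
      ext ρ
      exact not_lt (a := ENNReal.ofReal ρ ^ (-(n : ℝ))) (b := f y ^ p)
    rw [e3]
    exact lintegral_level_le_le hn' (by positivity)

/-- The choice of γ makes all powers of ρ cancel once the norms are rescaled, leaving ∫ P^u Q^v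
dρ/ρ. Since P ≤ 1 and u + v ≥ 1, Hölder's inequality needs only the integrals of P and Q. -/
theorem lintegral_scale_le {u v e₁ e₂ γ : ℝ} (hu0 : 0 < u) (hv0 : 0 < v)
    (hv : v < 1) (huv : 1 ≤ u + v) (hγ : γ = n * (2 - (u - e₁) - (v - e₂)))
    {Φ : ℝ → ℝ≥0∞} {C C₁ C₂ : ℝ≥0∞} {h₁ h₂ : ℝ → Rn n → ℝ≥0∞} (H₁ : IsScaleBounded u e₁ C₁ h₁)
    (H₂ : IsScaleBounded v e₂ C₂ h₂)
    (hΦ : ∀ ρ : ℝ, 0 < ρ → Φ ρ ≤ C * ENNReal.ofReal ρ ^ (n * (2 - u - v))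
      * ((∫⁻ y, h₁ ρ y ^ (1 / u)) ^ u * (∫⁻ x, h₂ ρ x ^ (1 / v)) ^ v)) :
    ∫⁻ ρ in Ioi (0 : ℝ), ENNReal.ofReal (ρ ^ (-γ - 1)) * Φ ρ ≤ C * (C₁ ^ (1 - v) * C₂ ^ v) := by
  set P : ℝ → ℝ≥0∞ := fun ρ => ENNReal.ofReal ρ ^ (-(n * (e₁ / u))) * ∫⁻ y, h₁ ρ y ^ (1 / u)
    with hP
  set Q : ℝ → ℝ≥0∞ := fun ρ => ENNReal.ofReal ρ ^ (-(n * (e₂ / v))) * ∫⁻ y, h₂ ρ y ^ (1 / v)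
    with hQ
  have hPm : Measurable P :=
    (by fun_prop : Measurable fun ρ : ℝ => ENNReal.ofReal ρ ^ (-(n * (e₁ / u)))).mul
      (H₁.measurable.pow_const _).lintegral_prod_right'
  have hQm : Measurable Q :=
    (by fun_prop : Measurable fun ρ : ℝ => ENNReal.ofReal ρ ^ (-(n * (e₂ / v)))).mul
      (H₂.measurable.pow_const _).lintegral_prod_right'
  have hinv : Measurable fun ρ : ℝ => ENNReal.ofReal ρ⁻¹ := by fun_prop
  set μ := (volume.restrict (Ioi (0 : ℝ))).withDensity fun ρ => ENNReal.ofReal ρ⁻¹ with hμ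
  have hμi : ∀ {g : ℝ → ℝ≥0∞}, Measurable g →
      ∫⁻ ρ, g ρ ∂μ = ∫⁻ ρ in Ioi (0 : ℝ), ENNReal.ofReal ρ⁻¹ * g ρ := fun hg =>
    lintegral_withDensity_eq_lintegral_mul _ hinv hg
  have hle : ∀ᵐ ρ ∂μ, P ρ ≤ 1 := by
    refine (withDensity_absolutelyContinuous _ _).ae_le ?_
    exact (ae_restrict_iff' measurableSet_Ioi).2 (Eventually.of_forall fun ρ hρ => H₁.le_one ρ hρ)
  have key := lintegral_rpow_mul_rpow_le (u := u) hPm.aemeasurable hQm.aemeasurable hv0.le hv.le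
    huv hle
  have hPQm : Measurable fun ρ => P ρ ^ u * Q ρ ^ v := (hPm.pow_const _).mul (hQm.pow_const _)
  rw [hμi hPm, hμi hQm, hμi hPQm, ENNReal.one_rpow,
    one_mul] at key
  have hpt : ∀ ρ ∈ Ioi (0 : ℝ), ENNReal.ofReal (ρ ^ (-γ - 1)) * Φ ρ
      ≤ C * (ENNReal.ofReal ρ⁻¹ * (P ρ ^ u * Q ρ ^ v)) := by
    intro ρ hρ
    rw [mem_Ioi] at hρ
    refine (mul_le_mul' le_rfl (hΦ ρ hρ)).trans (le_of_eq ?_)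
    have hR0 : ENNReal.ofReal ρ ≠ 0 := by simpa using hρ
    have hRt := ENNReal.ofReal_ne_top (r := ρ)
    rw [hP, hQ]
    simp only
    rw [ENNReal.mul_rpow_of_nonneg _ _ hu0.le, ENNReal.mul_rpow_of_nonneg _ _ hv0.le,
      ← ENNReal.rpow_mul, ← ENNReal.rpow_mul]
    have e1 : ENNReal.ofReal (ρ ^ (-γ - 1)) = ENNReal.ofReal ρ⁻¹ * ENNReal.ofReal ρ ^ (-γ) := by
      rw [ENNReal.ofReal_rpow_of_pos hρ, ← ENNReal.ofReal_mul (by positivity),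
        ← Real.rpow_neg_one ρ, ← Real.rpow_add hρ]
      congr 2; ring
    have e2 : ENNReal.ofReal ρ ^ (-γ) * ENNReal.ofReal ρ ^ (n * (2 - u - v))
        = ENNReal.ofReal ρ ^ (-(n * (e₁ / u)) * u) * ENNReal.ofReal ρ ^ (-(n * (e₂ / v)) * v) := by
      rw [← ENNReal.rpow_add _ _ hR0 hRt, ← ENNReal.rpow_add _ _ hR0 hRt]
      congr 1
      rw [hγ]; field_simp; ring
    rw [e1]
    calc _ = C * (ENNReal.ofReal ρ⁻¹ * ((ENNReal.ofReal ρ ^ (-γ)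
          * ENNReal.ofReal ρ ^ (n * (2 - u - v)))
          * ((∫⁻ y, h₁ ρ y ^ (1 / u)) ^ u * (∫⁻ x, h₂ ρ x ^ (1 / v)) ^ v))) := by ring
      _ = _ := by rw [e2]; ring
  refine (setLIntegral_mono' measurableSet_Ioi hpt).trans ?_
  rw [lintegral_const_mul _ (show Measurable fun ρ => ENNReal.ofReal ρ⁻¹ * (P ρ ^ u * Q ρ ^ v) from
    hinv.mul hPQm)]
  gcongr
  refine key.trans ?_
  have hv' : 0 ≤ 1 - v := by linarith
  gcongr
  · exact H₁.lintegral_le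
  · exact H₂.lintegral_le

end Levels

/-! ### The global bilinear estimate by real interpolation -/

section Global

variable {n : ℕ} {𝕜 : Type*} [RCLike 𝕜] {b : Rn n → 𝕜}

/-- The bilinear form of the kernel truncated to the ball of radius `ρ`. -/
noncomputable def truncForm (b : Rn n → 𝕜) (W : Rn n → ℝ≥0∞) (ρ : ℝ) (f g : Rn n → ℝ≥0∞) : ℝ≥0∞ :=
  ∫⁻ x, ∫⁻ y, pairing b ((Metric.ball 0 ρ).indicator W) f g x y

theorem truncForm_add_left (hbm : StronglyMeasurable b) {W f₁ f₂ g : Rn n → ℝ≥0∞}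
    (hW : Measurable W) (hf₁ : Measurable f₁) (hg : Measurable g) (ρ : ℝ) :
    truncForm b W ρ (fun y => f₁ y + f₂ y) g = truncForm b W ρ f₁ g + truncForm b W ρ f₂ g := by
  have hm := measurable_pairing hbm (hW.indicator (measurableSet_ball (x := 0) (ε := ρ))) hf₁ hg
  have hmx : Measurable fun x => ∫⁻ y, pairing b ((Metric.ball 0 ρ).indicator W) f₁ g x y :=
    hm.lintegral_prod_right'
  have hmy : ∀ x, Measurable fun y => pairing b ((Metric.ball 0 ρ).indicator W) f₁ g x y :=
    fun x => hm.comp measurable_prodMk_left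
  rw [truncForm, truncForm, truncForm, ← lintegral_add_left hmx]
  refine lintegral_congr fun x => ?_
  rw [← lintegral_add_left (hmy x)]
  refine lintegral_congr fun y => ?_
  simp only [pairing]
  ring

theorem truncForm_add_right (hbm : StronglyMeasurable b) {W f g₁ g₂ : Rn n → ℝ≥0∞}
    (hW : Measurable W) (hf : Measurable f) (hg₁ : Measurable g₁) (ρ : ℝ) :
    truncForm b W ρ f (fun y => g₁ y + g₂ y) = truncForm b W ρ f g₁ + truncForm b W ρ f g₂ := by
  have hm := measurable_pairing hbm (hW.indicator (measurableSet_ball (x := 0) (ε := ρ))) hf hg₁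
  have hmx : Measurable fun x => ∫⁻ y, pairing b ((Metric.ball 0 ρ).indicator W) f g₁ x y :=
    hm.lintegral_prod_right'
  have hmy : ∀ x, Measurable fun y => pairing b ((Metric.ball 0 ρ).indicator W) f g₁ x y :=
    fun x => hm.comp measurable_prodMk_left
  rw [truncForm, truncForm, truncForm, ← lintegral_add_left hmx]
  refine lintegral_congr fun x => ?_
  rw [← lintegral_add_left (hmy x)]
  refine lintegral_congr fun y => ?_
  simp only [pairing]
  ring

theorem truncForm_smul (hbm : StronglyMeasurable b) {W f g : Rn n → ℝ≥0∞}
    (hW : Measurable W) (hf : Measurable f) (hg : Measurable g) (c d : ℝ≥0∞) (ρ : ℝ) :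
    truncForm b W ρ (fun y => c * f y) (fun x => d * g x) = c * d * truncForm b W ρ f g := by
  have hm := measurable_pairing hbm (hW.indicator (measurableSet_ball (x := 0) (ε := ρ))) hf hg
  have hmx : Measurable fun x => ∫⁻ y, pairing b ((Metric.ball 0 ρ).indicator W) f g x y :=
    hm.lintegral_prod_right'
  have hmy : ∀ x, Measurable fun y => pairing b ((Metric.ball 0 ρ).indicator W) f g x y :=
    fun x => hm.comp measurable_prodMk_left
  rw [truncForm, truncForm, ← lintegral_const_mul _ hmx]
  refine lintegral_congr fun x => ?_
  rw [← lintegral_const_mul _ (hmy x)]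
  refine lintegral_congr fun y => ?_
  simp only [pairing]
  ring

theorem measurable_truncPairing (hbm : StronglyMeasurable b) {W : Rn n → ℝ≥0∞}
    (hW : Measurable W) {h₁ h₂ : ℝ → Rn n → ℝ≥0∞} (H₁ : Measurable (Function.uncurry h₁))
    (H₂ : Measurable (Function.uncurry h₂)) :
    Measurable fun q : (ℝ × Rn n) × Rn n =>
      pairing b ((Metric.ball 0 q.1.1).indicator W) (h₁ q.1.1) (h₂ q.1.1) q.1.2 q.2 := by
  have hk : Measurable fun q : (ℝ × Rn n) × Rn n =>
      (Metric.ball 0 q.1.1).indicator W (q.1.2 - q.2) := by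
    have : ∀ q : (ℝ × Rn n) × Rn n, (Metric.ball 0 q.1.1).indicator W (q.1.2 - q.2)
        = {q : (ℝ × Rn n) × Rn n | ‖q.1.2 - q.2‖ < q.1.1}.indicator
          (fun q => W (q.1.2 - q.2)) q := by
      intro q
      simp only [indicator, mem_ball_zero_iff, mem_ofPred_eq]
    simp_rw [this]
    exact Measurable.indicator (hW.comp (by fun_prop)) (measurableSet_lt (by fun_prop) (by fun_prop))
  exact (((H₁.comp ((measurable_fst.comp measurable_fst).prodMk measurable_snd)).mul
    (H₂.comp measurable_fst)).mul hk).mul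
      ((measurable_oscWeight hbm).comp ((measurable_snd.comp measurable_fst).prodMk measurable_snd))

theorem measurable_truncForm (hbm : StronglyMeasurable b) {W : Rn n → ℝ≥0∞}
    (hW : Measurable W) {h₁ h₂ : ℝ → Rn n → ℝ≥0∞} (H₁ : Measurable (Function.uncurry h₁))
    (H₂ : Measurable (Function.uncurry h₂)) :
    Measurable fun ρ => truncForm b W ρ (h₁ ρ) (h₂ ρ) :=
  ((measurable_truncPairing hbm hW H₁ H₂).lintegral_prod_right').lintegral_prod_right'

/-- Real interpolation done by hand. At scale ρ, f and g are split where f^p and g^r cross ρ^{-n}.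
Each of the four products is estimated with exponents 1/p ± ε and 1/r ± ε, the sign being the one
for which the resulting integral in ρ converges. -/
theorem exists_lintegral_truncForm_le_of_le_one (hbm : StronglyMeasurable b)
    (hb : LocallyIntegrable b) {N : ℝ≥0} (hN : OscillationLE b N) (hn : 0 < n) {W : Rn n → ℝ≥0∞}
    (hW : Measurable W) {p r w γ : ℝ} {A : ℝ≥0} (hWA : GrowthLE W (1 / w) A)
    (hp : 1 < p) (hr : 1 < r) (hw0 : 0 < w) (hw : w < 1) (hpr : 1 < 1 / p + 1 / r)
    (hprw : 1 / p + 1 / r + w < 2) (hγ : γ = n * (2 - 1 / p - 1 / r)) :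
    ∃ C : ℝ≥0, ∀ f g : Rn n → ℝ≥0∞, Measurable f → Measurable g →
      ∫⁻ y, f y ^ p ≤ 1 → ∫⁻ y, g y ^ r ≤ 1 →
      ∫⁻ ρ in Ioi (0 : ℝ), ENNReal.ofReal (ρ ^ (-γ - 1)) * truncForm b W ρ f g ≤ C := by
  have hp0 : 0 < 1 / p := by positivity
  have hr0 : 0 < 1 / r := by positivity
  have hp1 : 1 / p < 1 := by rw [div_lt_one (by linarith)]; exact hp
  have hr1 : 1 / r < 1 := by rw [div_lt_one (by linarith)]; exact hr
  -- The bounds on ε keep all four perturbed pairs in the single-scale range: both exponents in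
  -- (0,1), their sum at least 1, and their sum with w below 2.
  obtain ⟨ε, hε0, hε⟩ : ∃ ε : ℝ, 0 < ε ∧ ε < min (min (min (1 / p) (1 / r))
      (min (1 - 1 / p) (1 - 1 / r)))
      (min ((1 / p + 1 / r - 1) / 2) ((2 - (1 / p + 1 / r + w)) / 2)) := by
    refine exists_between ?_
    simp only [lt_min_iff]
    refine ⟨⟨⟨?_, ?_⟩, ?_, ?_⟩, ?_, ?_⟩ <;> linarith
  simp only [lt_min_iff] at hε
  obtain ⟨⟨⟨hε1, hε2⟩, hε3, hε4⟩, hε5, hε6⟩ := hε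
  have hsc : ∀ e₁ e₂ : ℝ, |e₁| = ε → |e₂| = ε → ∀ C₁ C₂ : ℝ, ∃ C : ℝ≥0,
      ∀ h₁ h₂ : ℝ → Rn n → ℝ≥0∞, IsScaleBounded (1 / p + e₁) e₁ (ENNReal.ofReal C₁) h₁ →
        IsScaleBounded (1 / r + e₂) e₂ (ENNReal.ofReal C₂) h₂ →
        ∫⁻ ρ in Ioi (0 : ℝ), ENNReal.ofReal (ρ ^ (-γ - 1)) * truncForm b W ρ (h₁ ρ) (h₂ ρ) ≤ C := by
    intro e₁ e₂ he₁ he₂ C₁ C₂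
    have h1 := abs_le.1 he₁.le
    have h2 := abs_le.1 he₂.le
    obtain ⟨C, hC⟩ := exists_lintegral_pairing_le hbm hb hN hW (u := 1 / p + e₁) (v := 1 / r + e₂)
      hWA (by linarith) (by linarith) hw0 (by linarith) (by linarith) hw (by linarith) (by linarith)
    have ht : (C : ℝ≥0∞) * (ENNReal.ofReal C₁ ^ (1 - (1 / r + e₂))
        * ENNReal.ofReal C₂ ^ (1 / r + e₂)) ≠ ∞ := by
      have h3 := ENNReal.rpow_ne_top_of_nonneg (show 0 ≤ 1 - (1 / r + e₂) by linarith)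
        (ENNReal.ofReal_ne_top (r := C₁))
      have h4 := ENNReal.rpow_ne_top_of_nonneg (show 0 ≤ 1 / r + e₂ by linarith)
        (ENNReal.ofReal_ne_top (r := C₂))
      finiteness
    refine ⟨_, fun h₁ h₂ H₁ H₂ => le_trans ?_ (ENNReal.coe_toNNReal ht).ge⟩
    refine lintegral_scale_le (by linarith) (by linarith) (by linarith) (by linarith)
      (by rw [hγ]; ring) H₁ H₂ (fun ρ hρ => ?_)
    exact hC ρ (h₁ ρ) (h₂ ρ) hρ (H₁.measurable.comp measurable_prodMk_left)
      (H₂.measurable.comp measurable_prodMk_left)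
  have hε' : |ε| = ε := abs_of_pos hε0
  have hε'' : |-ε| = ε := by rw [abs_neg, hε']
  obtain ⟨C₁, hC₁⟩ := hsc ε ε hε' hε' (1 / (n * (ε / (1 / p + ε)))) (1 / (n * (ε / (1 / r + ε))))
  obtain ⟨C₂, hC₂⟩ := hsc ε (-ε) hε' hε'' (1 / (n * (ε / (1 / p + ε))))
    (1 / (n * (ε / (1 / r + -ε))))
  obtain ⟨C₃, hC₃⟩ := hsc (-ε) ε hε'' hε' (1 / (n * (ε / (1 / p + -ε))))
    (1 / (n * (ε / (1 / r + ε))))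
  obtain ⟨C₄, hC₄⟩ := hsc (-ε) (-ε) hε'' hε'' (1 / (n * (ε / (1 / p + -ε))))
    (1 / (n * (ε / (1 / r + -ε))))
  refine ⟨C₁ + C₂ + C₃ + C₄, fun f g hf hg hfp hgr => ?_⟩
  have F₁ := isScaleBounded_levelSet hf hn hp hε0 hfp
  have F₂ := isScaleBounded_compl_levelSet hf hn hp hε0 hε1 hfp
  have G₁ := isScaleBounded_levelSet hg hn hr hε0 hgr
  have G₂ := isScaleBounded_compl_levelSet hg hn hr hε0 hε2 hgr
  set f₁ : ℝ → Rn n → ℝ≥0∞ := fun ρ y => (levelSet f p).indicator (fun q => f q.2) (ρ, y) with hf₁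
  set f₂ : ℝ → Rn n → ℝ≥0∞ := fun ρ y => (levelSet f p)ᶜ.indicator (fun q => f q.2) (ρ, y) with hf₂
  set g₁ : ℝ → Rn n → ℝ≥0∞ := fun ρ y => (levelSet g r).indicator (fun q => g q.2) (ρ, y) with hg₁
  set g₂ : ℝ → Rn n → ℝ≥0∞ := fun ρ y => (levelSet g r)ᶜ.indicator (fun q => g q.2) (ρ, y) with hg₂
  have hsplit : ∀ ρ, truncForm b W ρ f g = truncForm b W ρ (f₁ ρ) (g₁ ρ)
      + truncForm b W ρ (f₁ ρ) (g₂ ρ) + truncForm b W ρ (f₂ ρ) (g₁ ρ)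
      + truncForm b W ρ (f₂ ρ) (g₂ ρ) := by
    intro ρ
    have ef : f = fun y => f₁ ρ y + f₂ ρ y := by
      funext y
      exact (congrFun (indicator_self_add_compl (levelSet f p) fun q => f q.2) (ρ, y)).symm
    have eg : g = fun y => g₁ ρ y + g₂ ρ y := by
      funext y
      exact (congrFun (indicator_self_add_compl (levelSet g r) fun q => g q.2) (ρ, y)).symm
    have m1 : Measurable (f₁ ρ) := F₁.measurable.comp measurable_prodMk_left
    have m2 : Measurable (f₂ ρ) := F₂.measurable.comp measurable_prodMk_left
    have m3 : Measurable (g₁ ρ) := G₁.measurable.comp measurable_prodMk_left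
    calc truncForm b W ρ f g = truncForm b W ρ (fun y => f₁ ρ y + f₂ ρ y) g := by rw [← ef]
      _ = truncForm b W ρ (f₁ ρ) g + truncForm b W ρ (f₂ ρ) g :=
          truncForm_add_left hbm hW m1 hg ρ
      _ = truncForm b W ρ (f₁ ρ) (fun y => g₁ ρ y + g₂ ρ y)
          + truncForm b W ρ (f₂ ρ) (fun y => g₁ ρ y + g₂ ρ y) := by rw [← eg]
      _ = _ := by
          rw [truncForm_add_right hbm hW m1 m3, truncForm_add_right hbm hW m2 m3]; ring
  have hmm : ∀ {h₁ h₂ : ℝ → Rn n → ℝ≥0∞}, Measurable (Function.uncurry h₁) →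
      Measurable (Function.uncurry h₂) → Measurable fun ρ : ℝ =>
        ENNReal.ofReal (ρ ^ (-γ - 1)) * truncForm b W ρ (h₁ ρ) (h₂ ρ) := fun H₁ H₂ =>
    (by fun_prop : Measurable fun ρ : ℝ => ENNReal.ofReal (ρ ^ (-γ - 1))).mul
      (measurable_truncForm hbm hW H₁ H₂)
  have M₁ := hmm F₁.measurable G₁.measurable
  have M₂ := hmm F₁.measurable G₂.measurable
  have M₃ := hmm F₂.measurable G₁.measurable
  simp_rw [hsplit, mul_add]
  rw [lintegral_add_left (by fun_prop), lintegral_add_left (by fun_prop), lintegral_add_left M₁]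
  push_cast
  gcongr
  · exact hC₁ _ _ F₁ G₁
  · exact hC₂ _ _ F₁ G₂
  · exact hC₃ _ _ F₂ G₁
  · exact hC₄ _ _ F₂ G₂

theorem truncForm_eq_zero_left {W f g : Rn n → ℝ≥0∞} (hf : f =ᵐ[volume] 0) (ρ : ℝ) :
    truncForm b W ρ f g = 0 := by
  rw [truncForm]
  have : ∀ x, ∫⁻ y, pairing b ((Metric.ball 0 ρ).indicator W) f g x y = 0 := by
    intro x
    rw [← lintegral_zero (μ := (volume : Measure (Rn n)))]
    refine lintegral_congr_ae ?_
    filter_upwards [hf] with y hy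
    simp [pairing, hy]
  simp [this]

theorem truncForm_eq_zero_right {W f g : Rn n → ℝ≥0∞} (hg : g =ᵐ[volume] 0) (ρ : ℝ) :
    truncForm b W ρ f g = 0 := by
  rw [truncForm, ← lintegral_zero (μ := (volume : Measure (Rn n)))]
  refine lintegral_congr_ae ?_
  filter_upwards [hg] with x hx
  simp [pairing, hx]

theorem exists_lintegral_truncForm_le (hbm : StronglyMeasurable b)
    (hb : LocallyIntegrable b) {N : ℝ≥0} (hN : OscillationLE b N) (hn : 0 < n) {W : Rn n → ℝ≥0∞}
    (hW : Measurable W) {p r w γ : ℝ} {A : ℝ≥0} (hWA : GrowthLE W (1 / w) A)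
    (hp : 1 < p) (hr : 1 < r) (hw0 : 0 < w) (hw : w < 1) (hpr : 1 < 1 / p + 1 / r)
    (hprw : 1 / p + 1 / r + w < 2) (hγ : γ = n * (2 - 1 / p - 1 / r)) :
    ∃ C : ℝ≥0, ∀ f g : Rn n → ℝ≥0∞, Measurable f → Measurable g →
      ∫⁻ ρ in Ioi (0 : ℝ), ENNReal.ofReal (ρ ^ (-γ - 1)) * truncForm b W ρ f g
        ≤ C * ((∫⁻ y, f y ^ p) ^ (1 / p) * (∫⁻ x, g x ^ r) ^ (1 / r)) := by
  have hp0 : 0 < p := by linarith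
  have hr0 : 0 < r := by linarith
  obtain ⟨C, hC⟩ := exists_lintegral_truncForm_le_of_le_one hbm hb hN hn hW hWA hp hr hw0 hw hpr
    hprw hγ
  -- A nonzero constant makes the bound infinite when one norm is infinite and the other is nonzero.
  refine ⟨C + 1, fun f g hf hg => ?_⟩
  set a := (∫⁻ y, f y ^ p) ^ (1 / p) with ha
  set c := (∫⁻ x, g x ^ r) ^ (1 / r) with hc
  have hzero : ∀ {F : Rn n → ℝ≥0∞} {t : ℝ}, Measurable F → 0 < t →
      (∫⁻ y, F y ^ t) ^ (1 / t) = 0 → F =ᵐ[volume] 0 := by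
    intro F t hF ht h
    rw [ENNReal.rpow_eq_zero_iff_of_pos (by positivity), lintegral_eq_zero_iff (hF.pow_const _)] at h
    filter_upwards [h] with y hy
    simpa [ht, ENNReal.rpow_eq_zero_iff_of_pos ht] using hy
  rcases eq_or_ne a 0 with ha0 | ha0
  · simp [truncForm_eq_zero_left (hzero hf hp0 ha0)]
  rcases eq_or_ne c 0 with hc0 | hc0
  · simp [truncForm_eq_zero_right (hzero hg hr0 hc0)]
  have hC1 : ((C + 1 : ℝ≥0) : ℝ≥0∞) ≠ 0 := by positivity
  rcases eq_or_ne a ∞ with hat | hat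
  · rw [hat, ENNReal.top_mul hc0, ENNReal.mul_top hC1]; exact le_top
  rcases eq_or_ne c ∞ with hct | hct
  · rw [hct, ENNReal.mul_top ha0, ENNReal.mul_top hC1]; exact le_top
  have hnorm : ∀ {F : Rn n → ℝ≥0∞} {t : ℝ}, Measurable F → 0 < t →
      (∫⁻ y, F y ^ t) ^ (1 / t) ≠ 0 → (∫⁻ y, F y ^ t) ^ (1 / t) ≠ ∞ →
      ∫⁻ y, (((∫⁻ y, F y ^ t) ^ (1 / t))⁻¹ * F y) ^ t ≤ 1 := by
    intro F t hF ht h0 h1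
    simp_rw [ENNReal.mul_rpow_of_nonneg _ _ ht.le]
    rw [lintegral_const_mul _ (hF.pow_const _), ENNReal.inv_rpow, ← ENNReal.rpow_mul,
      one_div_mul_cancel ht.ne', ENNReal.rpow_one]
    exact ENNReal.inv_mul_le_one _
  have key := hC (fun y => a⁻¹ * f y) (fun x => c⁻¹ * g x) (hf.const_mul _) (hg.const_mul _)
    (hnorm hf hp0 ha0 hat) (hnorm hg hr0 hc0 hct)
  have e : ∀ ρ, truncForm b W ρ f g
      = a * c * truncForm b W ρ (fun y => a⁻¹ * f y) (fun x => c⁻¹ * g x) := by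
    intro ρ
    rw [truncForm_smul hbm hW hf hg, ← mul_assoc]
    have : a * c * (a⁻¹ * c⁻¹) = (a * a⁻¹) * (c * c⁻¹) := by ring
    rw [this, ENNReal.mul_inv_cancel ha0 hat, ENNReal.mul_inv_cancel hc0 hct, one_mul, one_mul]
  simp_rw [e, mul_left_comm _ (a * c)]
  rw [lintegral_const_mul' _ _ (ENNReal.mul_ne_top hat hct), mul_comm]
  gcongr
  exact key.trans (by simp)

end Global

end VanishingMorrey

namespace VanishingMorrey

open MeasureTheory Filter Topology Set
open scoped ENNReal NNReal

/-! ### Bilinear forms on concentric balls -/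

section Far

variable {n : ℕ} {𝕜 : Type*} [RCLike 𝕜] {b : Rn n → 𝕜}

theorem lintegral_rpow_mul_rpow_le_of_add_le_one {X : Type*} [MeasurableSpace X] {μ : Measure X}
    {G K : X → ℝ≥0∞} (hG : AEMeasurable G μ) (hK : AEMeasurable K μ) {a c : ℝ} (ha : 0 ≤ a)
    (hc : 0 ≤ c) (hac : a + c ≤ 1) :
    ∫⁻ x, G x ^ a * K x ^ c ∂μ
      ≤ (∫⁻ x, G x ∂μ) ^ a * (∫⁻ x, K x ∂μ) ^ c * μ univ ^ (1 - (a + c)) := by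
  have key := ENNReal.lintegral_prod_norm_pow_le (μ := μ) Finset.univ
    (f := ![G, K, fun _ => 1]) (p := ![a, c, 1 - (a + c)])
    (by
      intro i _
      fin_cases i
      · exact hG
      · exact hK
      · exact aemeasurable_const)
    (by simp [Fin.sum_univ_three])
    (by
      intro i _
      fin_cases i
      · exact ha
      · exact hc
      · simpa using hac)
  simpa [Fin.prod_univ_three] using key

theorem rpow_one_div_rpow_mul (a : ℝ≥0∞) (l : ℝ) {t : ℝ} (ht : 0 < t) :
    (a ^ (1 / t)) ^ (l * t) = a ^ l := by
  rw [← ENNReal.rpow_mul]; congr 1; field_simp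

theorem lintegral_indicator_rpow {E : Set (Rn n)} (hE : MeasurableSet E) (F : Rn n → ℝ≥0∞) {t : ℝ}
    (ht : 0 < t) : ∫⁻ y, E.indicator F y ^ t = ∫⁻ y in E, F y ^ t := by
  rw [← lintegral_indicator hE]
  refine lintegral_congr fun y => ?_
  by_cases hy : y ∈ E
  · rw [indicator_of_mem hy, indicator_of_mem hy]
  · rw [indicator_of_notMem hy, indicator_of_notMem hy, ENNReal.zero_rpow_of_pos ht]

theorem volume_ball_mul_lintegral_lintegral {Φ : Rn n → Rn n → ℝ≥0∞}
    (hΦ : Measurable (Function.uncurry Φ)) (E : Set (Rn n)) (r : ℝ) :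
    volume (Metric.ball (0 : Rn n) r) * ∫⁻ x in E, ∫⁻ y, Φ x y
      = ∫⁻ z, ∫⁻ x in E, ∫⁻ y in Metric.ball z r, Φ x y := by
  have hm3 : Measurable fun q : Rn n × Rn n => ∫⁻ y in Metric.ball q.1 r, Φ q.2 y := by
    have : ∀ q : Rn n × Rn n, ∫⁻ y in Metric.ball q.1 r, Φ q.2 y = ∫⁻ y,
        {p : (Rn n × Rn n) × Rn n | dist p.2 p.1.1 < r}.indicator
          (fun p => Φ p.1.2 p.2) (q, y) := by
      intro q
      rw [← lintegral_indicator measurableSet_ball]; rfl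
    simp_rw [this]
    refine Measurable.lintegral_prod_right' (Measurable.indicator ?_ ?_)
    · exact hΦ.comp ((measurable_snd.comp measurable_fst).prodMk measurable_snd)
    · exact measurableSet_lt (measurable_snd.dist (measurable_fst.comp measurable_fst))
        measurable_const
  rw [lintegral_lintegral_swap (f := fun z x => ∫⁻ y in Metric.ball z r, Φ x y) hm3.aemeasurable,
    ← lintegral_const_mul' _ _ (volume_ball_ne_top _ _)]
  refine lintegral_congr fun x => ?_
  exact (volume_ball_mul_lintegral (hΦ.comp measurable_prodMk_left) 0 r).symm

/-- The bilinear form on a product of two concentric balls. -/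
noncomputable def ballForm (b : Rn n → 𝕜) (W : Rn n → ℝ≥0∞) (x₀ : Rn n) (r t : ℝ)
    (f g : Rn n → ℝ≥0∞) : ℝ≥0∞ :=
  ∫⁻ x in Metric.ball x₀ r, ∫⁻ y in Metric.ball x₀ t, pairing b W f g x y

theorem ofReal_one_add_log_two_mul_le {r t : ℝ} (hr : 0 < r) (ht : r ≤ t) :
    ENNReal.ofReal (1 + Real.log (2 * t / r)) ≤ 2 * ENNReal.ofReal (1 + Real.log (t / r)) := by
  have h1 : 0 ≤ Real.log (t / r) := Real.log_nonneg ((one_le_div hr).2 ht)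
  rw [← ENNReal.ofReal_ofNat, ← ENNReal.ofReal_mul two_pos.le]
  refine ENNReal.ofReal_le_ofReal ?_
  have htr : 0 < t / r := div_pos (hr.trans_le ht) hr
  rw [mul_div_assoc, Real.log_mul two_ne_zero htr.ne']
  linarith [Real.log_two_lt_d9]

/-- Here |x-y| < r + t < 3t, so the truncations lose nothing. They allow y to range over the whole
space with W still subject to its growth bound. -/
theorem ballForm_eq_indicator {W f g : Rn n → ℝ≥0∞} (x₀ : Rn n) {r t : ℝ} (hrt : 2 * r ≤ t)
    (ht : 0 < t) :
    ballForm b W x₀ r t f g = ∫⁻ x in Metric.ball x₀ r, ∫⁻ y,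
      pairing b ((Metric.ball (0 : Rn n) (3 * t)).indicator W)
        ((Metric.ball x₀ t).indicator f) g x y := by
  refine setLIntegral_congr_fun measurableSet_ball fun x hx => ?_
  rw [← lintegral_indicator measurableSet_ball]
  refine lintegral_congr fun y => ?_
  by_cases hy : y ∈ Metric.ball x₀ t
  · have hxy : x - y ∈ Metric.ball (0 : Rn n) (3 * t) := by
      rw [Metric.mem_ball] at hx hy
      rw [mem_ball_zero_iff, ← dist_eq_norm]
      linarith [dist_triangle_right x y x₀]
    rw [indicator_of_mem hy, pairing, pairing, indicator_of_mem hy, indicator_of_mem hxy]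
  · rw [indicator_of_notMem hy, pairing, indicator_of_notMem hy]; simp

/-- The large ball is averaged over balls B(z,r) of the size of the small one. On B(x₀,r) × B(z,r)
the difference x - y stays in B(x₀-z,2r), so the bilinear bound is used at scale r and produces
r^{n(1-v)}. The condition u + w = 1 then allows plain Hölder in z. -/
theorem exists_ballForm_le_of_conj (hbm : StronglyMeasurable b)
    (hb : LocallyIntegrable b) {N : ℝ≥0} (hN : OscillationLE b N) {W : Rn n → ℝ≥0∞}
    (hW : Measurable W) {u v w : ℝ} {A : ℝ≥0} (hWA : GrowthLE W (1 / w) A)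
    (hu0 : 0 < u) (hv0 : 0 < v) (hw0 : 0 < w) (hv : v < 1) (huw : u + w = 1) :
    ∃ C : ℝ≥0, ∀ (x₀ : Rn n) (r t : ℝ) (f g : Rn n → ℝ≥0∞), 0 < r → 2 * r ≤ t →
      Measurable f → Measurable g →
      ballForm b W x₀ r t f g
        ≤ C * ENNReal.ofReal (1 + Real.log (t / r))
          * (ENNReal.ofReal r ^ (n * (1 - v)) * ENNReal.ofReal t ^ (n * (1 - u)))
          * ((∫⁻ y in Metric.ball x₀ t, f y ^ (1 / u)) ^ u
            * (∫⁻ x in Metric.ball x₀ r, g x ^ (1 / v)) ^ v) := by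
  obtain ⟨m, hm, hbil⟩ := exists_bilinear_bound hu0 hv0 hw0 (by linarith) hv (by linarith)
    (by linarith)
  have hm0 : 0 < m := by linarith
  obtain ⟨B, hB⟩ := exists_lintegral_oscWeight_rpow_le hbm hb hN hm
  set V₁ := volume (Metric.ball (0 : Rn n) 1) with hV₁
  set V₂ := volume (Metric.ball (0 : Rn n) 2) with hV₂
  have hV₁0 : V₁ ≠ 0 := volume_ball_ne_zero _ one_pos
  have hV₁t : V₁ ≠ ∞ := volume_ball_ne_top _ _
  have hV₂t : V₂ ≠ ∞ := volume_ball_ne_top _ _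
  have hV12 : V₁ ≤ V₂ := measure_mono (Metric.ball_subset_ball (by norm_num))
  have hS : 2 - (u + v + w) = 1 - v := by linarith
  have hv' : 0 ≤ 1 - v := by linarith
  set C₀ : ℝ≥0∞ := V₁⁻¹ * (V₁ ^ u * (V₂ * (A * 3 ^ n)) ^ w * (V₂ ^ (1 - v) * (B * 2))) with hC₀
  have hC₀t : C₀ ≠ ∞ := by
    have h1 : (V₂ * ((A : ℝ≥0∞) * 3 ^ n)) ^ w ≠ ∞ :=
      ENNReal.rpow_ne_top_of_nonneg hw0.le (by finiteness)
    have h2 : V₂ ^ (1 - v) ≠ ∞ := ENNReal.rpow_ne_top_of_nonneg hv' hV₂t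
    have h3 : V₁⁻¹ ≠ ∞ := ENNReal.inv_ne_top.2 hV₁0
    have h4 : V₁ ^ u ≠ ∞ := ENNReal.rpow_ne_top_of_nonneg hu0.le hV₁t
    rw [hC₀]; finiteness
  refine ⟨C₀.toNNReal, fun x₀ r t f g hr hrt hf hg => ?_⟩
  rw [ENNReal.coe_toNNReal hC₀t]
  have ht : 0 < t := by linarith
  set R := ENNReal.ofReal r with hR
  set T := ENNReal.ofReal t with hT
  set L := ENNReal.ofReal (1 + Real.log (t / r)) with hL
  have hR0 : R ≠ 0 := by simpa [hR] using hr
  have hRt : R ≠ ∞ := ENNReal.ofReal_ne_top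
  set F := (Metric.ball x₀ t).indicator f with hF
  set k := (Metric.ball (0 : Rn n) (3 * t)).indicator W with hk
  have hFm : Measurable F := hf.indicator measurableSet_ball
  have hkm : Measurable k := hW.indicator measurableSet_ball
  have hv1 : ∀ z : Rn n, volume (Metric.ball z r) = R ^ (n : ℝ) * V₁ := fun z => by
    simpa using volume_ball_mul_rpow z one_pos hr
  have hv2 : ∀ z : Rn n, volume (Metric.ball z (2 * r)) = R ^ (n : ℝ) * V₂ := fun z =>
    volume_ball_mul_rpow z two_pos hr
  set M := R ^ (n : ℝ) * V₂ with hM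
  set P : Rn n → ℝ≥0∞ := fun z => ∫⁻ y in Metric.ball z r, F y ^ (1 / u) with hP
  set Q : Rn n → ℝ≥0∞ := fun z => ∫⁻ y in Metric.ball (x₀ - z) (2 * r), k y ^ (1 / w) with hQ
  set IG := ∫⁻ x in Metric.ball x₀ r, g x ^ (1 / v) with hIG
  have hPm : Measurable P := measurable_lintegral_ball r (hFm.pow_const _)
  have hQm : Measurable Q :=
    (measurable_lintegral_ball (2 * r) (hkm.pow_const (1 / w))).comp (by fun_prop)
  have hM1 : ∀ z : Rn n, volume (Metric.ball z r) ≤ M := fun z => by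
    rw [hv1]; exact mul_le_mul' le_rfl hV12
  have hloc : ∀ z, ∫⁻ x in Metric.ball x₀ r, ∫⁻ y in Metric.ball z r, pairing b k F g x y
      ≤ P z ^ u * Q z ^ w * (IG ^ v * M ^ (1 - v) * (B * (2 * L))) := by
    intro z
    -- For more distant z the ball B(z,r) misses the support of the truncated f. The bound 2t is the
    -- σ entering the logarithm.
    by_cases hz : dist z x₀ ≤ 2 * t
    · have h1 := hbil hFm hg hkm (measurable_oscWeight hbm) (E₁ := Metric.ball x₀ r)
        (E₂ := Metric.ball z r) (E₃ := Metric.ball (x₀ - z) (2 * r)) measurableSet_ball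
        measurableSet_ball measurableSet_ball (by
          intro x hx y hy
          rw [Metric.mem_ball, dist_eq_norm] at hx hy ⊢
          have : x - y - (x₀ - z) = (x - x₀) - (y - z) := by abel
          rw [this]
          linarith [norm_sub_le (x - x₀) (y - z)]) (M := M) (D := B * (2 * L)) (hM1 _) (hM1 _)
        (hv2 _).le (by
          have := hB x₀ z x₀ r r r (2 * t) hr le_rfl (by linarith) le_rfl (by linarith)
            (by simpa using ht.le) hz
          refine this.trans ?_
          rw [ENNReal.rpow_two, sq]
          gcongr
          · exact ofReal_one_add_log_two_mul_le hr (by linarith)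
          · exact hM1 _
          · exact hM1 _)
      refine h1.trans (le_of_eq ?_)
      rw [hS]; ring
    · have h0 : ∀ x, ∫⁻ y in Metric.ball z r, pairing b k F g x y = 0 := by
        intro x
        rw [← lintegral_zero (μ := volume.restrict (Metric.ball z r))]
        refine setLIntegral_congr_fun measurableSet_ball fun y hy => ?_
        have : F y = 0 := by
          refine indicator_of_notMem (fun hyt => hz ?_) _
          rw [Metric.mem_ball] at hy hyt
          linarith [dist_triangle_left z x₀ y]
        simp [pairing, this]
      simp [h0]
  have havg : volume (Metric.ball (0 : Rn n) r) * ballForm b W x₀ r t f g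
      = ∫⁻ z, ∫⁻ x in Metric.ball x₀ r, ∫⁻ y in Metric.ball z r, pairing b k F g x y := by
    rw [ballForm_eq_indicator x₀ hrt ht]
    exact volume_ball_mul_lintegral_lintegral (measurable_pairing hbm hkm hFm hg) _ _
  have hIF : ∫⁻ y, F y ^ (1 / u) = ∫⁻ y in Metric.ball x₀ t, f y ^ (1 / u) :=
    lintegral_indicator_rpow measurableSet_ball f (by positivity)
  have hQi : ∫⁻ z, Q z ≤ R ^ (n : ℝ) * V₂ * (A * (3 * T) ^ (n : ℝ)) := by
    rw [hQ, lintegral_sub_left_eq_self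
      (fun z => ∫⁻ y in Metric.ball z (2 * r), k y ^ (1 / w)) x₀,
      volume_ball_mul_lintegral (hkm.pow_const _) 0, hv2]
    gcongr
    have h3 := hWA (3 * t) (by positivity)
    rw [ENNReal.ofReal_mul (by norm_num), ENNReal.ofReal_ofNat] at h3
    rwa [hk, lintegral_indicator_rpow measurableSet_ball W (by positivity)]
  set IF := ∫⁻ y in Metric.ball x₀ t, f y ^ (1 / u) with hIFd
  have hPQ : ∫⁻ z, P z ^ u * Q z ^ w
      ≤ (R ^ (n : ℝ) * V₁ * IF) ^ u * (R ^ (n : ℝ) * V₂ * (A * (3 * T) ^ (n : ℝ))) ^ w := by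
    refine (ENNReal.lintegral_mul_norm_pow_le hPm.aemeasurable hQm.aemeasurable hu0.le hw0.le
      huw).trans ?_
    gcongr
    rw [hP, volume_ball_mul_lintegral (hFm.pow_const _) 0, hv1, hIF]
  have hvol0 : volume (Metric.ball (0 : Rn n) r) ≠ 0 := volume_ball_ne_zero _ hr
  rw [← ENNReal.mul_le_mul_iff_right hvol0 (volume_ball_ne_top _ _), havg]
  refine (lintegral_mono hloc).trans ?_
  rw [lintegral_mul_const _ (show Measurable fun z => P z ^ u * Q z ^ w from
    (hPm.pow_const _).mul (hQm.pow_const _))]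
  refine (mul_le_mul' hPQ le_rfl).trans (le_of_eq ?_)
  have hu1 : u = 1 - w := by linarith
  have e1 : (R ^ (n : ℝ) * V₁ * IF) ^ u = R ^ (n * u) * V₁ ^ u * IF ^ u := by
    rw [ENNReal.mul_rpow_of_nonneg _ _ hu0.le, ENNReal.mul_rpow_of_nonneg _ _ hu0.le,
      ← ENNReal.rpow_mul]
  have e2 : (R ^ (n : ℝ) * V₂ * (A * (3 * T) ^ (n : ℝ))) ^ w
      = R ^ (n * w) * (V₂ * (A * 3 ^ n)) ^ w * T ^ (n * (1 - u)) := by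
    rw [ENNReal.mul_rpow_of_nonneg 3 T (Nat.cast_nonneg n), ENNReal.rpow_natCast 3]
    have : R ^ (n : ℝ) * V₂ * (A * (3 ^ n * T ^ (n : ℝ)))
        = R ^ (n : ℝ) * (V₂ * (A * 3 ^ n)) * T ^ (n : ℝ) := by ring
    rw [this, ENNReal.mul_rpow_of_nonneg _ _ hw0.le, ENNReal.mul_rpow_of_nonneg _ _ hw0.le,
      ← ENNReal.rpow_mul, ← ENNReal.rpow_mul, hu1, sub_sub_cancel]
  have e3 : M ^ (1 - v) = R ^ (n * (1 - v)) * V₂ ^ (1 - v) := by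
    rw [hM, ENNReal.mul_rpow_of_nonneg _ _ hv', ← ENNReal.rpow_mul]
  have e4 : R ^ (n * u) * R ^ (n * w) = R ^ (n : ℝ) := by
    rw [← ENNReal.rpow_add _ _ hR0 hRt, ← mul_add, huw, mul_one]
  rw [e1, e2, e3, hv1, hC₀, ← e4]
  calc _ = 1 * (R ^ (n * u) * V₁ ^ u * IF ^ u * (R ^ (n * w) * (V₂ * (A * 3 ^ n)) ^ w
        * T ^ (n * (1 - u))) * (IG ^ v * (R ^ (n * (1 - v)) * V₂ ^ (1 - v)) * (B * (2 * L)))) :=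
        (one_mul _).symm
    _ = _ := by rw [← ENNReal.mul_inv_cancel hV₁0 hV₁t]; ring

/-- For fixed y, Hölder's inequality in x over the small ball, possible because v + w < 1, puts g in
L^{1/v} and W in L^{1/w}. The norm of W is controlled only on B(0,2t): hence t^{nw}, with just
r^{n(1-v-w)} left. A slight power l > 1 again makes room for b. -/
theorem exists_ballForm_le_of_add_lt_one (hbm : StronglyMeasurable b)
    (hb : LocallyIntegrable b) {N : ℝ≥0} (hN : OscillationLE b N) {W : Rn n → ℝ≥0∞}
    (hW : Measurable W) {u v w : ℝ} {A : ℝ≥0} (hWA : GrowthLE W (1 / w) A)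
    (hu0 : 0 < u) (hu : u < 1) (hv0 : 0 < v) (hw0 : 0 < w) (hvw : v + w < 1) :
    ∃ C : ℝ≥0, ∀ (x₀ : Rn n) (r t : ℝ) (f g : Rn n → ℝ≥0∞), 0 < r → 2 * r ≤ t →
      Measurable f → Measurable g →
      ballForm b W x₀ r t f g
        ≤ C * ENNReal.ofReal (1 + Real.log (t / r))
          * (ENNReal.ofReal r ^ (n * (1 - v - w)) * ENNReal.ofReal t ^ (n * (1 - u + w)))
          * ((∫⁻ y in Metric.ball x₀ t, f y ^ (1 / u)) ^ u
            * (∫⁻ x in Metric.ball x₀ r, g x ^ (1 / v)) ^ v) := by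
  obtain ⟨l, hl1, hl⟩ : ∃ l : ℝ, 1 < l ∧ l < min (1 / u) (1 / (v + w)) := by
    refine exists_between ?_
    simp only [lt_min_iff]
    refine ⟨?_, ?_⟩ <;> rw [lt_div_iff₀ (by positivity)] <;> linarith
  simp only [lt_min_iff] at hl
  obtain ⟨hlu, hlvw⟩ := hl
  rw [lt_div_iff₀ (by positivity)] at hlu hlvw
  have hl0 : 0 < l := by linarith
  have hlm := Real.HolderConjugate.conjExponent hl1
  set m := l.conjExponent
  have hm0 : 0 < m := hlm.symm.pos
  obtain ⟨B, hB⟩ := exists_lintegral_oscWeight_rpow_le hbm hb hN (m := m) hlm.symm.lt.le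
  set V₁ := volume (Metric.ball (0 : Rn n) 1) with hV₁
  have hV₁t : V₁ ≠ ∞ := volume_ball_ne_top _ _
  set C₀ : ℝ≥0∞ := (A * 2 ^ n) ^ w * V₁ ^ (1 - v - w) * V₁ ^ (1 - u) * B with hC₀
  have hvw' : 0 ≤ 1 - v - w := by linarith
  have hu' : 0 ≤ 1 - u := by linarith
  have hC₀t : C₀ ≠ ∞ := by
    have h1 : ((A : ℝ≥0∞) * 2 ^ n) ^ w ≠ ∞ :=
      ENNReal.rpow_ne_top_of_nonneg hw0.le (by finiteness)
    have h2 : V₁ ^ (1 - v - w) ≠ ∞ := ENNReal.rpow_ne_top_of_nonneg hvw' hV₁t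
    have h3 : V₁ ^ (1 - u) ≠ ∞ := ENNReal.rpow_ne_top_of_nonneg hu' hV₁t
    rw [hC₀]; finiteness
  refine ⟨C₀.toNNReal, fun x₀ r t f g hr hrt hf hg => ?_⟩
  rw [ENNReal.coe_toNNReal hC₀t]
  have ht : 0 < t := by linarith
  set R := ENNReal.ofReal r with hR
  set T := ENNReal.ofReal t with hT
  set L := ENNReal.ofReal (1 + Real.log (t / r)) with hL
  have hT0 : T ≠ 0 := by simpa [hT] using ht
  have hTt : T ≠ ∞ := ENNReal.ofReal_ne_top
  have hv1 : volume (Metric.ball x₀ r) = R ^ (n : ℝ) * V₁ := by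
    simpa using volume_ball_mul_rpow x₀ one_pos hr
  have hv2 : volume (Metric.ball x₀ t) = T ^ (n : ℝ) * V₁ := by
    simpa using volume_ball_mul_rpow x₀ one_pos ht
  set E₁ := volume (Metric.ball x₀ r) with hE₁
  set E₂ := volume (Metric.ball x₀ t) with hE₂
  set IF := ∫⁻ y in Metric.ball x₀ t, f y ^ (1 / u) with hIF
  set IG := ∫⁻ x in Metric.ball x₀ r, g x ^ (1 / v) with hIG
  set IW : ℝ≥0∞ := A * (2 * T) ^ (n : ℝ) with hIW
  have hh : Measurable (Function.uncurry fun x y : Rn n => f y * g x * W (x - y)) :=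
    ((hf.comp measurable_snd).mul (hg.comp measurable_fst)).mul
      (hW.comp (measurable_fst.sub measurable_snd))
  have hinner : ∀ y ∈ Metric.ball x₀ t, ∫⁻ x in Metric.ball x₀ r, (f y * g x * W (x - y)) ^ l
      ≤ (f y ^ (1 / u)) ^ (l * u) * (IG ^ (l * v) * IW ^ (l * w) * E₁ ^ (1 - (l * v + l * w))) := by
    intro y hy
    have hWy : Measurable fun x => W (x - y) ^ (1 / w) := by fun_prop
    have e : ∀ x, (f y * g x * W (x - y)) ^ l
        = (f y ^ (1 / u)) ^ (l * u) * ((g x ^ (1 / v)) ^ (l * v) * (W (x - y) ^ (1 / w)) ^ (l * w)) := by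
      intro x
      rw [rpow_one_div_rpow_mul _ _ hu0, rpow_one_div_rpow_mul _ _ hv0,
        rpow_one_div_rpow_mul _ _ hw0, ENNReal.mul_rpow_of_nonneg _ _ hl0.le,
        ENNReal.mul_rpow_of_nonneg _ _ hl0.le, mul_assoc]
    simp_rw [e]
    rw [lintegral_const_mul _ (show Measurable fun x => (g x ^ (1 / v)) ^ (l * v)
      * (W (x - y) ^ (1 / w)) ^ (l * w) from ((hg.pow_const _).pow_const _).mul (hWy.pow_const _))]
    gcongr
    have h1 := lintegral_rpow_mul_rpow_le_of_add_le_one (μ := volume.restrict (Metric.ball x₀ r))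
      (hg.pow_const (1 / v)).aemeasurable hWy.aemeasurable (a := l * v) (c := l * w)
      (by positivity) (by positivity) (by linarith)
    rw [Measure.restrict_apply_univ] at h1
    refine h1.trans ?_
    gcongr
    have h3 := hWA (2 * t) (by positivity)
    rw [ENNReal.ofReal_mul (by norm_num), ENNReal.ofReal_ofNat] at h3
    refine le_trans ?_ h3
    rw [← lintegral_indicator measurableSet_ball, ← lintegral_indicator measurableSet_ball,
      ← lintegral_sub_right_eq_self
        ((Metric.ball (0 : Rn n) (2 * t)).indicator fun z => W z ^ (1 / w)) y]
    refine lintegral_mono fun x => ?_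
    by_cases hx : x ∈ Metric.ball x₀ r
    · have hxy : x - y ∈ Metric.ball (0 : Rn n) (2 * t) := by
        rw [Metric.mem_ball] at hx hy
        rw [mem_ball_zero_iff, ← dist_eq_norm]
        linarith [dist_triangle_right x y x₀]
      rw [indicator_of_mem hx, indicator_of_mem hxy]
    · rw [indicator_of_notMem hx]; exact zero_le
  have hmain : ∫⁻ x in Metric.ball x₀ r, ∫⁻ y in Metric.ball x₀ t, (f y * g x * W (x - y)) ^ l
      ≤ IF ^ (l * u) * E₂ ^ (1 - l * u)
        * (IG ^ (l * v) * IW ^ (l * w) * E₁ ^ (1 - (l * v + l * w))) := by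
    rw [lintegral_lintegral_swap (hh.pow_const l).aemeasurable]
    refine (setLIntegral_mono' measurableSet_ball hinner).trans ?_
    rw [lintegral_mul_const _ ((hf.pow_const _).pow_const _)]
    gcongr
    exact lintegral_rpow_le_of_le_one (hf.pow_const _).aemeasurable (by positivity) hlu.le
      (by rw [Measure.restrict_apply_univ])
  have hβ := hB x₀ x₀ x₀ r r t t hr le_rfl (by linarith) (by linarith) le_rfl
    (by simpa using ht.le) (by simpa using ht.le)
  have hl' : 0 ≤ 1 / l := by positivity
  have hm' : 0 ≤ 1 / m := by positivity
  refine (setLIntegral_setLIntegral_mul_le hh (measurable_oscWeight hbm) _ _ hlm).trans ?_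
  have hlm1 : 1 / l + 1 / m = 1 := by
    have := hlm.inv_add_inv_eq_one
    simpa [one_div] using this
  calc _ ≤ (IF ^ (l * u) * E₂ ^ (1 - l * u)
        * (IG ^ (l * v) * IW ^ (l * w) * E₁ ^ (1 - (l * v + l * w)))) ^ (1 / l)
        * ((B * L) ^ m * (E₁ * E₂)) ^ (1 / m) := by gcongr
    _ = IF ^ u * IG ^ v * IW ^ w * (E₁ ^ ((1 - (l * v + l * w)) * (1 / l)) * E₁ ^ (1 / m))
        * (E₂ ^ ((1 - l * u) * (1 / l)) * E₂ ^ (1 / m)) * (B * L) := by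
        simp_rw [ENNReal.mul_rpow_of_nonneg _ _ hl', ENNReal.mul_rpow_of_nonneg _ _ hm',
          ENNReal.mul_rpow_of_nonneg _ _ hm0.le, ENNReal.mul_rpow_of_nonneg _ _ hm',
          ← ENNReal.rpow_mul]
        have e2 : ∀ t : ℝ, l * t * (1 / l) = t := fun t => by field_simp
        have e3 : m * (1 / m) = 1 := by field_simp
        rw [e2, e2, e2, e3, ENNReal.rpow_one, ENNReal.rpow_one]
        ring
    _ = IF ^ u * IG ^ v * IW ^ w * E₁ ^ (1 - v - w) * E₂ ^ (1 - u) * (B * L) := by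
        rw [← ENNReal.rpow_add_of_nonneg _ _ (mul_nonneg (by linarith) hl') hm',
          ← ENNReal.rpow_add_of_nonneg _ _ (mul_nonneg (by linarith) hl') hm']
        have e1 : (1 - (l * v + l * w)) * (1 / l) + 1 / m = 1 - v - w := by
          have : (1 - (l * v + l * w)) * (1 / l) = 1 / l - v - w := by field_simp; ring
          linarith
        have e2 : (1 - l * u) * (1 / l) + 1 / m = 1 - u := by
          have : (1 - l * u) * (1 / l) = 1 / l - u := by field_simp
          linarith
        rw [e1, e2]
    _ = _ := by
        have e1 : IW ^ w = (A * 2 ^ n) ^ w * T ^ (n * w) := by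
          rw [hIW, ENNReal.mul_rpow_of_nonneg 2 T (Nat.cast_nonneg n), ENNReal.rpow_natCast 2,
            ← mul_assoc, ENNReal.mul_rpow_of_nonneg _ _ hw0.le, ← ENNReal.rpow_mul]
        have e2 : E₁ ^ (1 - v - w) = R ^ (n * (1 - v - w)) * V₁ ^ (1 - v - w) := by
          rw [hv1, ENNReal.mul_rpow_of_nonneg _ _ hvw', ← ENNReal.rpow_mul]
        have e3 : E₂ ^ (1 - u) = T ^ (n * (1 - u)) * V₁ ^ (1 - u) := by
          rw [hv2, ENNReal.mul_rpow_of_nonneg _ _ hu', ← ENNReal.rpow_mul]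
        have e4 : T ^ (n * (1 - u + w)) = T ^ (n * (1 - u)) * T ^ (n * w) := by
          rw [← ENNReal.rpow_add _ _ hT0 hTt, mul_add]
        rw [e1, e2, e3, e4, hC₀]
        ring

end Far

end VanishingMorrey

namespace VanishingMorrey

open MeasureTheory Filter Topology Set
open scoped ENNReal NNReal

/-! ### Duality -/

section Duality

/-- The extremal test function is h^{q-1}. It is truncated at height N, so that on a finite measure
space the integral is finite and may be divided out; then N → ∞ by monotone convergence. -/
theorem lintegral_rpow_le_of_forall_lintegral_mul_le {X : Type*} [MeasurableSpace X]
    {μ : Measure X} [IsFiniteMeasure μ] {h : X → ℝ≥0∞} (hh : Measurable h) {q q' : ℝ}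
    (hq : q.HolderConjugate q') {M : ℝ≥0∞}
    (H : ∀ g : X → ℝ≥0∞, Measurable g →
      ∫⁻ x, g x * h x ∂μ ≤ M * (∫⁻ x, g x ^ q' ∂μ) ^ (1 / q')) :
    (∫⁻ x, h x ^ q ∂μ) ^ (1 / q) ≤ M := by
  have hq0 : 0 < q := hq.pos
  have hq1 : 1 < q := hq.lt
  have hq'0 : 0 < q' := hq.symm.pos
  have hN : ∀ N : ℕ, ∫⁻ x, min (h x) N ^ q ∂μ ≤ M ^ q := by
    intro N
    set I := ∫⁻ x, min (h x) N ^ q ∂μ with hI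
    have hm : Measurable fun x => min (h x) (N : ℝ≥0∞) := hh.min measurable_const
    have hIt : I ≠ ∞ := by
      have h1 : I ≤ ∫⁻ _, (N : ℝ≥0∞) ^ q ∂μ := by
        refine lintegral_mono fun x => ?_
        gcongr
        exact min_le_right _ _
      refine ne_top_of_le_ne_top ?_ h1
      rw [lintegral_const]
      exact ENNReal.mul_ne_top (ENNReal.rpow_ne_top_of_nonneg hq0.le (ENNReal.natCast_ne_top N))
        (measure_ne_top μ _)
    have h2 : I ≤ M * I ^ (1 / q') := by
      have h3 := H (fun x => min (h x) (N : ℝ≥0∞) ^ (q - 1)) (hm.pow_const _)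
      have h4 : ∀ x, (min (h x) (N : ℝ≥0∞) ^ (q - 1)) ^ q' = min (h x) (N : ℝ≥0∞) ^ q := by
        intro x
        rw [← ENNReal.rpow_mul, hq.sub_one_mul_conj]
      simp_rw [h4] at h3
      refine le_trans (lintegral_mono fun x => ?_) h3
      calc min (h x) (N : ℝ≥0∞) ^ q = min (h x) (N : ℝ≥0∞) ^ (q - 1) * min (h x) (N : ℝ≥0∞) := by
            conv_rhs => rw [← ENNReal.rpow_one (min (h x) (N : ℝ≥0∞)), ← ENNReal.rpow_mul,
              ← ENNReal.rpow_add_of_nonneg _ _ (by linarith) zero_le_one]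
            congr 1; ring
        _ ≤ _ := by gcongr; exact min_le_left _ _
    rcases eq_or_ne I 0 with h0 | h0
    · rw [h0]; exact zero_le
    have hqq : 1 / q + 1 / q' = 1 := by simpa [one_div] using hq.inv_add_inv_eq_one
    have h5 : I = I ^ (1 / q) * I ^ (1 / q') := by
      rw [← ENNReal.rpow_add _ _ h0 hIt, hqq, ENNReal.rpow_one]
    have h6 : I ^ (1 / q) ≤ M := by
      have h7 : I ^ (1 / q') ≠ 0 := by
        simp [ENNReal.rpow_eq_zero_iff, h0, hIt]
      have h8 : I ^ (1 / q') ≠ ∞ := ENNReal.rpow_ne_top_of_nonneg (by positivity) hIt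
      rw [← ENNReal.mul_le_mul_iff_left h7 h8, ← h5]
      exact h2
    calc I = (I ^ (1 / q)) ^ q := by
          rw [← ENNReal.rpow_mul, one_div_mul_cancel hq0.ne', ENNReal.rpow_one]
      _ ≤ M ^ q := by gcongr
  have hlim : Tendsto (fun N : ℕ => ∫⁻ x, min (h x) N ^ q ∂μ) atTop (𝓝 (∫⁻ x, h x ^ q ∂μ)) := by
    refine lintegral_tendsto_of_tendsto_of_monotone
      (fun N => ((hh.min measurable_const).pow_const q).aemeasurable) ?_ ?_
    · refine Eventually.of_forall fun x i j hij => ?_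
      have : (i : ℝ≥0∞) ≤ j := by exact_mod_cast hij
      simp only
      gcongr
    · refine Eventually.of_forall fun x => ?_
      refine (ENNReal.continuous_rpow_const.tendsto _).comp ?_
      have := (tendsto_const_nhds (x := h x)).min ENNReal.tendsto_nat_nhds_top
      simpa using this
  have hfin := le_of_tendsto' hlim hN
  calc _ ≤ (M ^ q) ^ (1 / q) := by gcongr
    _ = M := by rw [← ENNReal.rpow_mul, mul_one_div_cancel hq0.ne', ENNReal.rpow_one]

end Duality

/-! ### The dominating positive operator and its local estimate -/

section PositiveOperator

variable {n : ℕ} {𝕜 : Type*} [RCLike 𝕜] {b : Rn n → 𝕜}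

/-- The kernel `∫_{|z|}^∞ ρ^{-γ-1} dρ`, which is `|z|^{-γ} / γ` for `z ≠ 0`. -/
noncomputable def rieszKernel (γ : ℝ) (z : Rn n) : ℝ≥0∞ :=
  ∫⁻ ρ in Ioi ‖z‖, ENNReal.ofReal (ρ ^ (-γ - 1))

theorem rieszKernel_eq {γ : ℝ} (hγ : 0 < γ) {z : Rn n} (hz : z ≠ 0) :
    rieszKernel γ z = ENNReal.ofReal (‖z‖ ^ (-γ) / γ) :=
  lintegral_Ioi_rpow hγ (norm_pos_iff.2 hz)

theorem rieszKernel_eq_lintegral (γ : ℝ) (z : Rn n) :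
    rieszKernel γ z = ∫⁻ ρ in Ioi (0 : ℝ), (Ioi ‖z‖).indicator
      (fun ρ => ENNReal.ofReal (ρ ^ (-γ - 1))) ρ := by
  rw [setLIntegral_indicator measurableSet_Ioi,
    inter_eq_left.2 (Ioi_subset_Ioi (norm_nonneg z)), rieszKernel]

theorem measurable_rieszKernel (γ : ℝ) : Measurable (rieszKernel (n := n) γ) := by
  have : ∀ z : Rn n, rieszKernel γ z = ∫⁻ ρ, {p : Rn n × ℝ | ‖p.1‖ < p.2}.indicator
      (fun p => ENNReal.ofReal (p.2 ^ (-γ - 1))) (z, ρ) := by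
    intro z
    rw [rieszKernel, ← lintegral_indicator measurableSet_Ioi]
    rfl
  rw [show rieszKernel (n := n) γ = fun z => _ from funext this]
  exact Measurable.lintegral_prod_right'
    (Measurable.indicator (by fun_prop) (measurableSet_lt (by fun_prop) (by fun_prop)))

theorem rieszKernel_le {γ : ℝ} (hγ : 0 < γ) {z : Rn n} {d : ℝ} (hd : 0 < d) (h : d / 2 ≤ ‖z‖) :
    rieszKernel γ z ≤ ENNReal.ofReal (2 ^ γ) * ∫⁻ t in Ioi d, ENNReal.ofReal (t ^ (-γ - 1)) := by
  calc rieszKernel γ z ≤ ∫⁻ t in Ioi (d / 2), ENNReal.ofReal (t ^ (-γ - 1)) :=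
        lintegral_mono_set (Ioi_subset_Ioi h)
    _ = _ := by
        rw [lintegral_Ioi_rpow hγ (half_pos hd), lintegral_Ioi_rpow hγ hd,
          ← ENNReal.ofReal_mul (by positivity)]
        congr 1
        rw [Real.div_rpow hd.le two_pos.le, Real.rpow_neg two_pos.le]
        field_simp

/-- The positive integral operator dominating all operators considered here. -/
noncomputable def posOp (b : Rn n → 𝕜) (W : Rn n → ℝ≥0∞) (γ : ℝ) (f : Rn n → ℝ≥0∞) (x : Rn n) :
    ℝ≥0∞ :=
  ∫⁻ y, W (x - y) * oscWeight b x y * f y * rieszKernel γ (x - y)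

theorem measurable_posOp_integrand (hbm : StronglyMeasurable b) {W f : Rn n → ℝ≥0∞}
    (hW : Measurable W) (hf : Measurable f) (γ : ℝ) :
    Measurable fun q : Rn n × Rn n =>
      W (q.1 - q.2) * oscWeight b q.1 q.2 * f q.2 * rieszKernel γ (q.1 - q.2) := by
  have hsub : Measurable fun q : Rn n × Rn n => q.1 - q.2 := measurable_fst.sub measurable_snd
  exact (((hW.comp hsub).mul (measurable_oscWeight hbm)).mul (hf.comp measurable_snd)).mul
    ((measurable_rieszKernel γ).comp hsub)

theorem measurable_posOp (hbm : StronglyMeasurable b) {W f : Rn n → ℝ≥0∞}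
    (hW : Measurable W) (hf : Measurable f) (γ : ℝ) : Measurable (posOp b W γ f) :=
  (measurable_posOp_integrand hbm hW hf γ).lintegral_prod_right'

theorem mul_posOp_eq (hbm : StronglyMeasurable b) {W f : Rn n → ℝ≥0∞} (g : Rn n → ℝ≥0∞)
    (hW : Measurable W) (hf : Measurable f) (γ : ℝ) (x : Rn n) :
    g x * posOp b W γ f x = ∫⁻ y, pairing b W f g x y * rieszKernel γ (x - y) := by
  have hm : Measurable fun y => W (x - y) * oscWeight b x y * f y * rieszKernel γ (x - y) :=
    (measurable_posOp_integrand hbm hW hf γ).comp measurable_prodMk_left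
  rw [posOp, ← lintegral_const_mul _ hm]
  refine lintegral_congr fun y => ?_
  rw [pairing]; ring

/-- Tonelli applied to the layer representation of the kernel: the scale ρ sees exactly the pairs
with |x-y| < ρ. -/
theorem lintegral_mul_posOp (hbm : StronglyMeasurable b) {W f g : Rn n → ℝ≥0∞}
    (hW : Measurable W) (hf : Measurable f) (hg : Measurable g) (γ : ℝ) :
    ∫⁻ x, g x * posOp b W γ f x
      = ∫⁻ ρ in Ioi (0 : ℝ), ENNReal.ofReal (ρ ^ (-γ - 1)) * truncForm b W ρ f g := by
  have hm : Measurable fun q : (ℝ × Rn n) × Rn n => ENNReal.ofReal (q.1.1 ^ (-γ - 1)) *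
      pairing b ((Metric.ball 0 q.1.1).indicator W) f g q.1.2 q.2 :=
    (by fun_prop : Measurable fun q : (ℝ × Rn n) × Rn n => ENNReal.ofReal (q.1.1 ^ (-γ - 1))).mul
      (measurable_truncPairing hbm hW (h₁ := fun _ => f) (h₂ := fun _ => g)
        (hf.comp measurable_snd) (hg.comp measurable_snd))
  have hpt : ∀ x y, pairing b W f g x y * rieszKernel γ (x - y)
      = ∫⁻ ρ in Ioi (0 : ℝ), ENNReal.ofReal (ρ ^ (-γ - 1))
        * pairing b ((Metric.ball 0 ρ).indicator W) f g x y := by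
    intro x y
    rw [rieszKernel_eq_lintegral, ← lintegral_const_mul _
      ((show Measurable fun ρ : ℝ => ENNReal.ofReal (ρ ^ (-γ - 1)) by fun_prop).indicator
        measurableSet_Ioi)]
    refine lintegral_congr fun ρ => ?_
    by_cases h : ‖x - y‖ < ρ
    · rw [indicator_of_mem (by exact h), pairing, pairing,
        indicator_of_mem (mem_ball_zero_iff.2 h)]
      ring
    · rw [indicator_of_notMem (by exact h), pairing, pairing,
        indicator_of_notMem (fun h' => h (mem_ball_zero_iff.1 h'))]
      simp
  simp_rw [mul_posOp_eq hbm g hW hf γ, hpt]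
  have hswap : ∀ x, ∫⁻ y, ∫⁻ ρ in Ioi (0 : ℝ), ENNReal.ofReal (ρ ^ (-γ - 1))
        * pairing b ((Metric.ball 0 ρ).indicator W) f g x y
      = ∫⁻ ρ in Ioi (0 : ℝ), ∫⁻ y, ENNReal.ofReal (ρ ^ (-γ - 1))
        * pairing b ((Metric.ball 0 ρ).indicator W) f g x y := by
    intro x
    refine lintegral_lintegral_swap (Measurable.aemeasurable ?_)
    exact hm.comp ((measurable_snd.prodMk measurable_const).prodMk measurable_fst)
  simp_rw [hswap]
  rw [lintegral_lintegral_swap]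
  · refine lintegral_congr fun ρ => ?_
    rw [truncForm, ← lintegral_const_mul' _ _ ENNReal.ofReal_ne_top]
    refine lintegral_congr fun x => ?_
    rw [← lintegral_const_mul' _ _ ENNReal.ofReal_ne_top]
  · exact (hm.lintegral_prod_right'.comp measurable_swap).aemeasurable

/-- For x ∈ B(x₀,r) and y outside B(x₀,2r) one has |x-y| ≥ |y-x₀|/2, so the layers may start at
|y-x₀| at the cost of 2^γ. The layer t then contains y exactly when y ∈ B(x₀,t), and t > 2r
automatically. -/
theorem setLIntegral_mul_posOp_compl_le (hbm : StronglyMeasurable b) {W f g : Rn n → ℝ≥0∞}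
    (hW : Measurable W) (hf : Measurable f) (hg : Measurable g) {γ : ℝ} (hγ : 0 < γ) (x₀ : Rn n)
    {r : ℝ} (hr : 0 < r) :
    ∫⁻ x in Metric.ball x₀ r, g x * posOp b W γ ((Metric.ball x₀ (2 * r))ᶜ.indicator f) x
      ≤ ENNReal.ofReal (2 ^ γ) * ∫⁻ t in Ioi (2 * r), ENNReal.ofReal (t ^ (-γ - 1))
        * ballForm b W x₀ r t f g := by
  have hpm := measurable_pairing hbm hW hf hg
  set Ψ : ℝ → Rn n → Rn n → ℝ≥0∞ := fun t x y => ENNReal.ofReal (t ^ (-γ - 1))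
    * (Metric.ball x₀ t).indicator (fun y => pairing b W f g x y) y with hΨ
  have hΨm : Measurable fun q : (ℝ × Rn n) × Rn n => Ψ q.1.1 q.1.2 q.2 := by
    have h1 : ∀ q : (ℝ × Rn n) × Rn n, (Metric.ball x₀ q.1.1).indicator
        (fun y => pairing b W f g q.1.2 y) q.2
        = {q : (ℝ × Rn n) × Rn n | dist q.2 x₀ < q.1.1}.indicator
          (fun q => pairing b W f g q.1.2 q.2) q := fun q => rfl
    have h2 : Measurable fun q : (ℝ × Rn n) × Rn n => (Metric.ball x₀ q.1.1).indicator
        (fun y => pairing b W f g q.1.2 y) q.2 := by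
      simp_rw [h1]
      refine Measurable.indicator ?_ (measurableSet_lt (by fun_prop) (by fun_prop))
      exact hpm.comp ((measurable_snd.comp measurable_fst).prodMk measurable_snd)
    exact (by fun_prop : Measurable fun q : (ℝ × Rn n) × Rn n =>
      ENNReal.ofReal (q.1.1 ^ (-γ - 1))).mul h2
  have hfm : Measurable ((Metric.ball x₀ (2 * r))ᶜ.indicator f) :=
    hf.indicator measurableSet_ball.compl
  have hpt : ∀ x ∈ Metric.ball x₀ r, g x * posOp b W γ ((Metric.ball x₀ (2 * r))ᶜ.indicator f) x
      ≤ ENNReal.ofReal (2 ^ γ) * ∫⁻ t in Ioi (2 * r), ∫⁻ y, Ψ t x y := by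
    intro x hx
    rw [mul_posOp_eq hbm g hW hfm γ, lintegral_lintegral_swap (f := fun t y => Ψ t x y)
      (Measurable.aemeasurable
        (hΨm.comp ((measurable_fst.prodMk measurable_const).prodMk measurable_snd))),
      ← lintegral_const_mul' _ _ ENNReal.ofReal_ne_top]
    refine lintegral_mono fun y => ?_
    by_cases hy : y ∈ Metric.ball x₀ (2 * r)
    · rw [pairing, indicator_of_notMem (notMem_compl_iff.2 hy)]; simp
    · rw [Metric.mem_ball, not_lt] at hy
      rw [Metric.mem_ball] at hx
      have hd : 0 < dist y x₀ := by linarith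
      have h1 : dist y x₀ / 2 ≤ ‖x - y‖ := by
        rw [← dist_eq_norm]
        linarith [dist_triangle_left y x₀ x, dist_comm x y]
      have h2 : pairing b W ((Metric.ball x₀ (2 * r))ᶜ.indicator f) g x y
          = pairing b W f g x y := by
        rw [pairing, pairing, indicator_of_mem]
        simpa using hy
      rw [h2]
      calc _ ≤ pairing b W f g x y * (ENNReal.ofReal (2 ^ γ)
            * ∫⁻ t in Ioi (dist y x₀), ENNReal.ofReal (t ^ (-γ - 1))) := by
            gcongr; exact rieszKernel_le hγ hd h1
        _ = ENNReal.ofReal (2 ^ γ) * ∫⁻ t in Ioi (dist y x₀), Ψ t x y := by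
            rw [mul_left_comm, ← lintegral_const_mul _ (by fun_prop)]
            congr 1
            refine setLIntegral_congr_fun measurableSet_Ioi fun t ht => ?_
            simp only [hΨ]
            rw [indicator_of_mem (by exact ht), mul_comm]
        _ ≤ _ := by
            gcongr
  refine (setLIntegral_mono' measurableSet_ball hpt).trans (le_of_eq ?_)
  rw [lintegral_const_mul' _ _ ENNReal.ofReal_ne_top, lintegral_lintegral_swap]
  · congr 1
    refine lintegral_congr fun t => ?_
    rw [ballForm, ← lintegral_const_mul' _ _ ENNReal.ofReal_ne_top]
    refine lintegral_congr fun x => ?_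
    rw [lintegral_const_mul' _ _ ENNReal.ofReal_ne_top, lintegral_indicator measurableSet_ball]
  · exact (hΨm.lintegral_prod_right'.comp measurable_swap).aemeasurable

theorem posOp_eq_add (hbm : StronglyMeasurable b) {W f : Rn n → ℝ≥0∞}
    (hW : Measurable W) (hf : Measurable f) (γ : ℝ) {E : Set (Rn n)} (hE : MeasurableSet E)
    (x : Rn n) :
    posOp b W γ f x = posOp b W γ (E.indicator f) x + posOp b W γ (Eᶜ.indicator f) x := by
  have hm : Measurable fun y =>
      W (x - y) * oscWeight b x y * E.indicator f y * rieszKernel γ (x - y) :=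
    (measurable_posOp_integrand hbm hW (hf.indicator hE) γ).comp measurable_prodMk_left
  rw [posOp, posOp, posOp, ← lintegral_add_left hm]
  refine lintegral_congr fun y => ?_
  rw [← add_mul, ← mul_add, ← Pi.add_apply, indicator_self_add_compl]

/-- By duality it suffices to pair with g on B(x₀,r). The part of f in B(x₀,2r) is handled by
`hglob`, the rest by `hfar` integrated over t. -/
theorem exists_local_bound (hbm : StronglyMeasurable b) {W : Rn n → ℝ≥0∞} (hW : Measurable W)
    {γ κ p q q' : ℝ} (hγ : 0 < γ) (hκ : 0 < κ) (hp : 0 < p) (hq : q.HolderConjugate q')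
    {C₁ C₂ : ℝ≥0}
    (hglob : ∀ f g : Rn n → ℝ≥0∞, Measurable f → Measurable g →
      ∫⁻ ρ in Ioi (0 : ℝ), ENNReal.ofReal (ρ ^ (-γ - 1)) * truncForm b W ρ f g
        ≤ C₁ * ((∫⁻ y, f y ^ p) ^ (1 / p) * (∫⁻ x, g x ^ q') ^ (1 / q')))
    (hfar : ∀ (x₀ : Rn n) (r t : ℝ) (f g : Rn n → ℝ≥0∞), 0 < r → 2 * r ≤ t →
      Measurable f → Measurable g →
      ballForm b W x₀ r t f g
        ≤ C₂ * ENNReal.ofReal (1 + Real.log (t / r))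
          * (ENNReal.ofReal r ^ κ * ENNReal.ofReal t ^ (γ - κ))
          * ((∫⁻ y in Metric.ball x₀ t, f y ^ p) ^ (1 / p)
            * (∫⁻ x in Metric.ball x₀ r, g x ^ q') ^ (1 / q'))) :
    ∃ C : ℝ≥0, ∀ (x₀ : Rn n) (r : ℝ) (f : Rn n → ℝ≥0∞), 0 < r → Measurable f →
      (∫⁻ x in Metric.ball x₀ r, posOp b W γ f x ^ q) ^ (1 / q)
        ≤ C * ENNReal.ofReal r ^ κ * ∫⁻ t in Ioi r,
          ENNReal.ofReal ((1 + Real.log (t / r)) / t ^ (κ + 1))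
            * (∫⁻ y in Metric.ball x₀ t, f y ^ p) ^ (1 / p) := by
  refine ⟨C₁ * (κ * 2 ^ κ).toNNReal + ((2 : ℝ) ^ γ).toNNReal * C₂, fun x₀ r f hr hf => ?_⟩
  have hq'0 : 0 < q' := hq.symm.pos
  set R := ENNReal.ofReal r with hR
  set Ψ : ℝ → ℝ≥0∞ := fun t => (∫⁻ y in Metric.ball x₀ t, f y ^ p) ^ (1 / p) with hΨ
  set J := ∫⁻ t in Ioi r, ENNReal.ofReal ((1 + Real.log (t / r)) / t ^ (κ + 1)) * Ψ t with hJ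
  have hfin : IsFiniteMeasure (volume.restrict (Metric.ball x₀ r)) :=
    ⟨by simpa using measure_ball_lt_top⟩
  refine lintegral_rpow_le_of_forall_lintegral_mul_le (measurable_posOp hbm hW hf γ) hq
    fun g hg => ?_
  set IG := (∫⁻ x in Metric.ball x₀ r, g x ^ q') ^ (1 / q') with hIG
  have hsub : Ioi (2 * r) ⊆ Ioi r := Ioi_subset_Ioi (by linarith)
  -- Ψ is monotone and ∫_{2r}^∞ t^{-κ-1} dt = (2r)^{-κ}/κ, so the near term is absorbed in the tail
  -- integral; this is where κ > 0 matters.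
  have hnear : Ψ (2 * r) ≤ ENNReal.ofReal (κ * 2 ^ κ) * R ^ κ * J := by
    have h1 : ENNReal.ofReal ((2 * r) ^ (-κ) / κ) * Ψ (2 * r) ≤ J := by
      rw [← lintegral_Ioi_rpow hκ (by positivity : 0 < 2 * r),
        ← lintegral_mul_const _ (by fun_prop)]
      refine le_trans ?_ (lintegral_mono_set hsub)
      refine setLIntegral_mono' measurableSet_Ioi fun t ht => ?_
      rw [mem_Ioi] at ht
      have ht0 : 0 < t := by linarith
      have hlog : 0 ≤ Real.log (t / r) := Real.log_nonneg ((one_le_div hr).2 (by linarith))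
      refine mul_le_mul' (ENNReal.ofReal_le_ofReal ?_) ?_
      · have : t ^ (-κ - 1) = 1 / t ^ (κ + 1) := by
          rw [one_div, ← Real.rpow_neg ht0.le]; congr 1; ring
        rw [this]
        gcongr
        linarith
      · have : 0 ≤ 1 / p := by positivity
        simp only [hΨ]
        gcongr
    calc Ψ (2 * r) = ENNReal.ofReal (κ * 2 ^ κ) * R ^ κ
          * (ENNReal.ofReal ((2 * r) ^ (-κ) / κ) * Ψ (2 * r)) := by
          rw [hR, ENNReal.ofReal_rpow_of_pos hr, ← mul_assoc,
            ← ENNReal.ofReal_mul (by positivity), ← ENNReal.ofReal_mul (by positivity)]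
          have : κ * 2 ^ κ * r ^ κ * ((2 * r) ^ (-κ) / κ) = 1 := by
            rw [Real.rpow_neg (by positivity), Real.mul_rpow two_pos.le hr.le]
            field_simp
          rw [this, ENNReal.ofReal_one, one_mul]
      _ ≤ _ := by gcongr
  have hN : ∫⁻ x in Metric.ball x₀ r, g x * posOp b W γ ((Metric.ball x₀ (2 * r)).indicator f) x
      ≤ C₁ * (Ψ (2 * r) * IG) := by
    have h1 := hglob ((Metric.ball x₀ (2 * r)).indicator f) ((Metric.ball x₀ r).indicator g)
      (hf.indicator measurableSet_ball) (hg.indicator measurableSet_ball)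
    rw [← lintegral_mul_posOp hbm hW (hf.indicator measurableSet_ball)
      (hg.indicator measurableSet_ball), lintegral_indicator_rpow measurableSet_ball f hp,
      lintegral_indicator_rpow measurableSet_ball g hq'0] at h1
    refine le_trans (le_of_eq ?_) h1
    rw [← lintegral_indicator measurableSet_ball]
    refine lintegral_congr fun x => ?_
    by_cases hx : x ∈ Metric.ball x₀ r
    · rw [indicator_of_mem hx, indicator_of_mem hx]
    · rw [indicator_of_notMem hx, indicator_of_notMem hx, zero_mul]
  have hF : ∫⁻ x in Metric.ball x₀ r, g x * posOp b W γ ((Metric.ball x₀ (2 * r))ᶜ.indicator f) x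
      ≤ ENNReal.ofReal (2 ^ γ) * (C₂ * R ^ κ * J * IG) := by
    refine (setLIntegral_mul_posOp_compl_le hbm hW hf hg hγ x₀ hr).trans ?_
    gcongr
    calc _ ≤ ∫⁻ t in Ioi (2 * r), (C₂ * R ^ κ * IG) *
          (ENNReal.ofReal ((1 + Real.log (t / r)) / t ^ (κ + 1)) * Ψ t) := by
          refine setLIntegral_mono' measurableSet_Ioi fun t ht => ?_
          rw [mem_Ioi] at ht
          have ht0 : 0 < t := by linarith
          have hlog : 0 ≤ Real.log (t / r) := Real.log_nonneg ((one_le_div hr).2 (by linarith))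
          refine (mul_le_mul' le_rfl (hfar x₀ r t f g hr ht.le hf hg)).trans (le_of_eq ?_)
          have e : ENNReal.ofReal ((1 + Real.log (t / r)) / t ^ (κ + 1))
              = ENNReal.ofReal (t ^ (-γ - 1)) * ENNReal.ofReal (1 + Real.log (t / r))
                * ENNReal.ofReal t ^ (γ - κ) := by
            rw [ENNReal.ofReal_rpow_of_pos ht0, ← ENNReal.ofReal_mul (by positivity),
              ← ENNReal.ofReal_mul (by positivity)]
            congr 1
            rw [div_eq_mul_inv, ← Real.rpow_neg ht0.le, mul_right_comm, ← Real.rpow_add ht0,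
              mul_comm]
            congr 2; ring
          rw [e]; ring
      _ ≤ (C₂ * R ^ κ * IG) * J := by
          rw [hJ]
          refine le_trans (lintegral_mono_set hsub) ?_
          have hΨm : Monotone Ψ := fun t t' h => ENNReal.rpow_le_rpow
            (lintegral_mono_set (Metric.ball_subset_ball h)) (by positivity)
          have hm : Measurable fun t =>
              ENNReal.ofReal ((1 + Real.log (t / r)) / t ^ (κ + 1)) * Ψ t :=
            (by fun_prop : Measurable fun t : ℝ =>
              ENNReal.ofReal ((1 + Real.log (t / r)) / t ^ (κ + 1))).mul hΨm.measurable
          rw [lintegral_const_mul _ hm]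
      _ = _ := by ring
  have hm1 : Measurable fun x => g x * posOp b W γ ((Metric.ball x₀ (2 * r)).indicator f) x :=
    hg.mul (measurable_posOp hbm hW (hf.indicator measurableSet_ball) γ)
  simp_rw [posOp_eq_add hbm hW hf γ (measurableSet_ball (x := x₀) (ε := 2 * r)), mul_add]
  rw [lintegral_add_left hm1]
  calc _ ≤ C₁ * (ENNReal.ofReal (κ * 2 ^ κ) * R ^ κ * J * IG)
        + ENNReal.ofReal (2 ^ γ) * (C₂ * R ^ κ * J * IG) := by
        refine add_le_add (hN.trans ?_) hF
        gcongr
    _ = _ := by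
        push_cast
        rw [ENNReal.ofReal, ENNReal.ofReal]
        ring

end PositiveOperator

end VanishingMorrey

namespace VanishingMorrey

open MeasureTheory Filter Topology Set
open scoped ENNReal NNReal

/-! ### From the sphere to balls -/

section PolarCoordinates

variable {n : ℕ} {𝕜 : Type*} [RCLike 𝕜] {Ω : Rn n → 𝕜}

theorem IsHomogeneousZero.apply_coe {𝕜 : Type*} {Ω : Rn n → 𝕜} (h : IsHomogeneousZero Ω) (x : ({0}ᶜ : Set (Rn n))) :
    Ω x = Ω (homeomorphUnitSphereProd (Rn n) x).1 := by
  have hx : (x : Rn n) ≠ 0 := x.2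
  rw [homeomorphUnitSphereProd_apply_fst_coe, h _ (inv_pos.2 (norm_pos_iff.2 hx))]

/-- In polar coordinates Ω depends only on the angular variable; the origin is a null set. -/
theorem aestronglyMeasurable_of_sphere (h : IsHomogeneousZero Ω)
    (hΩ : AEStronglyMeasurable (fun u : Metric.sphere (0 : Rn n) 1 => Ω u)
      (volume : Measure (Rn n)).toSphere) (hn : 0 < n) :
    AEStronglyMeasurable Ω (volume : Measure (Rn n)) := by
  have : Nonempty (Fin n) := ⟨⟨0, hn⟩⟩
  have he := (volume : Measure (Rn n)).measurePreserving_homeomorphUnitSphereProd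
  have h1 := hΩ.comp_quasiMeasurePreserving
    (Measure.quasiMeasurePreserving_fst.comp he.quasiMeasurePreserving)
  have h2 : AEStronglyMeasurable (Ω ∘ ((↑) : ({0}ᶜ : Set (Rn n)) → Rn n))
      (Measure.comap (↑) (volume : Measure (Rn n))) :=
    h1.congr (Eventually.of_forall fun x => (h.apply_coe x).symm)
  rw [← (MeasurableEmbedding.subtype_coe
      (measurableSet_singleton (0 : Rn n)).compl).aestronglyMeasurable_map_iff,
    map_comap_subtype_coe (measurableSet_singleton _).compl, restrict_compl_singleton] at h2
  exact h2

/-- In polar coordinates the integral is the sphere integral times R^n / n. -/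
theorem exists_setLIntegral_ball_le_of_sphere (h : IsHomogeneousZero Ω)
    {c : ℝ} (hc : 0 < c) (hΩ : MemLpSphere Ω (ENNReal.ofReal c)) (hn : 0 < n) :
    ∃ A : ℝ≥0, ∀ R : ℝ, 0 < R →
      ∫⁻ z in Metric.ball (0 : Rn n) R, ‖Ω z‖ₑ ^ c ≤ A * ENNReal.ofReal R ^ (n : ℝ) := by
  have : Nonempty (Fin n) := ⟨⟨0, hn⟩⟩
  have he := (volume : Measure (Rn n)).measurePreserving_homeomorphUnitSphereProd
  set σ := (volume : Measure (Rn n)).toSphere with hσ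
  set I := ∫⁻ u : Metric.sphere (0 : Rn n) 1, ‖Ω u‖ₑ ^ c ∂σ with hI
  have hIt : I ≠ ∞ := by
    have := lintegral_rpow_enorm_lt_top_of_eLpNorm_lt_top (by simpa using hc)
      ENNReal.ofReal_ne_top hΩ.2
    rw [ENNReal.toReal_ofReal hc.le] at this
    exact this.ne
  lift I to ℝ≥0 using hIt with I'
  refine ⟨I', fun R hR => ?_⟩
  have hm : AEMeasurable (fun u : Metric.sphere (0 : Rn n) 1 => ‖Ω u‖ₑ ^ c) σ :=
    hΩ.1.enorm.pow_const c
  calc ∫⁻ z in Metric.ball (0 : Rn n) R, ‖Ω z‖ₑ ^ c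
      = ∫⁻ z, (Metric.ball (0 : Rn n) R).indicator (fun z => ‖Ω z‖ₑ ^ c) z := by
        rw [lintegral_indicator measurableSet_ball]
    _ = ∫⁻ z : ({0}ᶜ : Set (Rn n)), (Metric.ball (0 : Rn n) R).indicator
          (fun z => ‖Ω z‖ₑ ^ c) (z : Rn n)
          ∂(Measure.comap Subtype.val volume) := by
        rw [lintegral_subtype_comap (measurableSet_singleton _).compl
          (fun z => (Metric.ball (0 : Rn n) R).indicator (fun z => ‖Ω z‖ₑ ^ c) z),
          restrict_compl_singleton]
    _ = ∫⁻ z : Metric.sphere (0 : Rn n) 1 × Ioi (0 : ℝ), ‖Ω z.1‖ₑ ^ c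
          * (Iio (⟨R, hR⟩ : Ioi (0 : ℝ))).indicator 1 z.2
          ∂(σ.prod (Measure.volumeIoiPow (Module.finrank ℝ (Rn n) - 1))) := by
        rw [← he.lintegral_comp_emb (Homeomorph.measurableEmbedding _)]
        refine lintegral_congr fun x => ?_
        have h1 : (homeomorphUnitSphereProd (Rn n) x).2 ∈ Iio (⟨R, hR⟩ : Ioi (0 : ℝ))
            ↔ (x : Rn n) ∈ Metric.ball (0 : Rn n) R := by
          rw [mem_Iio, ← Subtype.coe_lt_coe, homeomorphUnitSphereProd_apply_snd_coe,
            mem_ball_zero_iff]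
        by_cases hx : (x : Rn n) ∈ Metric.ball (0 : Rn n) R
        · rw [indicator_of_mem hx, indicator_of_mem (h1.2 hx), h.apply_coe]; simp
        · rw [indicator_of_notMem hx, indicator_of_notMem (fun h' => hx (h1.1 h'))]; simp
    _ = I' * ENNReal.ofReal (R ^ n / n) := by
        rw [lintegral_prod_mul hm
          ((measurable_one.indicator measurableSet_Iio).aemeasurable),
          lintegral_indicator_one measurableSet_Iio, Measure.volumeIoiPow_apply_Iio, ← hI,
          finrank_euclideanSpace_fin, Nat.sub_add_cancel hn, Nat.cast_pred hn, sub_add_cancel]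
    _ ≤ _ := by
        rw [ENNReal.ofReal_rpow_of_pos hR, Real.rpow_natCast]
        gcongr
        exact div_le_self (by positivity) (by exact_mod_cast hn)

theorem exists_growthLE (h : IsHomogeneousZero Ω) {s : ℝ≥0∞} (hΩ : MemLpSphere Ω s)
    {c : ℝ} (hc : 0 < c) (hcs : ENNReal.ofReal c ≤ s) (hn : 0 < n) {W : Rn n → ℝ≥0∞}
    (hW : W =ᵐ[volume] fun z => ‖Ω z‖ₑ) : ∃ A : ℝ≥0, GrowthLE W c A := by
  obtain ⟨A, hA⟩ := exists_setLIntegral_ball_le_of_sphere h hc (hΩ.mono_exponent hcs) hn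
  refine ⟨A, fun R hR => le_of_eq_of_le ?_ (hA R hR)⟩
  exact lintegral_congr_ae (ae_restrict_of_ae (hW.mono fun z hz => congrArg (· ^ c) hz))

end PolarCoordinates

end VanishingMorrey

namespace VanishingMorrey

open MeasureTheory Filter Topology Set
open scoped ENNReal NNReal

/-! ### The local estimate in the two ranges of s -/

section LocalEstimates

variable {n : ℕ} {𝕜 : Type*} [RCLike 𝕜] {b : Rn n → 𝕜}

/-- The Guliyev type local estimate
`‖T f‖_{L_q(B(x₀,r))} ≤ C r^κ ∫_r^∞ (1 + ln (t/r)) ‖f‖_{L_p(B(x₀,t))} dt / t^{κ+1}`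
for the positive operator `T = posOp b W γ`. -/
def HasLocalBound (b : Rn n → 𝕜) (W : Rn n → ℝ≥0∞) (γ p q κ : ℝ) : Prop :=
  ∃ C : ℝ≥0, ∀ (x₀ : Rn n) (r : ℝ) (f : Rn n → ℝ≥0∞), 0 < r → Measurable f →
    (∫⁻ x in Metric.ball x₀ r, posOp b W γ f x ^ q) ^ (1 / q)
      ≤ C * ENNReal.ofReal r ^ κ * ∫⁻ t in Ioi r,
        ENNReal.ofReal ((1 + Real.log (t / r)) / t ^ (κ + 1))
          * (∫⁻ y in Metric.ball x₀ t, f y ^ p) ^ (1 / p)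

/-- Elementary relations between the exponents of a fractional integral. -/
theorem exponent_relations {n : ℕ} {p q α : ℝ} (hp : 1 < p) (hα : 0 < α) (hαp : α < (n : ℝ) / p)
    (hq : 1 / q = 1 / p - α / n) :
    0 < n ∧ p < q ∧ (n : ℝ) * (1 / q) = n * (1 / p) - α ∧ 0 < n - α := by
  have hp0 : 0 < p := by linarith
  have hn0 : (0 : ℝ) < n := by
    by_contra h
    have : (n : ℝ) / p ≤ 0 := div_nonpos_of_nonpos_of_nonneg (not_lt.1 h) hp0.le
    linarith
  have hαn : α / n < 1 / p := by
    rw [div_lt_div_iff₀ hn0 hp0]; rw [lt_div_iff₀ hp0] at hαp; linarith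
  have hq0 : 0 < q := by
    rw [← one_div_pos, hq]; linarith
  refine ⟨by exact_mod_cast hn0, ?_, ?_, ?_⟩
  · rw [← one_div_lt_one_div hq0 hp0, hq]
    linarith [div_pos hα hn0]
  · rw [hq]; field_simp
  · have : (n : ℝ) / p < n := div_lt_self hn0 hp
    linarith

/-- Take u = 1/p, v = 1/q', w = 1/p'. Then u + v = 1 + α/n > 1 and u + v + w = 1 + 1/q' < 2, so the
global bound applies; u + w = 1 gives the far bound with κ = n(1 - v) = n/q. -/
theorem hasLocalBound_of_growthLE_conj (hbm : StronglyMeasurable b)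
    (hb : LocallyIntegrable b) {N : ℝ≥0} (hN : OscillationLE b N) {W : Rn n → ℝ≥0∞}
    (hW : Measurable W) {p q α : ℝ} {A : ℝ≥0} (hp : 1 < p) (hα : 0 < α) (hαp : α < (n : ℝ) / p)
    (hq : 1 / q = 1 / p - α / n) (hWA : GrowthLE W (p / (p - 1)) A) :
    HasLocalBound b W (n - α) p q (n / q) := by
  obtain ⟨hn, hpq, hnq, hγ⟩ := exponent_relations hp hα hαp hq
  have hn0 : (0 : ℝ) < n := by exact_mod_cast hn
  have hp0 : 0 < p := by linarith
  have hq0 : 0 < q := by linarith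
  have hqq := Real.HolderConjugate.conjExponent (show 1 < q by linarith)
  set q' := q.conjExponent
  have hq'0 : 0 < q' := hqq.symm.pos
  have hqi : 1 / q + 1 / q' = 1 := by simpa [one_div] using hqq.inv_add_inv_eq_one
  have hp1 : 1 / p < 1 := by rw [div_lt_one hp0]; exact hp
  have hαn : 0 < α / n := div_pos hα hn0
  have hiq : 0 < 1 / q := by positivity
  have hip : 0 < 1 / p := by positivity
  have hiq' : 0 < 1 / q' := by positivity
  have hw : 1 / (1 - 1 / p) = p / (p - 1) := by field_simp
  rw [← hw] at hWA
  obtain ⟨C₁, hC₁⟩ := exists_lintegral_truncForm_le (γ := n - α) hbm hb hN hn hW hWA hp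
    hqq.symm.lt (by linarith) (by linarith) (by linarith) (by linarith) (by
      rw [show 2 - 1 / p - 1 / q' = 1 - 1 / p + 1 / q by linarith]; linear_combination -hnq)
  obtain ⟨C₂, hC₂⟩ := exists_ballForm_le_of_conj (v := 1 / q') hbm hb hN hW hWA hip hiq'
    (by linarith) (by linarith) (by linarith)
  refine exists_local_bound hbm hW hγ (by positivity) hp0 hqq hC₁ (C₂ := C₂) ?_
  intro x₀ r t f g hr ht hf hg
  have h := hC₂ x₀ r t f g hr ht hf hg
  rw [one_div_one_div, one_div_one_div, show (n : ℝ) * (1 - 1 / q') = n / q by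
    rw [show 1 - 1 / q' = 1 / q by linarith]; ring,
    show (n : ℝ) * (1 - 1 / p) = n - α - n / q by
      rw [div_eq_mul_one_div (n : ℝ) q]; linear_combination hnq] at h
  exact h

/-- Take u = 1/p, v = 1/q', w = 1/s. From q < s one gets v + w < 1, which serves both the global and
the far bound, and κ = n(1 - v - w). -/
theorem hasLocalBound_of_growthLE (hbm : StronglyMeasurable b)
    (hb : LocallyIntegrable b) {N : ℝ≥0} (hN : OscillationLE b N) {W : Rn n → ℝ≥0∞}
    (hW : Measurable W) {p q α s : ℝ} {A : ℝ≥0} (hp : 1 < p) (hα : 0 < α)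
    (hαp : α < (n : ℝ) / p) (hq : 1 / q = 1 / p - α / n) (hqs : q < s) (hWA : GrowthLE W s A) :
    HasLocalBound b W (n - α) p q (n / q - n * s⁻¹) := by
  obtain ⟨hn, hpq, hnq, hγ⟩ := exponent_relations hp hα hαp hq
  have hn0 : (0 : ℝ) < n := by exact_mod_cast hn
  have hp0 : 0 < p := by linarith
  have hq0 : 0 < q := by linarith
  have hs0 : 0 < s := by linarith
  have hqq := Real.HolderConjugate.conjExponent (show 1 < q by linarith)
  set q' := q.conjExponent
  have hq'0 : 0 < q' := hqq.symm.pos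
  have hqi : 1 / q + 1 / q' = 1 := by simpa [one_div] using hqq.inv_add_inv_eq_one
  have hp1 : 1 / p < 1 := by rw [div_lt_one hp0]; exact hp
  have hαn : 0 < α / n := div_pos hα hn0
  have hiq : 0 < 1 / q := by positivity
  have hip : 0 < 1 / p := by positivity
  have hiq' : 0 < 1 / q' := by positivity
  have his : 0 < 1 / s := by positivity
  have hsq : 1 / s < 1 / q := one_div_lt_one_div_of_lt hq0 hqs
  rw [← one_div_one_div s] at hWA
  obtain ⟨C₁, hC₁⟩ := exists_lintegral_truncForm_le (γ := n - α) hbm hb hN hn hW hWA hp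
    hqq.symm.lt his (by linarith) (by linarith) (by linarith) (by
      rw [show 2 - 1 / p - 1 / q' = 1 - 1 / p + 1 / q by linarith]; linear_combination -hnq)
  obtain ⟨C₂, hC₂⟩ := exists_ballForm_le_of_add_lt_one (v := 1 / q') hbm hb hN hW hWA hip hp1 hiq'
    his (by linarith)
  have hκ : (n : ℝ) * (1 - 1 / q' - 1 / s) = n / q - n * s⁻¹ := by
    rw [show 1 - 1 / q' - 1 / s = 1 / q - 1 / s by linarith]; ring
  refine exists_local_bound hbm hW hγ ?_ hp0 hqq hC₁ (C₂ := C₂) ?_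
  · rw [← hκ]
    exact mul_pos hn0 (by linarith)
  intro x₀ r t f g hr ht hf hg
  have h := hC₂ x₀ r t f g hr ht hf hg
  rw [one_div_one_div, one_div_one_div, hκ,
    show (n : ℝ) * (1 - 1 / p + 1 / s) = n - α - (n / q - n * s⁻¹) by
      rw [div_eq_mul_one_div (n : ℝ) q, ← one_div s]; linear_combination hnq] at h
  exact h

theorem hasLocalBound_of_memLpSphere (hbm : StronglyMeasurable b)
    (hb : LocallyIntegrable b) {N : ℝ≥0} (hN : OscillationLE b N) {Ω : Rn n → 𝕜}
    (hΩ₀ : IsHomogeneousZero Ω) {s : ℝ≥0∞} (hs : 1 < s) (hΩ : MemLpSphere Ω s)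
    {W : Rn n → ℝ≥0∞} (hW : Measurable W) (hWΩ : W =ᵐ[volume] fun z => ‖Ω z‖ₑ) {p q α κ : ℝ}
    (hp : 1 < p) (hα : 0 < α) (hαp : α < (n : ℝ) / p) (hq : 1 / q = 1 / p - α / n)
    (hκ : (ENNReal.conjExponent s ≤ ENNReal.ofReal p ∧ κ = n / q) ∨
      (ENNReal.ofReal q < s ∧ κ = n / q - n * s⁻¹.toReal)) :
    0 < κ ∧ HasLocalBound b W (n - α) p q κ := by
  obtain ⟨hn, hpq, hnq, hγ⟩ := exponent_relations hp hα hαp hq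
  have hn0 : (0 : ℝ) < n := by exact_mod_cast hn
  have hp0 : 0 < p := by linarith
  have hq0 : 0 < q := by linarith
  have hconj : ENNReal.conjExponent s ≤ ENNReal.ofReal p →
      0 < (n : ℝ) / q ∧ HasLocalBound b W (n - α) p q (n / q) := by
    intro hsp
    -- The condition s' ≤ p is p' ≤ s, and on the sphere, of finite measure, L_s is contained in
    -- L_{p'}.
    have hps : ENNReal.ofReal (p / (p - 1)) ≤ s := by
      have h1 := ENNReal.HolderConjugate.conjExponent hs.le
      rcases eq_or_ne s ∞ with rfl | hst
      · exact le_top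
      have h2 : 1 < s.toReal := by
        rw [← ENNReal.toReal_one]
        exact (ENNReal.toReal_lt_toReal ENNReal.one_ne_top hst).2 hs
      have h3 := Real.HolderConjugate.conjExponent hp
      have h4 : s⁻¹ + (ENNReal.conjExponent s)⁻¹ = 1 := h1.inv_add_inv_eq_one
      have h5 : (ENNReal.ofReal p)⁻¹ ≤ (ENNReal.conjExponent s)⁻¹ := ENNReal.inv_le_inv.2 hsp
      have h6 : s⁻¹ + (ENNReal.ofReal p)⁻¹ ≤ 1 := h4 ▸ add_le_add le_rfl h5
      rw [← ENNReal.ofReal_toReal hst, ← ENNReal.ofReal_inv_of_pos (by linarith),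
        ← ENNReal.ofReal_inv_of_pos hp0, ← ENNReal.ofReal_add (by positivity) (by positivity),
        ENNReal.ofReal_le_one] at h6
      rw [← ENNReal.ofReal_toReal hst]
      refine ENNReal.ofReal_le_ofReal ?_
      have h7 : (s.toReal)⁻¹ ≤ (p - 1) / p := by
        rw [sub_div, div_self hp0.ne', one_div]; linarith
      have h8 := inv_anti₀ (by positivity) h7
      rwa [inv_inv, inv_div] at h8
    obtain ⟨A, hA⟩ := exists_growthLE hΩ₀ hΩ (div_pos hp0 (by linarith : 0 < p - 1)) hps hn hWΩ
    exact ⟨by positivity, hasLocalBound_of_growthLE_conj hbm hb hN hW hp hα hαp hq hA⟩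
  rcases hκ with ⟨hsp, rfl⟩ | ⟨hqs, rfl⟩
  · exact hconj hsp
  · rcases eq_or_ne s ∞ with rfl | hst
    -- For s = ∞ the two values of κ agree and s' = 1 ≤ p, so the first case covers it.
    · have h1 : ENNReal.conjExponent ∞ ≤ ENNReal.ofReal p := by
        simp [ENNReal.conjExponent, hp.le]
      simpa using hconj h1
    · have hqs' : q < s.toReal := by
        rwa [ENNReal.ofReal_lt_iff_lt_toReal hq0.le hst] at hqs
      obtain ⟨A, hA⟩ := exists_growthLE hΩ₀ hΩ (c := s.toReal) (by linarith)
        ENNReal.ofReal_toReal_le hn hWΩ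
      rw [ENNReal.toReal_inv]
      refine ⟨?_, hasLocalBound_of_growthLE hbm hb hN hW hp hα hαp hq hqs' hA⟩
      rw [div_eq_mul_inv, ← mul_sub]
      exact mul_pos hn0 (sub_pos.2 (inv_strictAnti₀ hq0 hqs'))

end LocalEstimates

end VanishingMorrey

namespace VanishingMorrey

open MeasureTheory Filter Topology Set
open scoped ENNReal NNReal

/-! ### From the local estimate to vanishing Morrey spaces -/

section MorreyBound

variable {n : ℕ} {ε : Type*} [TopologicalSpace ε] [ContinuousENorm ε] {p q κ : ℝ}
  {φ φ₁ φ₂ : Rn n → ℝ → ℝ}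

theorem eLpNorm_ofReal_eq {X : Type*} [MeasurableSpace X] {μ : Measure X} (hq : 0 < q)
    (f : X → ε) : eLpNorm f (ENNReal.ofReal q) μ = (∫⁻ x, ‖f x‖ₑ ^ q ∂μ) ^ (1 / q) := by
  rw [eLpNorm_eq_lintegral_rpow_enorm_toReal (by simpa using hq) ENNReal.ofReal_ne_top,
    ENNReal.toReal_ofReal hq.le]

theorem IsWeight.pos (hφ : IsWeight φ) (x : Rn n) {r : ℝ} (hr : 0 < r) : 0 < φ x r := by
  obtain ⟨c, hc, h⟩ := hφ.inf_pos
  exact hc.trans_le (h x r hr)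

theorem eLpNorm_eq_mul_localRatio (hφ : IsWeight φ) (f : Rn n → ε) (x : Rn n) {r : ℝ}
    (hr : 0 < r) : eLpNorm f (ENNReal.ofReal p) (volume.restrict (Metric.ball x r))
      = ENNReal.ofReal (φ x r) * localRatio p φ f x r := by
  rw [localRatio, ENNReal.mul_inv_cancel_left (by simpa using hφ.pos x hr) ENNReal.ofReal_ne_top]

theorem localRatio_le_morreyNorm (f : Rn n → ε) (x : Rn n) {r : ℝ} (hr : 0 < r) :
    localRatio p φ f x r ≤ morreyNorm p φ f :=
  le_iSup_of_le x (le_iSup_of_le r (le_iSup_of_le hr le_rfl))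

theorem lintegral_log_mul_eLpNorm_le (hφ₁ : IsWeight φ₁) {f : Rn n → ε} (x : Rn n) {r : ℝ}
    (hr : 0 < r) {E : Set ℝ} (hE : MeasurableSet E) (hEr : E ⊆ Ioi r) {M : ℝ≥0∞} (hM : M ≠ ∞)
    (h : ∀ t ∈ E, localRatio p φ₁ f x t ≤ M) :
    ∫⁻ t in E, ENNReal.ofReal ((1 + Real.log (t / r)) / t ^ (κ + 1))
        * eLpNorm f (ENNReal.ofReal p) (volume.restrict (Metric.ball x t))
      ≤ (∫⁻ t in E, ENNReal.ofReal ((1 + Real.log (t / r)) * φ₁ x t / t ^ (κ + 1))) * M := by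
  rw [← lintegral_mul_const' _ _ hM]
  refine setLIntegral_mono' hE fun t ht => ?_
  have htr : r < t := hEr ht
  have ht0 : 0 < t := hr.trans htr
  have hlog : 0 ≤ Real.log (t / r) := Real.log_nonneg ((one_le_div hr).2 htr.le)
  rw [eLpNorm_eq_mul_localRatio hφ₁ f x ht0, ← mul_assoc, ← ENNReal.ofReal_mul (by positivity),
    div_mul_eq_mul_div]
  exact mul_le_mul' le_rfl (h t ht)

theorem tendsto_rpow_mul_one_add_log {δ : ℝ} (hδ : 0 < δ) (hκ : 0 < κ) :
    Tendsto (fun r : ℝ => r ^ κ * (1 + Real.log (δ / r))) (𝓝[>] 0) (𝓝 0) := by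
  have h1 : Tendsto (fun r : ℝ => r ^ κ) (𝓝[>] 0) (𝓝 0) := by
    have := (Real.continuousAt_rpow_const 0 κ (Or.inr hκ.le)).tendsto
    rw [Real.zero_rpow hκ.ne'] at this
    exact this.mono_left nhdsWithin_le_nhds
  have h2 := (h1.mul_const (1 + Real.log δ)).sub (tendsto_log_mul_rpow_nhdsGT_zero hκ)
  rw [zero_mul, sub_zero] at h2
  refine h2.congr' ?_
  filter_upwards [self_mem_nhdsWithin] with r hr
  rw [Real.log_div hδ.ne' (ne_of_gt hr)]
  ring

/-- An operator satisfying the local estimate of Guliyev type is bounded on Morrey spaces. -/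
theorem morrey_le_of_local_bound {ε' : Type*} [TopologicalSpace ε'] [ContinuousENorm ε']
    (hφ₁ : IsWeight φ₁) (hφ₂ : IsWeight φ₂) {C : ℝ≥0} {C₀ : ℝ} (hC₀ : 0 < C₀)
    (hpair : ∀ x : Rn n, ∀ r : ℝ, 0 < r →
      ∫⁻ t in Ioi r, ENNReal.ofReal ((1 + Real.log (t / r)) * φ₁ x t / t ^ (κ + 1)) ≤
        ENNReal.ofReal (C₀ * φ₂ x r / r ^ κ)) {f : Rn n → ε} {g : Rn n → ε'}
    (hf : morreyNorm p φ₁ f < ∞)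
    (hfg : ∀ (x : Rn n) (r : ℝ), 0 < r →
      eLpNorm g (ENNReal.ofReal q) (volume.restrict (Metric.ball x r))
        ≤ C * ENNReal.ofReal r ^ κ * ∫⁻ t in Ioi r,
          ENNReal.ofReal ((1 + Real.log (t / r)) / t ^ (κ + 1))
            * eLpNorm f (ENNReal.ofReal p) (volume.restrict (Metric.ball x t))) :
    morreyNorm q φ₂ g ≤ ENNReal.ofReal (C * C₀) * morreyNorm p φ₁ f := by
  refine iSup_le fun x => iSup_le fun r => iSup_le fun hr => ?_
  have h1 := lintegral_log_mul_eLpNorm_le (p := p) (κ := κ) hφ₁ (f := f) x hr measurableSet_Ioi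
    subset_rfl hf.ne fun t ht => localRatio_le_morreyNorm f x (hr.trans ht)
  have hφ := hφ₂.pos x hr
  calc localRatio q φ₂ g x r
      ≤ (ENNReal.ofReal (φ₂ x r))⁻¹ * (C * ENNReal.ofReal r ^ κ *
          (ENNReal.ofReal (C₀ * φ₂ x r / r ^ κ) * morreyNorm p φ₁ f)) :=
        mul_le_mul' le_rfl ((hfg x r hr).trans (mul_le_mul' le_rfl
          (h1.trans (mul_le_mul' (hpair x r hr) le_rfl))))
    _ = _ := by
        rw [← ENNReal.ofReal_inv_of_pos hφ, ENNReal.ofReal_rpow_of_pos hr,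
          ← ENNReal.ofReal_coe_nnreal, ← mul_assoc (ENNReal.ofReal _ * _), ← mul_assoc,
          ← ENNReal.ofReal_mul (by positivity), ← ENNReal.ofReal_mul (by positivity),
          ← ENNReal.ofReal_mul (by positivity)]
        congr 2
        field_simp

/-- The cut δ is fixed first, so that the local ratios of f below δ are at most η and the pair
condition bounds that part by e/2 uniformly in x. Then r → 0 makes the part above δ small, uniformly
in x because `TailCondition` contains the supremum over x and φ₂ ≥ c. -/
theorem tendsto_localRatio_of_local_bound {ε' : Type*} [TopologicalSpace ε'] [ContinuousENorm ε']
    (hκ : 0 < κ) (hφ₁ : IsWeight φ₁) (hφ₂ : IsWeight φ₂) (htail : TailCondition κ φ₁)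
    {C : ℝ≥0} {C₀ : ℝ} (hC₀ : 0 < C₀)
    (hpair : ∀ x : Rn n, ∀ r : ℝ, 0 < r →
      ∫⁻ t in Ioi r, ENNReal.ofReal ((1 + Real.log (t / r)) * φ₁ x t / t ^ (κ + 1)) ≤
        ENNReal.ofReal (C₀ * φ₂ x r / r ^ κ)) {f : Rn n → ε} {g : Rn n → ε'}
    (hf : MemVM p φ₁ f)
    (hfg : ∀ (x : Rn n) (r : ℝ), 0 < r →
      eLpNorm g (ENNReal.ofReal q) (volume.restrict (Metric.ball x r))
        ≤ C * ENNReal.ofReal r ^ κ * ∫⁻ t in Ioi r,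
          ENNReal.ofReal ((1 + Real.log (t / r)) / t ^ (κ + 1))
            * eLpNorm f (ENNReal.ofReal p) (volume.restrict (Metric.ball x t))) :
    Tendsto (fun r : ℝ => ⨆ x : Rn n, localRatio q φ₂ g x r) (𝓝[>] 0) (𝓝 0) := by
  obtain ⟨c, hc, hcφ⟩ := hφ₂.inf_pos
  set N := morreyNorm p φ₁ f with hN
  have hNt : N ≠ ∞ := hf.1.2.ne
  rw [ENNReal.tendsto_nhds_zero]
  intro e he
  obtain ⟨η, hη0, hηt, hη⟩ : ∃ η : ℝ≥0∞, 0 < η ∧ η ≠ ∞ ∧ ENNReal.ofReal (C * C₀) * η ≤ e / 2 := by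
    rcases eq_or_ne e ∞ with rfl | het
    · exact ⟨1, one_pos, ENNReal.one_ne_top, by simp [ENNReal.top_div_of_ne_top]⟩
    have h0 : ENNReal.ofReal (C * C₀) + 1 ≠ 0 := by simp
    have ht : ENNReal.ofReal (C * C₀) + 1 ≠ ∞ := by finiteness
    have he2 : e / 2 ≠ 0 := by simpa using he.ne'
    refine ⟨e / 2 / (ENNReal.ofReal (C * C₀) + 1), ENNReal.div_pos he2 ht, ?_, ?_⟩
    · exact ENNReal.div_ne_top (ENNReal.div_ne_top het two_ne_zero) h0
    · calc _ ≤ (ENNReal.ofReal (C * C₀) + 1) * (e / 2 / (ENNReal.ofReal (C * C₀) + 1)) := by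
            gcongr; exact le_self_add
        _ = _ := ENNReal.mul_div_cancel h0 ht
  obtain ⟨δ, hδ0, hδ⟩ : ∃ δ : ℝ, 0 < δ ∧ ∀ t, 0 < t → t ≤ δ → ∀ x, localRatio p φ₁ f x t ≤ η := by
    have h1 := (ENNReal.tendsto_nhds_zero.1 hf.2) η hη0
    obtain ⟨u, hu, hu'⟩ := mem_nhdsGT_iff_exists_Ioo_subset.1 h1
    refine ⟨u / 2, half_pos hu, fun t ht htu x => ?_⟩
    have hu0 : (0 : ℝ) < u := hu
    exact (le_iSup (fun x => localRatio p φ₁ f x t) x).trans (hu' ⟨ht, by linarith⟩)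
  set S : ℝ → ℝ≥0∞ := fun t => ⨆ x : Rn n, ENNReal.ofReal (φ₁ x t) with hS
  set T := ∫⁻ t in Ioi δ, ENNReal.ofReal ((1 + Real.log (t / δ)) / t ^ (κ + 1)) * S t with hT
  have hTt : T ≠ ∞ := (htail δ δ hδ0 le_rfl).ne
  have hlim : Tendsto (fun r : ℝ => (ENNReal.ofReal c)⁻¹ * (C * (T * N))
      * ENNReal.ofReal (r ^ κ * (1 + Real.log (δ / r)))) (𝓝[>] 0) (𝓝 0) := by
    have h1 := ENNReal.tendsto_ofReal (tendsto_rpow_mul_one_add_log hδ0 hκ)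
    have h2 : (ENNReal.ofReal c)⁻¹ ≠ ∞ := by simpa using hc
    have h3 := ENNReal.Tendsto.const_mul h1
      (Or.inr (by finiteness : (ENNReal.ofReal c)⁻¹ * (C * (T * N)) ≠ ∞))
    simpa using h3
  have he2 : 0 < e / 2 := ENNReal.half_pos he.ne'
  filter_upwards [ENNReal.tendsto_nhds_zero.1 hlim _ he2, Ioo_mem_nhdsGT hδ0] with r hr1 hr2
  obtain ⟨hr, hrδ⟩ := hr2
  refine iSup_le fun x => ?_
  have hφ := hφ₂.pos x hr
  have hlogr : 0 ≤ Real.log (δ / r) := Real.log_nonneg ((one_le_div hr).2 hrδ.le)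
  have hnear : ∫⁻ t in Ioc r δ, ENNReal.ofReal ((1 + Real.log (t / r)) / t ^ (κ + 1))
        * eLpNorm f (ENNReal.ofReal p) (volume.restrict (Metric.ball x t))
      ≤ ENNReal.ofReal (C₀ * φ₂ x r / r ^ κ) * η := by
    refine (lintegral_log_mul_eLpNorm_le (κ := κ) hφ₁ x hr measurableSet_Ioc Ioc_subset_Ioi_self hηt
      fun t ht => hδ t (hr.trans ht.1) ht.2 x).trans (mul_le_mul' ?_ le_rfl)
    exact (lintegral_mono_set Ioc_subset_Ioi_self).trans (hpair x r hr)
  have hfar : ∫⁻ t in Ioi δ, ENNReal.ofReal ((1 + Real.log (t / r)) / t ^ (κ + 1))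
        * eLpNorm f (ENNReal.ofReal p) (volume.restrict (Metric.ball x t))
      ≤ ENNReal.ofReal (1 + Real.log (δ / r)) * (T * N) := by
    refine (lintegral_log_mul_eLpNorm_le (κ := κ) hφ₁ x hr measurableSet_Ioi
      (Ioi_subset_Ioi hrδ.le) hNt
      fun t ht => localRatio_le_morreyNorm f x (hδ0.trans ht)).trans ?_
    rw [← mul_assoc, hT, ← lintegral_const_mul' _ _ ENNReal.ofReal_ne_top]
    refine mul_le_mul' (setLIntegral_mono' measurableSet_Ioi fun t ht => ?_) le_rfl
    have ht0 : 0 < t := hδ0.trans ht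
    have hlogt : 0 ≤ Real.log (t / δ) := Real.log_nonneg ((one_le_div hδ0).2 (le_of_lt ht))
    -- With both logarithms nonnegative, 1 + A + B ≤ (1 + A)(1 + B) separates t from r.
    have hsplit : Real.log (t / r) = Real.log (t / δ) + Real.log (δ / r) := by
      rw [← Real.log_mul (by positivity) (by positivity), div_mul_div_cancel₀ hδ0.ne']
    have hφt := hφ₁.pos x ht0
    calc ENNReal.ofReal ((1 + Real.log (t / r)) * φ₁ x t / t ^ (κ + 1))
        ≤ ENNReal.ofReal ((1 + Real.log (δ / r)) *
          ((1 + Real.log (t / δ)) / t ^ (κ + 1) * φ₁ x t)) := by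
          refine ENNReal.ofReal_le_ofReal ?_
          rw [div_mul_eq_mul_div, mul_div_assoc', ← mul_assoc]
          gcongr
          rw [hsplit]
          nlinarith
      _ = ENNReal.ofReal (1 + Real.log (δ / r)) *
          (ENNReal.ofReal ((1 + Real.log (t / δ)) / t ^ (κ + 1)) * ENNReal.ofReal (φ₁ x t)) := by
          rw [ENNReal.ofReal_mul (by positivity), ENNReal.ofReal_mul (by positivity)]
      _ ≤ _ := by
          gcongr
          exact le_iSup (fun x => ENNReal.ofReal (φ₁ x t)) x
  calc localRatio q φ₂ g x r
      ≤ (ENNReal.ofReal (φ₂ x r))⁻¹ * (C * ENNReal.ofReal r ^ κ *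
          (ENNReal.ofReal (C₀ * φ₂ x r / r ^ κ) * η
            + ENNReal.ofReal (1 + Real.log (δ / r)) * (T * N))) := by
        refine mul_le_mul' le_rfl ((hfg x r hr).trans (mul_le_mul' le_rfl ?_))
        rw [← Ioc_union_Ioi_eq_Ioi hrδ.le]
        exact (lintegral_union_le _ _ _).trans (add_le_add hnear hfar)
    _ = ENNReal.ofReal (C * C₀) * η + (ENNReal.ofReal (φ₂ x r))⁻¹ * (C * (T * N))
          * ENNReal.ofReal (r ^ κ * (1 + Real.log (δ / r))) := by
        rw [mul_add, mul_add]
        congr 1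
        · rw [← ENNReal.ofReal_inv_of_pos hφ, ENNReal.ofReal_rpow_of_pos hr,
            ← ENNReal.ofReal_coe_nnreal, ← mul_assoc (ENNReal.ofReal _ * _), ← mul_assoc,
            ← ENNReal.ofReal_mul (by positivity), ← ENNReal.ofReal_mul (by positivity),
            ← ENNReal.ofReal_mul (by positivity)]
          congr 2
          field_simp
        · rw [ENNReal.ofReal_mul (by positivity), ENNReal.ofReal_rpow_of_pos hr]
          ring
    _ ≤ e / 2 + e / 2 := by
        refine add_le_add hη (le_trans ?_ hr1)
        gcongr
        exact hcφ x r hr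
    _ = e := ENNReal.add_halves e

theorem isBoundedVM_of_local_bound {𝕜 : Type*} [RCLike 𝕜] (hκ : 0 < κ)
    (hφ₁ : IsWeight φ₁) (hφ₂ : IsWeight φ₂)
    (htail : TailCondition κ φ₁) (hpair : PairCondition κ φ₁ φ₂) {T : (Rn n → 𝕜) → Rn n → ε}
    {C : ℝ≥0}
    (hT : ∀ f : Rn n → 𝕜, MemVM p φ₁ f → AEStronglyMeasurable (T f) volume ∧
      ∀ (x : Rn n) (r : ℝ), 0 < r →
        eLpNorm (T f) (ENNReal.ofReal q) (volume.restrict (Metric.ball x r))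
          ≤ C * ENNReal.ofReal r ^ κ * ∫⁻ t in Ioi r,
            ENNReal.ofReal ((1 + Real.log (t / r)) / t ^ (κ + 1))
              * eLpNorm f (ENNReal.ofReal p) (volume.restrict (Metric.ball x t))) :
    IsBoundedVM p φ₁ q φ₂ T := by
  obtain ⟨C₀, hC₀, hpair⟩ := hpair
  -- The added 1 only keeps the constant positive when C = 0.
  refine ⟨C * C₀ + 1, by positivity, fun f hf => ?_⟩
  obtain ⟨hm, hfg⟩ := hT f hf
  have hnorm := morrey_le_of_local_bound hφ₁ hφ₂ hC₀ hpair hf.1.2 hfg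
  have hfin : morreyNorm q φ₂ (T f) < ∞ :=
    hnorm.trans_lt (ENNReal.mul_lt_top ENNReal.ofReal_lt_top hf.1.2)
  refine ⟨⟨⟨fun K hK => ?_, hfin⟩,
    tendsto_localRatio_of_local_bound hκ hφ₁ hφ₂ htail hC₀ hpair hf hfg⟩, ?_⟩
  · obtain ⟨R, hR, hKR⟩ := hK.isBounded.subset_ball_lt 0 (0 : Rn n)
    refine ⟨hm.restrict, ?_⟩
    refine (eLpNorm_mono_measure _ (Measure.restrict_mono hKR le_rfl)).trans_lt ?_
    rw [eLpNorm_eq_mul_localRatio hφ₂ _ _ hR]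
    exact ENNReal.mul_lt_top ENNReal.ofReal_lt_top
      ((localRatio_le_morreyNorm _ _ hR).trans_lt hfin)
  · refine hnorm.trans ?_
    gcongr
    linarith

end MorreyBound

end VanishingMorrey

namespace VanishingMorrey

open MeasureTheory Filter Topology Set
open scoped ENNReal NNReal

/-! ### Pointwise domination by the positive operator -/

section Domination

variable {n : ℕ} {𝕜 : Type*} [RCLike 𝕜] {Ω b f : Rn n → 𝕜} {α : ℝ}

theorem ae_fst_sub {P : Rn n → Prop} (hP : ∀ᵐ z ∂(volume : Measure (Rn n)), P z) (x : Rn n) :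
    ∀ᵐ y ∂(volume : Measure (Rn n)), P (x - y) :=
  (quasiMeasurePreserving_sub_left_of_right_invariant volume x).ae hP

/-- For fixed x the map y ↦ x - y preserves null sets, so b, Ω and f may be replaced by measurable
representatives. -/
theorem posOp_congr_ae {b' : Rn n → 𝕜} {W W' F F' : Rn n → ℝ≥0∞} (γ : ℝ)
    (hb : b =ᵐ[volume] b') (hW : W =ᵐ[volume] W') (hF : F =ᵐ[volume] F') :
    posOp b W γ F =ᵐ[volume] posOp b' W' γ F' := by
  filter_upwards [hb] with x hx
  refine lintegral_congr_ae ?_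
  filter_upwards [hb, hF, ae_fst_sub hW x] with y h1 h2 h3
  rw [h2, oscWeight, oscWeight, h1, hx, h3]

theorem enorm_fracIntegrand_mul_oscWeight_le (hγ : 0 < n - α) (x y : Rn n) :
    ‖fracIntegrand Ω α f x y‖ₑ * oscWeight b x y
      ≤ ENNReal.ofReal (n - α) * (‖Ω (x - y)‖ₑ * oscWeight b x y * ‖f y‖ₑ
        * rieszKernel (n - α) (x - y)) := by
  rcases eq_or_ne x y with rfl | hxy
  -- On the diagonal the denominator is 0^{n-α} = 0, and division by zero gives 0.
  · simp [fracIntegrand, Real.zero_rpow hγ.ne']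
  · have h0 : x - y ≠ 0 := sub_ne_zero.2 hxy
    have hz : 0 < ‖x - y‖ := norm_pos_iff.2 h0
    have h1 : ‖fracIntegrand Ω α f x y‖ₑ
        = ‖Ω (x - y)‖ₑ * ENNReal.ofReal (‖x - y‖ ^ (-((n : ℝ) - α))) * ‖f y‖ₑ := by
      rw [fracIntegrand, enorm_mul, div_eq_mul_inv, enorm_mul, ← RCLike.ofReal_inv,
        ← Real.rpow_neg hz.le]
      congr 2
      rw [← ofReal_norm, RCLike.norm_ofReal, abs_of_pos (Real.rpow_pos_of_pos hz _)]
    have h2 : ENNReal.ofReal (n - α) * rieszKernel (n - α) (x - y)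
        = ENNReal.ofReal (‖x - y‖ ^ (-((n : ℝ) - α))) := by
      rw [rieszKernel_eq hγ h0, ← ENNReal.ofReal_mul hγ.le, mul_div_cancel₀ _ hγ.ne']
    rw [h1, ← h2]
    exact le_of_eq (by ring)

theorem lintegral_enorm_fracIntegrand_mul_oscWeight_le (hγ : 0 < n - α) (x : Rn n) :
    ∫⁻ y, ‖fracIntegrand Ω α f x y‖ₑ * oscWeight b x y
      ≤ ENNReal.ofReal (n - α) * posOp b (fun z => ‖Ω z‖ₑ) (n - α) (fun y => ‖f y‖ₑ) x := by
  rw [posOp, ← lintegral_const_mul' _ _ ENNReal.ofReal_ne_top]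
  exact lintegral_mono fun y => enorm_fracIntegrand_mul_oscWeight_le hγ x y

theorem aestronglyMeasurable_fracIntegrand (hΩ : AEStronglyMeasurable Ω volume)
    (hf : AEStronglyMeasurable f volume) (x : Rn n) :
    AEStronglyMeasurable (fracIntegrand Ω α f x) volume := by
  have h1 : AEStronglyMeasurable (fun y => Ω (x - y)) volume :=
    hΩ.comp_quasiMeasurePreserving (quasiMeasurePreserving_sub_left_of_right_invariant volume x)
  have h2 : Measurable fun y : Rn n => ((‖x - y‖ ^ ((n : ℝ) - α) : ℝ) : 𝕜) :=
    RCLike.measurable_ofReal.comp (by fun_prop)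
  exact (h1.aemeasurable.div h2.aemeasurable).aestronglyMeasurable.mul hf

theorem aestronglyMeasurable_fracIntegral (hΩ : AEStronglyMeasurable Ω volume)
    (hf : AEStronglyMeasurable f volume) : AEStronglyMeasurable (fracIntegral Ω α f) volume := by
  have h1 : AEStronglyMeasurable (fun q : Rn n × Rn n => Ω (q.1 - q.2))
      (volume.prod volume) :=
    hΩ.comp_quasiMeasurePreserving (quasiMeasurePreserving_sub_of_right_invariant volume volume)
  have h2 : Measurable fun q : Rn n × Rn n => ((‖q.1 - q.2‖ ^ ((n : ℝ) - α) : ℝ) : 𝕜) :=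
    RCLike.measurable_ofReal.comp (by fun_prop)
  have h3 : AEStronglyMeasurable (fun q : Rn n × Rn n => f q.2) (volume.prod volume) :=
    hf.comp_quasiMeasurePreserving Measure.quasiMeasurePreserving_snd
  exact ((h1.aemeasurable.div h2.aemeasurable).aestronglyMeasurable.mul h3).integral_prod_right'

theorem aestronglyMeasurable_fracCommutator (hΩ : AEStronglyMeasurable Ω volume)
    (hb : AEStronglyMeasurable b volume) (hf : AEStronglyMeasurable f volume) :
    AEStronglyMeasurable (fracCommutator Ω b α f) volume :=
  (hb.mul (aestronglyMeasurable_fracIntegral hΩ hf)).sub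
    (aestronglyMeasurable_fracIntegral hΩ (hb.mul hf))

theorem integrable_mul_fracIntegrand (hγ : 0 < n - α) (hΩ : AEStronglyMeasurable Ω volume)
    (hf : AEStronglyMeasurable f volume) {x : Rn n}
    (hx : posOp b (fun z => ‖Ω z‖ₑ) (n - α) (fun y => ‖f y‖ₑ) x < ∞) {m : Rn n → 𝕜}
    (hm : AEStronglyMeasurable m volume) {M : ℝ≥0}
    (hmM : ∀ y, ‖m y‖ₑ ≤ M * oscWeight b x y) :
    Integrable (fun y => m y * fracIntegrand Ω α f x y) volume := by
  refine ⟨hm.mul (aestronglyMeasurable_fracIntegrand hΩ hf x), ?_⟩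
  rw [hasFiniteIntegral_iff_enorm]
  calc ∫⁻ y, ‖m y * fracIntegrand Ω α f x y‖ₑ
      ≤ ∫⁻ y, M * (‖fracIntegrand Ω α f x y‖ₑ * oscWeight b x y) := by
        refine lintegral_mono fun y => ?_
        rw [enorm_mul]
        exact (mul_le_mul' (hmM y) le_rfl).trans_eq (by ring)
    _ ≤ M * (ENNReal.ofReal (n - α) *
          posOp b (fun z => ‖Ω z‖ₑ) (n - α) (fun y => ‖f y‖ₑ) x) := by
        rw [lintegral_const_mul' _ _ ENNReal.coe_ne_top]
        exact mul_le_mul' le_rfl (lintegral_enorm_fracIntegrand_mul_oscWeight_le hγ x)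
    _ < ∞ := by finiteness

theorem fracIntegrand_mul (x y : Rn n) :
    fracIntegrand Ω α (fun y => b y * f y) x y = b y * fracIntegrand Ω α f x y := by
  rw [fracIntegrand, fracIntegrand, mul_left_comm]

theorem fracCommutator_eq (hγ : 0 < n - α) (hΩ : AEStronglyMeasurable Ω volume)
    (hb : AEStronglyMeasurable b volume) (hf : AEStronglyMeasurable f volume) {x : Rn n}
    (hx : posOp b (fun z => ‖Ω z‖ₑ) (n - α) (fun y => ‖f y‖ₑ) x < ∞) :
    Integrable (fracIntegrand Ω α f x) volume ∧
      Integrable (fracIntegrand Ω α (fun y => b y * f y) x) volume ∧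
      fracCommutator Ω b α f x = ∫ y, (b x - b y) * fracIntegrand Ω α f x y := by
  have h1 : Integrable (fracIntegrand Ω α f x) volume := by
    have := integrable_mul_fracIntegrand hγ hΩ hf hx (m := fun _ => 1) (M := 1)
      aestronglyMeasurable_const fun y => by simp [oscWeight]
    simpa using this
  have h2 : Integrable (fun y => b y * fracIntegrand Ω α f x y) volume := by
    refine integrable_mul_fracIntegrand hγ hΩ hf hx (M := 1 + ‖b x‖₊) hb fun y => ?_
    -- For fixed x, |b(y)| is at most (1 + |b(x)|) times the weight, so finiteness of the positive
    -- operator at x also gives integrability for bf.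
    calc ‖b y‖ₑ = ‖b x - (b x - b y)‖ₑ := by rw [sub_sub_cancel]
      _ ≤ ‖b x‖ₑ + ‖b x - b y‖ₑ := enorm_sub_le
      _ ≤ (1 + ‖b x‖ₑ) * (1 + ‖b x - b y‖ₑ) := by
          rw [add_mul, mul_add, mul_add, one_mul, one_mul, mul_one, add_comm ‖b x‖ₑ]
          exact add_le_add le_add_self le_self_add
      _ = _ := by simp [oscWeight, enorm_eq_nnnorm]
  have h3 : fracIntegrand Ω α (fun y => b y * f y) x = fun y => b y * fracIntegrand Ω α f x y :=
    funext fun y => fracIntegrand_mul x y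
  refine ⟨h1, h3 ▸ h2, ?_⟩
  rw [fracCommutator, fracIntegral, fracIntegral, h3, ← integral_const_mul,
    ← integral_sub (h1.const_mul _) h2]
  simp_rw [sub_mul]

theorem enorm_fracCommutator_le (hγ : 0 < n - α) (hΩ : AEStronglyMeasurable Ω volume)
    (hb : AEStronglyMeasurable b volume) (hf : AEStronglyMeasurable f volume) {x : Rn n}
    (hx : posOp b (fun z => ‖Ω z‖ₑ) (n - α) (fun y => ‖f y‖ₑ) x < ∞) :
    ‖fracCommutator Ω b α f x‖ₑ
      ≤ ENNReal.ofReal (n - α) * posOp b (fun z => ‖Ω z‖ₑ) (n - α) (fun y => ‖f y‖ₑ) x := by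
  rw [(fracCommutator_eq hγ hΩ hb hf hx).2.2]
  refine (enorm_integral_le_lintegral_enorm _).trans
    (le_trans (lintegral_mono fun y => ?_) (lintegral_enorm_fracIntegrand_mul_oscWeight_le hγ x))
  rw [enorm_mul, mul_comm, oscWeight]
  gcongr
  exact le_add_self

/-- The factor |B(x,t)|^{-1+α/n} is a multiple of t^{-(n-α)}, which is at most |x-y|^{-(n-α)} for y
∈ B(x,t). -/
theorem fracMaximalCommutator_le (hn : 0 < n) (hγ : 0 < n - α) :
    ∃ C : ℝ≥0, ∀ (f : Rn n → 𝕜) (x : Rn n), fracMaximalCommutator Ω b α f x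
      ≤ C * posOp b (fun z => ‖Ω z‖ₑ) (n - α) (fun y => ‖f y‖ₑ) x := by
  have hn0 : (0 : ℝ) < n := by exact_mod_cast hn
  set a : ℝ := -1 + α / n with ha
  have hna : (n : ℝ) * a = -(n - α) := by rw [ha]; field_simp; ring
  set V := volume (Metric.ball (0 : Rn n) 1) with hV
  have hVa : V ^ a * ENNReal.ofReal (n - α) ≠ ∞ :=
    ENNReal.mul_ne_top (ENNReal.rpow_ne_top_of_ne_zero (volume_ball_ne_zero _ one_pos)
      (volume_ball_ne_top _ _)) ENNReal.ofReal_ne_top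
  refine ⟨(V ^ a * ENNReal.ofReal (n - α)).toNNReal, fun f x => ?_⟩
  rw [ENNReal.coe_toNNReal hVa]
  refine iSup_le fun t => iSup_le fun ht => ?_
  have hvol : volume (Metric.ball x t) ^ a = V ^ a * ENNReal.ofReal (t ^ (-((n : ℝ) - α))) := by
    have h1 := volume_ball_mul_rpow x one_pos ht
    rw [one_mul] at h1
    rw [h1, mul_comm, ENNReal.mul_rpow_of_ne_top (volume_ball_ne_top _ _)
      (ENNReal.rpow_ne_top_of_nonneg hn0.le ENNReal.ofReal_ne_top), ← ENNReal.rpow_mul, hna,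
      ENNReal.ofReal_rpow_of_pos ht]
  have hvt : volume (Metric.ball x t) ^ a ≠ ∞ :=
    ENNReal.rpow_ne_top_of_ne_zero (volume_ball_ne_zero _ ht) (volume_ball_ne_top _ _)
  rw [← lintegral_const_mul' _ _ hvt, posOp, ← lintegral_const_mul' _ _ hVa]
  refine le_trans (setLIntegral_mono' measurableSet_ball fun y hy => ?_)
    (setLIntegral_le_lintegral _ _)
  rcases eq_or_ne x y with rfl | hxy
  · simp
  have h0 : x - y ≠ 0 := sub_ne_zero.2 hxy
  have hz : 0 < ‖x - y‖ := norm_pos_iff.2 h0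
  have hzt : ‖x - y‖ ≤ t := by
    rw [← dist_eq_norm, dist_comm]; exact le_of_lt hy
  have h2 : ENNReal.ofReal (t ^ (-((n : ℝ) - α)))
      ≤ ENNReal.ofReal (n - α) * rieszKernel (n - α) (x - y) := by
    rw [rieszKernel_eq hγ h0, ← ENNReal.ofReal_mul hγ.le, mul_div_cancel₀ _ hγ.ne']
    exact ENNReal.ofReal_le_ofReal (Real.rpow_le_rpow_of_nonpos hz hzt (by linarith))
  calc _ ≤ V ^ a * (ENNReal.ofReal (n - α) * rieszKernel (n - α) (x - y))
        * (oscWeight b x y * ‖Ω (x - y)‖ₑ * ‖f y‖ₑ) := by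
        rw [hvol, oscWeight]
        refine mul_le_mul' (mul_le_mul' le_rfl h2) (mul_le_mul' (mul_le_mul' le_add_self le_rfl)
          le_rfl)
    _ = _ := by ring

end Domination

/-! ### Measurability of the maximal commutator -/

section MaximalMeasurability

variable {n : ℕ} {𝕜 : Type*} [RCLike 𝕜] {Ω b f : Rn n → 𝕜} {α : ℝ}

/-- An open ball is the increasing union of its concentric balls of smaller rational radius, and for
those the factor |B|^a is no smaller because a ≤ 0. A countable supremum preserves measurability. -/
theorem iSup_mul_setLIntegral_ball_eq_iSup_rat {a : ℝ} (ha : a ≤ 0) (x : Rn n)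
    (h : Rn n → ℝ≥0∞) :
    ⨆ (t : ℝ) (_ : 0 < t), volume (Metric.ball x t) ^ a * ∫⁻ y in Metric.ball x t, h y
      = ⨆ (t : ℚ) (_ : 0 < t), volume (Metric.ball x (t : ℝ)) ^ a
        * ∫⁻ y in Metric.ball x (t : ℝ), h y := by
  refine le_antisymm (iSup_le fun t => iSup_le fun ht => ?_)
    (iSup_le fun t => iSup_le fun ht => le_iSup_of_le (t : ℝ)
      (le_iSup_of_le (by exact_mod_cast ht) le_rfl))
  have hU : Metric.ball x t = ⋃ c : {c : ℚ // 0 < c ∧ (c : ℝ) < t}, Metric.ball x (c.1 : ℝ) := by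
    ext y
    simp only [mem_iUnion, Metric.mem_ball, Subtype.exists, exists_prop]
    refine ⟨fun hy => ?_, fun ⟨c, hc, hyc⟩ => hyc.trans hc.2⟩
    obtain ⟨c, hc1, hc2⟩ := exists_rat_btwn hy
    exact ⟨c, ⟨by exact_mod_cast dist_nonneg.trans_lt hc1, hc2⟩, hc1⟩
  have hdir : Directed (· ⊆ ·) fun c : {c : ℚ // 0 < c ∧ (c : ℝ) < t} =>
      Metric.ball x (c.1 : ℝ) := by
    refine Monotone.directed_le fun c d hcd => Metric.ball_subset_ball ?_
    exact_mod_cast hcd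
  conv_lhs => rw [hU, setLIntegral_iUnion_of_directed _ hdir, ← hU, ENNReal.mul_iSup]
  refine iSup_le fun c => le_iSup_of_le c.1 (le_iSup_of_le c.2.1 ?_)
  refine mul_le_mul' ?_ le_rfl
  rw [← neg_neg a, ENNReal.rpow_neg, ENNReal.rpow_neg _ (-a)]
  exact ENNReal.inv_le_inv.2 (ENNReal.rpow_le_rpow
    (measure_mono (Metric.ball_subset_ball c.2.2.le)) (neg_nonneg.2 ha))

theorem aestronglyMeasurable_fracMaximalCommutator (hn : 0 < n) (hγ : 0 < n - α)
    (hΩ : AEStronglyMeasurable Ω volume) (hb : AEStronglyMeasurable b volume)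
    (hf : AEStronglyMeasurable f volume) :
    AEStronglyMeasurable (fracMaximalCommutator Ω b α f) volume := by
  have hn0 : (0 : ℝ) < n := by exact_mod_cast hn
  have ha : -1 + α / n ≤ 0 := by
    have : α / n ≤ 1 := (div_le_one hn0).2 (by linarith)
    linarith
  have hbm := hb.stronglyMeasurable_mk
  have hW := hΩ.stronglyMeasurable_mk.enorm
  have hF := hf.stronglyMeasurable_mk.enorm
  set Φ : Rn n → Rn n → ℝ≥0∞ := fun x y => ‖hb.mk b x - hb.mk b y‖ₑ * ‖hΩ.mk Ω (x - y)‖ₑ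
    * ‖hf.mk f y‖ₑ with hΦ
  have hΦm : Measurable fun q : Rn n × Rn n => Φ q.1 q.2 := by
    have hsub : Measurable fun q : Rn n × Rn n => q.1 - q.2 := measurable_fst.sub measurable_snd
    exact ((((hbm.comp_measurable measurable_fst).sub
      (hbm.comp_measurable measurable_snd)).enorm).mul (hW.comp hsub)).mul (hF.comp measurable_snd)
  have hmeas : Measurable fun x => ⨆ (t : ℚ) (_ : 0 < t),
      volume (Metric.ball x (t : ℝ)) ^ (-1 + α / (n : ℝ))
        * ∫⁻ y in Metric.ball x (t : ℝ), Φ x y := by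
    refine Measurable.iSup fun t => Measurable.iSup fun _ => ?_
    simp_rw [Measure.addHaar_ball_center]
    refine Measurable.const_mul ?_ _
    have h1 : ∀ x, ∫⁻ y in Metric.ball x (t : ℝ), Φ x y = ∫⁻ y,
        {q : Rn n × Rn n | dist q.2 q.1 < t}.indicator (fun q => Φ q.1 q.2) (x, y) := by
      intro x
      rw [← lintegral_indicator measurableSet_ball]; rfl
    simp_rw [h1]
    exact (hΦm.indicator (measurableSet_lt (measurable_snd.dist measurable_fst)
      measurable_const)).lintegral_prod_right'
  refine ⟨_, hmeas.stronglyMeasurable, ?_⟩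
  filter_upwards [hb.ae_eq_mk] with x hx
  rw [fracMaximalCommutator, ← iSup_mul_setLIntegral_ball_eq_iSup_rat ha]
  refine iSup_congr fun t => iSup_congr fun ht => congrArg _ (lintegral_congr_ae ?_)
  refine ae_restrict_of_ae ?_
  filter_upwards [hb.ae_eq_mk, hf.ae_eq_mk, ae_fst_sub hΩ.ae_eq_mk x] with y h1 h2 h3
  simp only [hΦ]
  rw [h1, h2, h3, hx]

end MaximalMeasurability

end VanishingMorrey

namespace VanishingMorrey

open MeasureTheory Filter Topology Set
open scoped ENNReal NNReal

/-! ### Assembly -/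

section Main

variable {n : ℕ} {𝕜 : Type*} [RCLike 𝕜]

theorem oscillationLE_of_memBMO {b b' : Rn n → 𝕜} (hb : MemBMO b) (hbb' : b =ᵐ[volume] b') :
    OscillationLE b' (bmoSeminorm b).toNNReal := by
  intro x r hr
  rw [ENNReal.coe_toNNReal hb.2.ne]
  have h1 : ballAvg b' x r = ⨍ z in Metric.ball x r, b z :=
    average_congr (ae_restrict_of_ae hbb'.symm)
  have h2 : ∫⁻ y in Metric.ball x r, ‖b' y - ballAvg b' x r‖ₑ
      = ∫⁻ y in Metric.ball x r, ‖b y - ⨍ z in Metric.ball x r, b z‖ₑ := by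
    rw [h1]
    exact lintegral_congr_ae (ae_restrict_of_ae (hbb'.mono fun y hy => by simp only [hy]))
  rw [h2, ← ENNReal.div_le_iff_le_mul (Or.inl (volume_ball_ne_zero x hr))
    (Or.inl (volume_ball_ne_top x r)), ENNReal.div_eq_inv_mul]
  exact le_iSup_of_le x (le_iSup_of_le r (le_iSup_of_le hr le_rfl))

theorem MemMorrey.aestronglyMeasurable {p : ℝ} {φ : Rn n → ℝ → ℝ} {f : Rn n → 𝕜}
    (hf : MemMorrey p φ f) : AEStronglyMeasurable f volume := by
  have h := fun k : ℕ => (hf.1 _ (isCompact_closedBall (0 : Rn n) k)).1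
  have h2 := aestronglyMeasurable_iUnion_iff.2 h
  rwa [Metric.iUnion_closedBall_nat, Measure.restrict_univ] at h2

theorem posOp_local_bound {b Ω : Rn n → 𝕜} {γ p q κ : ℝ} (hp : 0 < p)
    {b' : Rn n → 𝕜} {W : Rn n → ℝ≥0∞} (hbb' : b =ᵐ[volume] b')
    (hW : W =ᵐ[volume] fun z => ‖Ω z‖ₑ) (h : HasLocalBound b' W γ p q κ) :
    ∃ C : ℝ≥0, ∀ f : Rn n → 𝕜, AEStronglyMeasurable f volume → ∀ (x : Rn n) (r : ℝ), 0 < r →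
      (∫⁻ y in Metric.ball x r, posOp b (fun z => ‖Ω z‖ₑ) γ (fun z => ‖f z‖ₑ) y ^ q) ^ (1 / q)
        ≤ C * ENNReal.ofReal r ^ κ * ∫⁻ t in Ioi r,
          ENNReal.ofReal ((1 + Real.log (t / r)) / t ^ (κ + 1))
            * eLpNorm f (ENNReal.ofReal p) (volume.restrict (Metric.ball x t)) := by
  obtain ⟨C, hC⟩ := h
  refine ⟨C, fun f hf x r hr => ?_⟩
  have hF : (fun z => ‖f z‖ₑ) =ᵐ[volume] fun z => ‖hf.mk f z‖ₑ :=
    hf.ae_eq_mk.mono fun z hz => by simp only [hz]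
  have hP := posOp_congr_ae γ hbb' hW.symm hF
  have h1 : ∫⁻ y in Metric.ball x r, posOp b (fun z => ‖Ω z‖ₑ) γ (fun z => ‖f z‖ₑ) y ^ q
      = ∫⁻ y in Metric.ball x r, posOp b' W γ (fun z => ‖hf.mk f z‖ₑ) y ^ q :=
    lintegral_congr_ae (ae_restrict_of_ae (hP.mono fun y hy => by simp only [hy]))
  have h2 : ∀ t, eLpNorm f (ENNReal.ofReal p) (volume.restrict (Metric.ball x t))
      = (∫⁻ y in Metric.ball x t, ‖hf.mk f y‖ₑ ^ p) ^ (1 / p) := by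
    intro t
    rw [eLpNorm_congr_ae (ae_restrict_of_ae hf.ae_eq_mk), eLpNorm_ofReal_eq hp]
  simp_rw [h1, h2]
  exact hC x r _ hr hf.stronglyMeasurable_mk.enorm

theorem eLpNorm_ball_le_of_enorm_le {ε : Type*} [TopologicalSpace ε] [ContinuousENorm ε]
    {q : ℝ} (hq : 0 < q) {g : Rn n → ε} {P : Rn n → ℝ≥0∞} {c : ℝ≥0}
    (h : ∀ᵐ x ∂(volume : Measure (Rn n)), ‖g x‖ₑ ≤ c * P x) (x : Rn n) (r : ℝ) :
    eLpNorm g (ENNReal.ofReal q) (volume.restrict (Metric.ball x r))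
      ≤ c * (∫⁻ y in Metric.ball x r, P y ^ q) ^ (1 / q) := by
  have hc : (c : ℝ≥0∞) ^ q ≠ ∞ := ENNReal.rpow_ne_top_of_nonneg hq.le ENNReal.coe_ne_top
  calc eLpNorm g (ENNReal.ofReal q) (volume.restrict (Metric.ball x r))
      ≤ (∫⁻ y in Metric.ball x r, (c * P y) ^ q) ^ (1 / q) := by
        rw [eLpNorm_ofReal_eq hq]
        refine ENNReal.rpow_le_rpow (lintegral_mono_ae (ae_restrict_of_ae ?_)) (by positivity)
        exact h.mono fun y hy => ENNReal.rpow_le_rpow hy hq.le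
    _ = _ := by
        simp_rw [ENNReal.mul_rpow_of_nonneg _ _ hq.le]
        rw [lintegral_const_mul' _ _ hc, ENNReal.mul_rpow_of_nonneg _ _ (by positivity),
          ← ENNReal.rpow_mul, mul_one_div_cancel hq.ne', ENNReal.rpow_one]

theorem lintegral_log_mul_eLpNorm_lt_top {p κ : ℝ} {φ₁ φ₂ : Rn n → ℝ → ℝ} (hφ₁ : IsWeight φ₁)
    (hpair : PairCondition κ φ₁ φ₂) {f : Rn n → 𝕜} (hf : MemMorrey p φ₁ f) (x : Rn n) {r : ℝ}
    (hr : 0 < r) :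
    ∫⁻ t in Ioi r, ENNReal.ofReal ((1 + Real.log (t / r)) / t ^ (κ + 1))
      * eLpNorm f (ENNReal.ofReal p) (volume.restrict (Metric.ball x t)) < ∞ := by
  obtain ⟨C₀, -, hpair⟩ := hpair
  refine (lintegral_log_mul_eLpNorm_le hφ₁ x hr measurableSet_Ioi subset_rfl hf.2.ne
    fun t ht => localRatio_le_morreyNorm f x (hr.trans ht)).trans_lt ?_
  exact ENNReal.mul_lt_top ((hpair x r hr).trans_lt ENNReal.ofReal_lt_top) hf.2

theorem ae_lt_top_of_local_bound {P : Rn n → ℝ≥0∞} (hP : AEMeasurable P volume) {q : ℝ}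
    (hq : 0 < q)
    (h : ∀ r : ℝ, 0 < r → (∫⁻ y in Metric.ball (0 : Rn n) r, P y ^ q) ^ (1 / q) < ∞) :
    ∀ᵐ x ∂(volume : Measure (Rn n)), P x < ∞ := by
  have h1 : ∀ k : ℕ, ∀ᵐ x ∂(volume : Measure (Rn n)),
      x ∈ Metric.ball (0 : Rn n) (k + 1) → P x < ∞ := by
    intro k
    have h2 := h (k + 1) (by positivity)
    rw [ENNReal.rpow_lt_top_iff_of_pos (by positivity)] at h2
    rw [← ae_restrict_iff' measurableSet_ball]
    refine (ae_lt_top' (hP.restrict.pow_const q) h2.ne).mono fun x hx => ?_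
    rwa [ENNReal.rpow_lt_top_iff_of_pos hq] at hx
  filter_upwards [ae_all_iff.2 h1] with x hx
  obtain ⟨k, hk⟩ := mem_iUnion.1 ((Metric.iUnion_ball_nat_succ (0 : Rn n)).symm ▸ mem_univ x)
  exact hx k hk

theorem isBoundedVM_of_enorm_le_mul {ε : Type*} [TopologicalSpace ε] [ContinuousENorm ε]
    {p q κ : ℝ} {φ₁ φ₂ : Rn n → ℝ → ℝ} (hq : 0 < q) (hκ : 0 < κ) (hφ₁ : IsWeight φ₁)
    (hφ₂ : IsWeight φ₂) (htail : TailCondition κ φ₁) (hpair : PairCondition κ φ₁ φ₂)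
    {P : (Rn n → 𝕜) → Rn n → ℝ≥0∞} {T : (Rn n → 𝕜) → Rn n → ε} {c C : ℝ≥0}
    (hP : ∀ f : Rn n → 𝕜, AEStronglyMeasurable f volume → ∀ (x : Rn n) (r : ℝ), 0 < r →
      (∫⁻ y in Metric.ball x r, P f y ^ q) ^ (1 / q)
        ≤ C * ENNReal.ofReal r ^ κ * ∫⁻ t in Ioi r,
          ENNReal.ofReal ((1 + Real.log (t / r)) / t ^ (κ + 1))
            * eLpNorm f (ENNReal.ofReal p) (volume.restrict (Metric.ball x t)))
    (hT : ∀ f : Rn n → 𝕜, MemVM p φ₁ f → AEStronglyMeasurable (T f) volume ∧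
      ∀ᵐ x ∂(volume : Measure (Rn n)), ‖T f x‖ₑ ≤ c * P f x) :
    IsBoundedVM p φ₁ q φ₂ T := by
  refine isBoundedVM_of_local_bound (C := c * C) hκ hφ₁ hφ₂ htail hpair fun f hf =>
    ⟨(hT f hf).1, fun x r hr => ?_⟩
  refine (eLpNorm_ball_le_of_enorm_le hq (hT f hf).2 x r).trans
    ((mul_le_mul' le_rfl (hP f hf.1.aestronglyMeasurable x r hr)).trans_eq ?_)
  rw [ENNReal.coe_mul]
  ring

end Main

end VanishingMorrey

open VanishingMorrey MeasureTheory ENNReal NNReal in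
theorem mainTheorem8 {n : ℕ} {𝕜 : Type*} [RCLike 𝕜]
    (s : ENNReal) (hs : 1 < s)
    (Ω : VanishingMorrey.Rn n → 𝕜)
    (hΩ₀ : VanishingMorrey.IsHomogeneousZero Ω) (hΩ : VanishingMorrey.MemLpSphere Ω s)
    (p q α : ℝ) (hp : 1 < p) (hα : 0 < α) (hαp : α < (n : ℝ) / p)
    (hq : 1 / q = 1 / p - α / (n : ℝ))
    (b : VanishingMorrey.Rn n → 𝕜) (hb : VanishingMorrey.MemBMO b)
    (φ₁ φ₂ : VanishingMorrey.Rn n → ℝ → ℝ)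
    (hφ₁ : VanishingMorrey.IsWeight φ₁) (hφ₂ : VanishingMorrey.IsWeight φ₂)
    (hφ₁' : VanishingMorrey.VMCondition p φ₁) (hφ₂' : VanishingMorrey.VMCondition q φ₂)
    (hcases :
      (ENNReal.conjExponent s ≤ ENNReal.ofReal p ∧
        VanishingMorrey.TailCondition ((n : ℝ) / q) φ₁ ∧
        VanishingMorrey.PairCondition ((n : ℝ) / q) φ₁ φ₂) ∨
      (ENNReal.ofReal q < s ∧
        VanishingMorrey.TailCondition ((n : ℝ) / q - (n : ℝ) * (s⁻¹).toReal) φ₁ ∧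
        VanishingMorrey.PairCondition ((n : ℝ) / q - (n : ℝ) * (s⁻¹).toReal) φ₁ φ₂)) :
    VanishingMorrey.IsBoundedVM p φ₁ q φ₂
        (fun f : VanishingMorrey.Rn n → 𝕜 => VanishingMorrey.fracMaximalCommutator Ω b α f) ∧
      (∀ f : VanishingMorrey.Rn n → 𝕜, VanishingMorrey.MemVM p φ₁ f →
        ∀ᵐ x ∂(MeasureTheory.volume : MeasureTheory.Measure (VanishingMorrey.Rn n)),
          MeasureTheory.Integrable (VanishingMorrey.fracIntegrand Ω α f x)
              MeasureTheory.volume ∧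
            MeasureTheory.Integrable (VanishingMorrey.fracIntegrand Ω α (fun y => b y * f y) x)
              MeasureTheory.volume ∧
            VanishingMorrey.fracCommutator Ω b α f x =
              ∫ y, (b x - b y) * VanishingMorrey.fracIntegrand Ω α f x y) ∧
      VanishingMorrey.IsBoundedVM p φ₁ q φ₂
        (fun f : VanishingMorrey.Rn n → 𝕜 => VanishingMorrey.fracCommutator Ω b α f) := by
  obtain ⟨hn, hpq, -, hγ⟩ := exponent_relations hp hα hαp hq
  have hp0 : 0 < p := by linarith
  have hq0 : 0 < q := by linarith
  have hΩm := aestronglyMeasurable_of_sphere hΩ₀ hΩ.1 hn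
  have hbm := hb.1.aestronglyMeasurable
  -- The two cases differ from here on only in the value of κ.
  obtain ⟨κ, hκ, htail, hpair⟩ : ∃ κ : ℝ,
      ((ENNReal.conjExponent s ≤ ENNReal.ofReal p ∧ κ = n / q) ∨
        (ENNReal.ofReal q < s ∧ κ = n / q - n * s⁻¹.toReal)) ∧
      TailCondition κ φ₁ ∧ PairCondition κ φ₁ φ₂ := by
    rcases hcases with ⟨h1, h2, h3⟩ | ⟨h1, h2, h3⟩
    · exact ⟨_, Or.inl ⟨h1, rfl⟩, h2, h3⟩
    · exact ⟨_, Or.inr ⟨h1, rfl⟩, h2, h3⟩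
  have hWΩ : (fun z => ‖hΩm.mk Ω z‖ₑ) =ᵐ[volume] fun z => ‖Ω z‖ₑ :=
    hΩm.ae_eq_mk.mono fun z hz => by simp only [hz]
  obtain ⟨hκ0, hloc⟩ := hasLocalBound_of_memLpSphere hbm.stronglyMeasurable_mk
    (hb.1.congr hbm.ae_eq_mk) (oscillationLE_of_memBMO hb hbm.ae_eq_mk) hΩ₀ hs hΩ
    hΩm.stronglyMeasurable_mk.enorm hWΩ hp hα hαp hq hκ
  obtain ⟨C, hC⟩ := posOp_local_bound hp0 hbm.ae_eq_mk hWΩ hloc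
  -- By the pair condition the right side of the local estimate is finite on every B(0,r), so the
  -- positive operator is finite almost everywhere. This gives the absolute convergence and the
  -- integral formula for the commutator.
  have hfin : ∀ f : Rn n → 𝕜, MemVM p φ₁ f → ∀ᵐ x ∂(volume : Measure (Rn n)),
      posOp b (fun z => ‖Ω z‖ₑ) (n - α) (fun z => ‖f z‖ₑ) x < ∞ := by
    intro f hf
    have hfm := hf.1.aestronglyMeasurable
    refine ae_lt_top_of_local_bound ?_ hq0 fun r hr => (hC f hfm 0 r hr).trans_lt ?_
    · have hF : (fun z => ‖f z‖ₑ) =ᵐ[volume] fun z => ‖hfm.mk f z‖ₑ :=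
        hfm.ae_eq_mk.mono fun z hz => by simp only [hz]
      exact ⟨_, measurable_posOp hbm.stronglyMeasurable_mk hΩm.stronglyMeasurable_mk.enorm
        hfm.stronglyMeasurable_mk.enorm _, posOp_congr_ae _ hbm.ae_eq_mk hWΩ.symm hF⟩
    · have h1 := lintegral_log_mul_eLpNorm_lt_top hφ₁ hpair hf.1 0 hr
      have h2 : ENNReal.ofReal r ^ κ ≠ ∞ :=
        ENNReal.rpow_ne_top_of_nonneg hκ0.le ENNReal.ofReal_ne_top
      exact ENNReal.mul_lt_top (ENNReal.mul_lt_top ENNReal.coe_lt_top h2.lt_top) h1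
  refine ⟨?_, fun f hf => ?_, ?_⟩
  · obtain ⟨c, hc⟩ := fracMaximalCommutator_le (Ω := Ω) (b := b) hn hγ
    refine isBoundedVM_of_enorm_le_mul (c := c) hq0 hκ0 hφ₁ hφ₂ htail hpair hC
      fun f hf =>
      ⟨aestronglyMeasurable_fracMaximalCommutator hn hγ hΩm hbm hf.1.aestronglyMeasurable, ?_⟩
    exact Filter.Eventually.of_forall fun x => hc f x
  · filter_upwards [hfin f hf] with x hx
    exact fracCommutator_eq hγ hΩm hbm hf.1.aestronglyMeasurable hx
  · refine isBoundedVM_of_enorm_le_mul (c := (n - α : ℝ).toNNReal) hq0 hκ0 hφ₁ hφ₂ htail hpair hC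
      fun f hf =>
        ⟨aestronglyMeasurable_fracCommutator hΩm hbm hf.1.aestronglyMeasurable, ?_⟩
    filter_upwards [hfin f hf] with x hx
    exact enorm_fracCommutator_le hγ hΩm hbm hf.1.aestronglyMeasurable hx
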